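/- Let $n\ge 4$ and let $\Gamma=\langle a,x\mid a^{2(n-2)}=1,\ x^2=a^{n-2},\ x^{-1}ax=a^{-1}\rangle$ be the binary dihedral group of order $4(n-2)$, with simple representations $E_1$ (trivial), $E_2,E_3,E_4$ of dimension one and $U_1,\dots,U_{n-3}$ of dimension two, where $U_1=O_1=\mathbb{C}^2$ is the natural representation. With $\zeta=e^{\pi i/(n-2)}$, the generators act on $U_k$ by $a\mapsto\operatorname{diag}(\zeta^{k},\zeta^{-k})$, $x\mapsto i^k\begin{pmatrix}0&1\\1&0\end{pmatrix}$, and on $E_1,E_2,E_3,E_4$ by $a\mapsto 1,1,-1,-1$, $x\mapsto 1,-1,i^{n-2},-i^{n-2}$. A Clebsch–Gordan datum $\varphi$ is a family of bilinear maps $\varphi_{V,W}\colon V\otimes W\to\bigoplus_X X^{c_{VWX}}$, where $V,W,X$ run over the simple representations and $c_{VWX}\in\{0,1\}$ is the multiplicity of $X$ in $V\otimes W$; write $\varphi_{V,W;X}$ for its components. It is regular if every $\varphi_{V,W}$ is an isomorphism of $\Gamma$-representations and $\varphi_{E_1,V}$, $\varphi_{V,E_1}$ are identities. Let $\varphi^{(0)}$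 be a regular Clebsch–Gordan datum such that (in the standard bases, with $e_1\otimes e_1,e_1\otimes e_2,e_2\otimes e_1,e_2\otimes e_2$ as basis of a tensor product of two-dimensional spaces) $$\varphi^{(0)}_{E_i,E_j}=1,\quad \varphi^{(0)}_{E_2,O_1}=\begin{pmatrix}1&0\\0&-1\end{pmatrix},\quad \varphi^{(0)}_{E_3,O_1;U_{n-3}}=\begin{pmatrix}0&1\\-1&0\end{pmatrix},\quad \varphi^{(0)}_{E_4,O_1;U_{n-3}}=\begin{pmatrix}0&1\\1&0\end{pmatrix},$$ $$\varphi^{(0)}_{U_k,O_1;U_{k-1}}=\begin{pmatrix}0&1&0&0\\0&0&-1&0\end{pmatrix}\ (2\le k\le n-3),\qquad \varphi^{(0)}_{U_k,O_1;U_{k+1}}=\begin{pmatrix}2&0&0&0\\0&0&0&2\end{pmatrix}\ (1\le k\le n-4),$$ $$\varphi^{(0)}_{O_1,O_1;E_1}=(0\ \,1\ \,{-1}\ \,0),\quad \varphi^{(0)}_{O_1,O_1;E_2}=(0\ \,1\ \,1\ \,0),\quad \varphi^{(0)}_{U_{n-3},O_1;E_3}=(1\ \,0\ \,0\ \,1),\quad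 \varphi^{(0)}_{U_{n-3},O_1;E_4}=(1\ \,0\ \,0\ \,{-1}).$$ The group $\operatorname{GL}=\prod_{V\ne E_1}\operatorname{GL}(V)$ acts on Clebsch–Gordan data by change of basis, and $\mathrm{CG}_\Gamma=\overline{\operatorname{GL}\varphi^{(0)}}$. Let $Q$ be the extended Dynkin quiver of type $D_n$ with arrows $E_1\to O_1$, $E_2\to O_1$, $U_k\to U_{k+1}$ $(1\le k\le n-4)$, $U_{n-3}\to E_3$, $U_{n-3}\to E_4$, let $\alpha$ be the vector of dimensions of the simple representations, and let $\operatorname{Rep}(\Pi_Q,\alpha)$ be the variety of $\alpha$-dimensional representations of the double quiver $\overline Q$ with $\sum_{h(b)=v}b\,b^*-\sum_{t(b)=v}b^*b=0$ at every vertex $v$. For $\varphi\in\mathrm{CG}_\Gamma$ and $y\in\mathbb{C}^2$ let $R(\varphi,y)$ be the representation of $\overline Q$ in which the arrow $V\to W$ acts as $u\mapsto\varphi_{V,O_1;W}(u\otimes y)$. Let $\theta_2$ be $+1$ at all vertices other than $E_1$ and $-(2n-3)$ at $E_1$, so that $\theta_2\cdot\alpha=0$. A representation $\rho\in\operatorname{Rep}(\Pi_Q,\alpha)$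 is $\theta_2$-semistable if $\theta_2\cdot\dim\eta\ge 0$ for every subrepresentation $\eta\subset\rho$, and lies in the nullcone if there is an algebraic one-parameter subgroup $g\colon\mathbb{C}^*\to\operatorname{GL}_\alpha=\prod_V \operatorname{GL}(V)$ with $g(t)\rho\to 0$ as $t\to 0$. Then every $\theta_2$-semistable $\rho\in\operatorname{Rep}(\Pi_Q,\alpha)$ in the nullcone lies in the image of $R$: there are $\varphi\in\mathrm{CG}_\Gamma$ and $y\in\mathbb{C}^2$ with $R(\varphi,y)=\rho$. -/

import Mathlib

open scoped Kronecker

noncomputable section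

namespace KleinianD

/-! ### The simple representations of the binary dihedral group -/

/-- Labels of the simple representations of the binary dihedral group of order `4(n-2)`, which are
also the vertices of the extended Dynkin quiver of type `D_n` (for `n ≥ 4`).
`Sum.inl i` is the one-dimensional representation `E_{i+1}`, with `E_1` trivial, and `Sum.inr k`,
for `0 ≤ k ≤ n-4`, is the two-dimensional representation `O_{k+1}` (`k` even) or `I_{k+1}`
(`k` odd). -/
abbrev Vertex (n : ℕ) : Type := Fin 4 ⊕ Fin (n - 4 + 1)

/-- The trivial representation `E_1`. -/
abbrev E₁ (n : ℕ) : Vertex n := Sum.inl 0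

/-- The natural two-dimensional representation `O_1`. -/
abbrev O₁ (n : ℕ) : Vertex n := Sum.inr 0

/-- The last two-dimensional representation (`O_{n-3}` or `I_{n-3}`). It equals `O_1` for `n = 4`. -/
abbrev lastV (n : ℕ) : Vertex n := Sum.inr (Fin.last (n - 4))

/-- Dimensions of the simple representations; this is also the dimension vector `α`. -/
abbrev dim (n : ℕ) : Vertex n → ℕ
  | Sum.inl _ => 1
  | Sum.inr _ => 2

/-- The root of unity `exp(π i / (n - 2))`. -/
def zeta (n : ℕ) : ℂ := Complex.exp (Real.pi * Complex.I / ((n : ℂ) - 2))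

/-- The action of the generator `a` of
`⟨a, x | a^(2(n-2)) = 1, x² = a^(n-2), x⁻¹ a x = a⁻¹⟩` on the simple representation `v`. -/
def actA (n : ℕ) : (v : Vertex n) → Matrix (Fin (dim n v)) (Fin (dim n v)) ℂ
  | Sum.inl i => Matrix.of fun _ _ => ![1, 1, -1, -1] i
  | Sum.inr k => (!![zeta n ^ (k.val + 1), 0; 0, (zeta n)⁻¹ ^ (k.val + 1)] :
      Matrix (Fin 2) (Fin 2) ℂ)

/-- The action of the generator `x` on the simple representation `v`. The natural
representation is given by `a ↦ diag(ζ, ζ⁻¹)` and `x ↦ !![0, i; i, 0]`, which works for `n` of either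
parity. -/
def actX (n : ℕ) : (v : Vertex n) → Matrix (Fin (dim n v)) (Fin (dim n v)) ℂ
  | Sum.inl i => Matrix.of fun _ _ => ![1, -1, Complex.I ^ (n - 2), -Complex.I ^ (n - 2)] i
  | Sum.inr k => (!![0, Complex.I ^ (k.val + 1); Complex.I ^ (k.val + 1), 0] :
      Matrix (Fin 2) (Fin 2) ℂ)

/-! ### Clebsch-Gordan data -/

/-- Matrices of linear maps `U_i ⊗ U_j → U_k` in the standard bases (the basis vector
`e_a ⊗ e_b` has index `(a, b)`). -/
abbrev BilinMat (n : ℕ) (i j k : Vertex n) : Type :=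
  Matrix (Fin (dim n k)) (Fin (dim n i) × Fin (dim n j)) ℂ

/-- The map `U_i ⊗ U_j → U_k` commutes with the binary dihedral group, i.e. with its generators. -/
def IsEquivariant (n : ℕ) (i j k : Vertex n) (T : BilinMat n i j k) : Prop :=
  T * (actA n i ⊗ₖ actA n j) = actA n k * T ∧ T * (actX n i ⊗ₖ actX n j) = actX n k * T

/-- `U_k` occurs in `U_i ⊗ U_j`, i.e. the Clebsch-Gordan coefficient `c_{ijk}` is nonzero.
For the binary dihedral groups every Clebsch-Gordan coefficient is `0` or `1`. -/
def Occurs (n : ℕ) (i j k : Vertex n) : Prop :=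
  ∃ T : BilinMat n i j k, IsEquivariant n i j k T ∧ T ≠ 0

/-- The ambient affine space of Clebsch-Gordan data: families of bilinear maps
`φ_{i,j} : U_i ⊗ U_j → ⨁_k U_k^{c_{ijk}}`, listed through their components `φ_{i,j;k}`. The
components with `c_{ijk} = 0` vanish on all data considered below. -/
abbrev CGDatum (n : ℕ) : Type := (i j k : Vertex n) → BilinMat n i j k

/-- A Clebsch-Gordan datum is regular if every `φ_{i,j} : U_i ⊗ U_j → ⨁_k U_k^{c_{ijk}}` is an
isomorphism of representations and `φ_{0,i}`, `φ_{i,0}` are identities. -/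
structure IsRegular {n : ℕ} (φ : CGDatum n) : Prop where
  equivariant : ∀ i j k, IsEquivariant n i j k (φ i j k)
  bijective : ∀ i j, Set.BijOn
    (fun (w : Fin (dim n i) × Fin (dim n j) → ℂ) (k : Vertex n) => (φ i j k).mulVec w)
    Set.univ {z : (k : Vertex n) → Fin (dim n k) → ℂ | ∀ k, ¬ Occurs n i j k → z k = 0}
  left_unit : ∀ i, φ (E₁ n) i i = Matrix.of fun c p => if c = p.2 then 1 else 0
  right_unit : ∀ i, φ i (E₁ n) i = Matrix.of fun c p => if c = p.1 then 1 else 0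

/-- Read a `p × (q r)` matrix as the matrix of a map `ℂ^q ⊗ ℂ^r → ℂ^p` with respect to the
lexicographically ordered basis `e_1 ⊗ e_1, e_1 ⊗ e_2, …` of the tensor product. -/
def tensorMat {p q r : ℕ} (A : Matrix (Fin p) (Fin (q * r)) ℂ) :
    Matrix (Fin p) (Fin q × Fin r) ℂ :=
  A.submatrix id finProdFinEquiv

/-- The normalisation of the entries `φ_{E_i,E_j}`, `φ_{E_i,O_1}` and `φ_{U,O_1}`
(`U` two-dimensional) of the Clebsch-Gordan datum `φ⁽⁰⁾`. -/
structure HasStandardEntries {n : ℕ} (φ : CGDatum n) : Prop where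
  E_E : ∀ i j l : Fin 4, Occurs n (Sum.inl i) (Sum.inl j) (Sum.inl l) →
    φ (Sum.inl i) (Sum.inl j) (Sum.inl l) = Matrix.of fun _ _ => 1
  E₂_O₁ : φ (Sum.inl 1) (O₁ n) (O₁ n) = tensorMat (q := 1) (r := 2) !![1, 0; 0, -1]
  E₃_O₁ : φ (Sum.inl 2) (O₁ n) (lastV n) = tensorMat (q := 1) (r := 2) !![0, 1; -1, 0]
  E₄_O₁ : φ (Sum.inl 3) (O₁ n) (lastV n) = tensorMat (q := 1) (r := 2) !![0, 1; 1, 0]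
  V_O₁_down : ∀ k : Fin (n - 4), φ (Sum.inr k.succ) (O₁ n) (Sum.inr k.castSucc) =
    tensorMat (q := 2) (r := 2) !![0, 1, 0, 0; 0, 0, -1, 0]
  V_O₁_up : ∀ k : Fin (n - 4), φ (Sum.inr k.castSucc) (O₁ n) (Sum.inr k.succ) =
    tensorMat (q := 2) (r := 2) !![2, 0, 0, 0; 0, 0, 0, 2]
  O₁_O₁_E₁ : φ (O₁ n) (O₁ n) (E₁ n) = tensorMat (q := 2) (r := 2) !![0, 1, -1, 0]
  O₁_O₁_E₂ : φ (O₁ n) (O₁ n) (Sum.inl 1) = tensorMat (q := 2) (r := 2) !![0, 1, 1, 0]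
  last_O₁_E₃ : φ (lastV n) (O₁ n) (Sum.inl 2) = tensorMat (q := 2) (r := 2) !![1, 0, 0, 1]
  last_O₁_E₄ : φ (lastV n) (O₁ n) (Sum.inl 3) = tensorMat (q := 2) (r := 2) !![1, 0, 0, -1]

/-- The group `∏_v GL(U_v)`, the product over all vertices. -/
abbrev GLα (n : ℕ) : Type := (v : Vertex n) → GL (Fin (dim n v)) ℂ

/-- Change of basis on Clebsch-Gordan data: `(gφ)_{ij} = (⨁ g_k) ∘ φ_{ij} ∘ (g_i⁻¹ ⊗ g_j⁻¹)`. -/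
def gaugeCG {n : ℕ} (g : GLα n) (φ : CGDatum n) : CGDatum n := fun i j k =>
  (g k).val * φ i j k * ((g i)⁻¹.val ⊗ₖ (g j)⁻¹.val)

/-- The Clebsch-Gordan variety: the closure of the orbit of `φ₀` under the gauge group
`∏_{v ≠ E_1} GL(U_v)` (encoded as the elements with trivial component at `E_1`). The closure is
taken in the Euclidean topology; for orbits of algebraic groups it agrees with the Zariski closure. -/
def CGVariety {n : ℕ} (φ₀ : CGDatum n) : Set (CGDatum n) :=
  closure {φ | ∃ g : GLα n, g (E₁ n) = 1 ∧ φ = gaugeCG g φ₀}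

/-! ### Representations of the preprojective algebra -/

/-- `IsArrow n i j`: the Kleinian quiver `Q` of type `D_n` has a (unique) arrow `i → j`. The arrows
are `E_1 → O_1`, `E_2 → O_1`, `U_k → U_{k+1}` along the chain of two-dimensional vertices, and
`U_{n-3} → E_3`, `U_{n-3} → E_4`. -/
def IsArrow (n : ℕ) : Vertex n → Vertex n → Prop
  | Sum.inl i, Sum.inr k => (i = 0 ∨ i = 1) ∧ k = 0
  | Sum.inr k, Sum.inr l => l.val = k.val + 1
  | Sum.inr k, Sum.inl i => k = Fin.last (n - 4) ∧ (i = 2 ∨ i = 3)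
  | Sum.inl _, Sum.inl _ => False

/-- The arrows of the double quiver, as pairs (tail, head): the arrows of `Q` and their reverses. -/
abbrev DArrow (n : ℕ) : Type := {e : Vertex n × Vertex n // IsArrow n e.1 e.2 ∨ IsArrow n e.2 e.1}

/-- Representations of the double quiver with dimension vector `α`. -/
abbrev DoubleRep (n : ℕ) : Type :=
  (e : DArrow n) → Matrix (Fin (dim n e.1.2)) (Fin (dim n e.1.1)) ℂ

/-- The matrix of the arrow `i → j` in a representation of the double quiver. -/
def DoubleRep.map {n : ℕ} (ρ : DoubleRep n) (i j : Vertex n) (h : IsArrow n i j ∨ IsArrow n j i) :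
    Matrix (Fin (dim n j)) (Fin (dim n i)) ℂ :=
  ρ ⟨(i, j), h⟩

open Classical in
/-- `Rep(Π_Q, α)`: the representations which satisfy the preprojective relation
`∑_{h(a) = v} a a^* - ∑_{t(a) = v} a^* a = 0` at every vertex `v`. -/
def RepPreproj (n : ℕ) : Set (DoubleRep n) :=
  {ρ | ∀ v : Vertex n,
    (∑ w : Vertex n, if h : IsArrow n w v then
        DoubleRep.map ρ w v (Or.inl h) * DoubleRep.map ρ v w (Or.inr h) else 0) -
    (∑ w : Vertex n, if h : IsArrow n v w then
        DoubleRep.map ρ w v (Or.inr h) * DoubleRep.map ρ v w (Or.inl h) else 0) = 0}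

/-- A family of subspaces which is stable under all arrows. -/
def IsSubrep {n : ℕ} (ρ : DoubleRep n) (W : (v : Vertex n) → Submodule ℂ (Fin (dim n v) → ℂ)) :
    Prop :=
  ∀ e : DArrow n, ∀ u ∈ W e.1.1, (ρ e).mulVec u ∈ W e.1.2

/-- `θ`-semistability: `θ · α = 0` and `θ · dim η ≥ 0` for every nontrivial strict
subrepresentation `η`. -/
def IsSemistable {n : ℕ} (θ : Vertex n → ℤ) (ρ : DoubleRep n) : Prop :=
  ∑ v, θ v * (dim n v : ℤ) = 0 ∧
  ∀ W : (v : Vertex n) → Submodule ℂ (Fin (dim n v) → ℂ), IsSubrep ρ W → W ≠ ⊥ → W ≠ ⊤ →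
    0 ≤ ∑ v, θ v * (Module.finrank ℂ (W v) : ℤ)

/-- The stability parameter `θ₂ = (+1, …, +1)` of the gauge group; the value at `E_1` is the one
enforced by `θ₂ · α = 0`. -/
def θ₂ (n : ℕ) (v : Vertex n) : ℤ := if v = E₁ n then -(2 * (n : ℤ) - 3) else 1

/-- The action of `GL_α` on representations of the double quiver. -/
def gaugeRep {n : ℕ} (g : GLα n) (ρ : DoubleRep n) : DoubleRep n := fun e =>
  (g e.1.2).val * ρ e * (g e.1.1)⁻¹.val

/-- A homomorphism `ℂ^* → GL_α` is algebraic: its entries are Laurent polynomials in `t`. -/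
def IsAlgebraic {n : ℕ} (g : ℂˣ →* GLα n) : Prop :=
  ∀ (v : Vertex n) (p q : Fin (dim n v)), ∃ (f : Polynomial ℂ) (N : ℕ), ∀ t : ℂˣ,
    (g t v).val p q * (t : ℂ) ^ N = f.eval (t : ℂ)

/-- The nullcone: the elements `ρ` of `Rep(Π_Q, α)` for which there is a one-parameter subgroup `g`
of `GL_α` with `g(t) ρ → 0` as `t → 0`. -/
def nullcone (n : ℕ) : Set (DoubleRep n) :=
  {ρ | ρ ∈ RepPreproj n ∧ ∃ g : ℂˣ →* GLα n, IsAlgebraic g ∧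
    Filter.Tendsto (fun t : ℂˣ => gaugeRep (g t) ρ)
      (Filter.comap (fun t : ℂˣ => (t : ℂ)) (nhds 0)) (nhds 0)}

/-! ### The comparison map -/

/-- `R(φ, x) = φ(- ⊗ x)` for `x ∈ ℂ² = O_1`: the arrow `i → j` acts as
`U_i → U_j, u ↦ φ_{i,O_1;j}(u ⊗ x)`. -/
def R {n : ℕ} (φ : CGDatum n) (x : Fin (dim n (O₁ n)) → ℂ) : DoubleRep n := fun e =>
  Matrix.of fun c a => ∑ b, φ e.1.1 (O₁ n) e.1.2 c (a, b) * x b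

/-- The image of `R` on `CG × ℂ²`, where `CG` is the Clebsch-Gordan variety of `φ₀`. -/
def imageR {n : ℕ} (φ₀ : CGDatum n) : Set (DoubleRep n) :=
  {ρ | ∃ φ ∈ CGVariety φ₀, ∃ x : Fin (dim n (O₁ n)) → ℂ, R φ x = ρ}

end KleinianD

end

noncomputable section

namespace KleinianD

open Filter Topology

/-! ### Schur's lemma -/

/-! Since `θ₂` is positive away from `E_1`, a semistable representation has no proper
subrepresentation containing `E_1`: it is generated by its vector there (`IsSemistable.eq_top`). Two
facts about generated representations then give the theorem.

The first is a properness statement, `mem_imageR_of_mem_closure`: a generated `ρ` which is a limit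
of representations `R(ψ, y)`, with `ψ` in the orbit of `φ⁽⁰⁾`, is itself in the image of `R`. By
Schur's lemma and multiplicity one, a regular datum is associative with certain structure constants
(`IsRegular.exists_assocWith`), and these do not change under base change (`AssocWith.gaugeCG`).
Associativity expresses left multiplication by `φ(v ⊗ y)` through left multiplication by `v` and the
arrows of `R(φ, y)`. Beginning with the unit of `E_1`, left multiplication by any vector reached
along arrows is therefore a polynomial in `R(ψ, y)`, uniformly on the orbit. If `ρ` is generated,
such vectors form bases of all the spaces at `ρ`, hence also near `ρ`, so `ψ` is a continuous
function of `R(ψ, y)` and converges along with it.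

The second fact is that every generated representation satisfying the preprojective relations is
such a limit (`QuiverData.IsGenerated.mem_closure`). The relations give an endomorphism `X` of each
two-dimensional space, commuting with transport along the chain; the scalar `d = (Q_0·P_1)(Q_1·P_0)`
governs `X²` on the vectors transported from `E_1` and `E_2`. If `d ≠ 0`, diagonalising `X` brings
the representation to the form `R(φ⁽⁰⁾, y)` (`IsChainEnd.exists_isBaseChange`).

If `d = 0`, the representation is deformed to one with `d ≠ 0`. Let `y_k` be the vector at position
`k` of the chain transported from `E_1`. When `Q_1·P_0 ≠ 0` and `y_k`, `X y_k` form a basis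
everywhere, only the end of the chain has to move (`IsChainEnd.exists_deformation`). Otherwise
generation forces a new vector to enter from `E_3` and `E_4` and to travel back along the chain
(`QuiverData.IsGenerated.exists_isReturn`). This leaves two explicit families, according to whether
`X y_k` vanishes from the start (`flatData`) or only from a later position on (`bentData`). -/

lemma isPrimitiveRoot_zeta {n : ℕ} (hn : 4 ≤ n) : IsPrimitiveRoot (zeta n) (2 * (n - 2)) := by
  have h := Complex.isPrimitiveRoot_exp (2 * (n - 2)) (by omega)
  have h2 : ((n : ℂ) - 2) ≠ 0 := by
    have : ((n - 2 : ℕ) : ℂ) ≠ 0 := by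
      exact_mod_cast (by omega : n - 2 ≠ 0)
    rwa [Nat.cast_sub (by omega)] at this
  have e : zeta n = Complex.exp (2 * Real.pi * Complex.I / ((2 * (n - 2) : ℕ) : ℂ)) := by
    rw [zeta]
    congr 1
    push_cast [Nat.cast_sub (show 2 ≤ n by omega)]
    field_simp
  rw [e]
  exact h

lemma zeta_ne_zero (n : ℕ) : zeta n ≠ 0 := Complex.exp_ne_zero _

lemma zeta_pow_ne_one {n : ℕ} (hn : 4 ≤ n) {k : ℕ} (h0 : k ≠ 0) (hk : k < 2 * (n - 2)) :
    zeta n ^ k ≠ 1 :=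
  (isPrimitiveRoot_zeta hn).pow_ne_one_of_pos_of_lt h0 hk

lemma zeta_pow_inj {n : ℕ} (hn : 4 ≤ n) {k l : ℕ} (hk : k < 2 * (n - 2)) (hl : l < 2 * (n - 2))
    (h : zeta n ^ k = zeta n ^ l) : k = l :=
  (isPrimitiveRoot_zeta hn).pow_inj hk hl h

lemma schur_one_one (n : ℕ) (i j : Fin 4) (hij : i ≠ j) (t : ℂ)
    (ha : t * ![1, 1, -1, -1] i = ![1, 1, -1, -1] j * t)
    (hx : t * ![1, -1, Complex.I ^ (n - 2), -Complex.I ^ (n - 2)] i =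
      ![1, -1, Complex.I ^ (n - 2), -Complex.I ^ (n - 2)] j * t) : t = 0 := by
  have hI : Complex.I ^ (n - 2) ≠ 0 := pow_ne_zero _ Complex.I_ne_zero
  suffices h : (2 : ℂ) * t = 0 ∨ (2 * Complex.I ^ (n - 2)) * t = 0 by
    rcases h with h | h <;> simpa [hI] using h
  fin_cases i <;> fin_cases j <;> simp only [Fin.zero_eta, Fin.mk_one, Fin.reduceFinMk,
    Matrix.cons_val] at ha hx <;> first
      | exact absurd rfl hij
      | exact Or.inl (by linear_combination hx)
      | exact Or.inl (by linear_combination -hx)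
      | exact Or.inl (by linear_combination ha)
      | exact Or.inl (by linear_combination -ha)
      | exact Or.inr (by linear_combination hx)
      | exact Or.inr (by linear_combination -hx)

/-- The signs square to `1`, whereas `ζ^(2(k+1)) ≠ 1` because `k + 1 ≤ n - 3`. -/
lemma zeta_pow_ne_sign {n : ℕ} (hn : 4 ≤ n) (k : Fin (n - 4 + 1)) (i : Fin 4) :
    zeta n ^ (k.val + 1) ≠ ![1, 1, -1, -1] i ∧ (zeta n)⁻¹ ^ (k.val + 1) ≠ ![1, 1, -1, -1] i := by
  have h2 : zeta n ^ (2 * (k.val + 1)) ≠ 1 := zeta_pow_ne_one hn (by omega) (by omega)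
  have h3 : (zeta n)⁻¹ ^ (2 * (k.val + 1)) ≠ 1 := by
    rw [inv_pow]
    simpa using h2
  rw [mul_comm, pow_mul] at h2 h3
  have hs : (![1, 1, -1, -1] i : ℂ) ^ 2 = 1 := by fin_cases i <;> norm_num
  exact ⟨fun h => h2 (by rw [h, hs]), fun h => h3 (by rw [h, hs])⟩

/-- Off-diagonal entries would need `ζ^(k+1) ζ^(l+1) = 1`, which the bound on `k` and `l` excludes;
diagonal entries need equal powers of `ζ`. For `k = l` the generator `x` exchanges the two
eigenlines of `a` and so identifies the two diagonal entries. -/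
lemma schur_two_two {n : ℕ} (hn : 4 ≤ n) (k l : Fin (n - 4 + 1)) (M : Matrix (Fin 2) (Fin 2) ℂ)
    (hA : M * actA n (Sum.inr k) = actA n (Sum.inr l) * M)
    (hX : M * actX n (Sum.inr k) = actX n (Sum.inr l) * M) :
    (k ≠ l → M = 0) ∧ (k = l → M = M 0 0 • 1) := by
  have z0 := zeta_ne_zero n
  have h00 := congrFun (congrFun hA 0) 0
  have h01 := congrFun (congrFun hA 0) 1
  have h10 := congrFun (congrFun hA 1) 0
  have h11 := congrFun (congrFun hA 1) 1
  have x01 := congrFun (congrFun hX 0) 1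
  simp [Matrix.mul_apply, actA, actX, Fin.sum_univ_two] at h00 h01 h10 h11 x01
  have hne : zeta n ^ (k.val + 1 + (l.val + 1)) ≠ 1 := zeta_pow_ne_one hn (by omega) (by omega)
  rw [pow_add] at hne
  have zk : zeta n ^ (k.val + 1) ≠ 0 := pow_ne_zero _ z0
  have zl : zeta n ^ (l.val + 1) ≠ 0 := pow_ne_zero _ z0
  have e01 : M 0 1 = 0 := by
    by_contra h
    apply hne
    field_simp at h01
    linear_combination -h01
  have e10 : M 1 0 = 0 := by
    by_contra h
    apply hne
    field_simp at h10
    linear_combination h10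
  constructor
  · intro hkl
    have hne' : zeta n ^ (k.val + 1) ≠ zeta n ^ (l.val + 1) := fun h => hkl
      (Fin.ext (by have := zeta_pow_inj hn (by omega) (by omega) h; omega))
    have e00 : M 0 0 = 0 := by
      by_contra h
      apply hne'
      exact mul_left_cancel₀ h (by linear_combination h00)
    have e11 : M 1 1 = 0 := by
      by_contra h
      apply hne'
      field_simp at h11
      linear_combination -h11
    ext p q
    fin_cases p <;> fin_cases q <;> simp [*]
  · rintro rfl
    have hI : Complex.I ^ (k.val + 1) ≠ 0 := pow_ne_zero _ Complex.I_ne_zero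
    have e11 : M 1 1 = M 0 0 := mul_left_cancel₀ hI (by linear_combination -x01)
    ext p q
    fin_cases p <;> fin_cases q <;> simp [*]

/-- Schur's lemma: a map commuting with the group vanishes between different simple
representations and is a scalar on each of them. -/
lemma schur {n : ℕ} (hn : 4 ≤ n) (i j : Vertex n) (M : Matrix (Fin (dim n j)) (Fin (dim n i)) ℂ)
    (hA : M * actA n i = actA n j * M) (hX : M * actX n i = actX n j * M) (hij : i ≠ j) :
    M = 0 := by
  rcases i with i | k <;> rcases j with j | l
  · have ha := congrFun (congrFun hA 0) 0
    have hx := congrFun (congrFun hX 0) 0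
    simp [Matrix.mul_apply, actA, actX] at ha hx
    ext p q
    have hp : p = 0 := Subsingleton.elim _ _
    have hq : q = 0 := Subsingleton.elim _ _
    subst hp hq
    exact schur_one_one n i j (fun h => hij (by rw [h])) _ ha hx
  · have h0 := congrFun (congrFun hA 0) 0
    have h1 := congrFun (congrFun hA 1) 0
    simp [Matrix.mul_apply, actA] at h0 h1
    ext p q
    have hq : q = 0 := Subsingleton.elim _ _
    subst hq
    have hz := zeta_pow_ne_sign hn l i
    fin_cases p
    · by_contra h
      exact hz.1 (mul_left_cancel₀ h (by simpa [mul_comm] using h0.symm))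
    · by_contra h
      exact hz.2 (mul_left_cancel₀ h (by simpa [mul_comm] using h1.symm))
  · have h0 := congrFun (congrFun hA 0) 0
    have h1 := congrFun (congrFun hA 0) 1
    simp [Matrix.mul_apply, actA] at h0 h1
    ext p q
    have hp : p = 0 := Subsingleton.elim _ _
    subst hp
    have hz := zeta_pow_ne_sign hn k j
    fin_cases q
    · by_contra h
      exact hz.1 (mul_left_cancel₀ h (by simpa [mul_comm] using h0))
    · by_contra h
      exact hz.2 (mul_left_cancel₀ h (by simpa [mul_comm] using h1))
  · exact (schur_two_two hn k l M hA hX).1 (fun h => hij (by rw [h]))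

lemma schur_self {n : ℕ} (hn : 4 ≤ n) (i : Vertex n) (M : Matrix (Fin (dim n i)) (Fin (dim n i)) ℂ)
    (hA : M * actA n i = actA n i * M) (hX : M * actX n i = actX n i * M) :
    ∃ c : ℂ, M = c • 1 := by
  rcases i with i | k
  · refine ⟨M 0 0, ?_⟩
    ext p q
    have hp : p = 0 := Subsingleton.elim _ _
    have hq : q = 0 := Subsingleton.elim _ _
    subst hp hq
    simp
  · exact ⟨_, (schur_two_two hn k k M hA hX).2 rfl⟩

/-! ### Multiplicity one and associativity of Clebsch-Gordan data -/

lemma IsRegular.eq_zero_of_not_occurs {n : ℕ} {φ : CGDatum n} (h : IsRegular φ) {i j k : Vertex n}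
    (hk : ¬ Occurs n i j k) : φ i j k = 0 := by
  by_contra h0
  exact hk ⟨_, h.equivariant i j k, h0⟩

lemma single_mem_of_occurs {n : ℕ} {i j k : Vertex n} (hk : Occurs n i j k)
    (z : Fin (dim n k) → ℂ) :
    (Pi.single k z : (k : Vertex n) → Fin (dim n k) → ℂ) ∈
      {z : (k : Vertex n) → Fin (dim n k) → ℂ | ∀ k, ¬ Occurs n i j k → z k = 0} := by
  intro k' hk'
  have hne : k' ≠ k := by
    rintro rfl
    exact hk' hk
  simp [hne]

open Classical in
/-- The tensor product is the direct sum of its components, equivariantly. -/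
lemma IsRegular.exists_section {n : ℕ} {φ : CGDatum n} (h : IsRegular φ) (i j : Vertex n) :
    ∃ ι : (k : Vertex n) → Matrix (Fin (dim n i) × Fin (dim n j)) (Fin (dim n k)) ℂ,
      ∑ k, ι k * φ i j k = 1 ∧ ∀ k, (actA n i ⊗ₖ actA n j) * ι k = ι k * actA n k ∧
        (actX n i ⊗ₖ actX n j) * ι k = ι k * actX n k := by
  have hb := h.bijective i j
  set L : (Fin (dim n i) × Fin (dim n j) → ℂ) →ₗ[ℂ] ((k : Vertex n) → Fin (dim n k) → ℂ) :=
    LinearMap.pi fun k => (φ i j k).mulVecLin with hL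
  have hLa : ∀ t k, L t k = (φ i j k).mulVec t := fun t k => rfl
  have hinj : LinearMap.ker L = ⊥ := LinearMap.ker_eq_bot.2 fun s t hst =>
    hb.injOn (Set.mem_univ s) (Set.mem_univ t) hst
  obtain ⟨l, hl⟩ := LinearMap.exists_leftInverse_of_injective L hinj
  have hl' : ∀ t, l (L t) = t := fun t => LinearMap.congr_fun hl t
  -- The left inverse `l` is controlled only on the image of `L`, which contains the summand at `k`
  -- exactly when that component occurs. Setting the other sections to zero keeps them equivariant.
  refine ⟨fun k => if Occurs n i j k then LinearMap.toMatrix' (l ∘ₗ LinearMap.single ℂ (fun k => Fin (dim n k) → ℂ) k) else 0,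
    ?_, ?_⟩
  · apply Matrix.toLin'.injective
    apply LinearMap.ext
    intro t
    rw [map_sum, LinearMap.sum_apply]
    have e : ∀ k, Matrix.toLin' ((if Occurs n i j k then
        LinearMap.toMatrix' (l ∘ₗ LinearMap.single ℂ (fun k => Fin (dim n k) → ℂ) k) else 0) * φ i j k) t
        = l (Pi.single k (L t k)) := by
      intro k
      rw [Matrix.toLin'_mul, LinearMap.comp_apply, Matrix.toLin'_apply (φ i j k)]
      split_ifs with hk
      · rw [Matrix.toLin'_toMatrix']
        rfl
      · rw [hLa, h.eq_zero_of_not_occurs hk]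
        simp
    rw [Finset.sum_congr rfl fun k _ => e k, ← map_sum, Finset.univ_sum_single, hl']
    simp
  · have key : ∀ (S : Matrix (Fin (dim n i) × Fin (dim n j)) (Fin (dim n i) × Fin (dim n j)) ℂ)
        (B : (k : Vertex n) → Matrix (Fin (dim n k)) (Fin (dim n k)) ℂ)
        (_ : ∀ k, φ i j k * S = B k * φ i j k) (k : Vertex n),
        S * (if Occurs n i j k then LinearMap.toMatrix' (l ∘ₗ LinearMap.single ℂ (fun k => Fin (dim n k) → ℂ) k) else 0) =
        (if Occurs n i j k then LinearMap.toMatrix' (l ∘ₗ LinearMap.single ℂ (fun k => Fin (dim n k) → ℂ) k) else 0) * B k := by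
      intro S B hS k
      split_ifs with hk
      · apply Matrix.toLin'.injective
        apply LinearMap.ext
        intro z
        rw [Matrix.toLin'_mul, Matrix.toLin'_mul, LinearMap.comp_apply, LinearMap.comp_apply,
          Matrix.toLin'_toMatrix', LinearMap.comp_apply, LinearMap.comp_apply]
        obtain ⟨t, -, ht⟩ := hb.surjOn (single_mem_of_occurs hk z)
        have ht' : L t = Pi.single k z := ht
        have e2 : L (S.mulVec t) = Pi.single k ((B k).mulVec z) := by
          funext k'
          rw [hLa, Matrix.mulVec_mulVec, hS, ← Matrix.mulVec_mulVec, ← hLa, ht']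
          by_cases hkk : k' = k
          · subst hkk
            simp
          · simp [Pi.single_eq_of_ne hkk]
        have e3 : (LinearMap.single ℂ (fun k => Fin (dim n k) → ℂ) k) z = L t := ht'.symm
        have e4 : (LinearMap.single ℂ (fun k => Fin (dim n k) → ℂ) k) ((Matrix.toLin' (B k)) z) =
            L (S.mulVec t) := e2.symm
        rw [e3, e4, hl', hl', Matrix.toLin'_apply]
      · simp
    exact fun k => ⟨key _ _ (fun k => (h.equivariant i j k).1) k,
      key _ _ (fun k => (h.equivariant i j k).2) k⟩

/-- Decomposing the source by the sections `ι` of `φ i j`, Schur's lemma kills `T * ι k'` for `k' ≠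
k` and makes `T * ι k` a scalar. -/
lemma IsRegular.exists_eq_smul {n : ℕ} (hn : 4 ≤ n) {φ : CGDatum n} (h : IsRegular φ)
    (i j k : Vertex n) (T : BilinMat n i j k) (hT : IsEquivariant n i j k T) :
    ∃ c : ℂ, T = c • φ i j k := by
  obtain ⟨ι, h1, h2⟩ := h.exists_section i j
  have hA : ∀ k', (T * ι k') * actA n k' = actA n k * (T * ι k') := fun k' => by
    rw [Matrix.mul_assoc, ← (h2 k').1, ← Matrix.mul_assoc, hT.1, Matrix.mul_assoc]
  have hX : ∀ k', (T * ι k') * actX n k' = actX n k * (T * ι k') := fun k' => by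
    rw [Matrix.mul_assoc, ← (h2 k').2, ← Matrix.mul_assoc, hT.2, Matrix.mul_assoc]
  obtain ⟨c, hc⟩ := schur_self hn k (T * ι k) (hA k) (hX k)
  refine ⟨c, ?_⟩
  calc T = ∑ k', T * ι k' * φ i j k' := by
        conv_lhs => rw [← Matrix.mul_one T, ← h1, Matrix.mul_sum]
        exact Finset.sum_congr rfl fun k' _ => (Matrix.mul_assoc _ _ _).symm
    _ = T * ι k * φ i j k := by
        apply Finset.sum_eq_single_of_mem k (Finset.mem_univ k)
        intro k' _ hk'
        rw [schur hn k' k _ (hA k') (hX k') hk', Matrix.zero_mul]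
    _ = c • φ i j k := by rw [hc]; simp

/-- The rebracketing of triple tensor products `i ⊗ (j ⊗ o) ≃ (i ⊗ o) ⊗ j`. -/
def rebracket (a b c : Type) : a × (b × c) ≃ (a × c) × b where
  toFun p := ((p.1, p.2.2), p.2.1)
  invFun p := (p.1.1, (p.2, p.1.2))
  left_inv _ := rfl
  right_inv _ := rfl

lemma kronecker_rebracket_mul {a b c p q : Type} [Fintype a] [Fintype b] [Fintype c]
    (M : Matrix p (a × c) ℂ) (N : Matrix q b ℂ) (A : Matrix a a ℂ) (B : Matrix b b ℂ)
    (C : Matrix c c ℂ) :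
    (M ⊗ₖ N).submatrix id (rebracket a b c) * (A ⊗ₖ (B ⊗ₖ C)) =
      ((M * (A ⊗ₖ C)) ⊗ₖ (N * B)).submatrix id (rebracket a b c) := by
  have e : A ⊗ₖ (B ⊗ₖ C) = ((A ⊗ₖ C) ⊗ₖ B).submatrix (rebracket a b c) (rebracket a b c) := by
    ext ⟨x, y, z⟩ ⟨x', y', z'⟩
    simp [rebracket]
    ring
  rw [e, Matrix.submatrix_mul_equiv, Matrix.mul_kronecker_mul]

lemma mul_kronecker_rebracket {a b c p q r s : Type} [Fintype p] [Fintype q]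
    (M : Matrix p (a × c) ℂ) (N : Matrix q b ℂ) (A : Matrix r p ℂ) (B : Matrix s q ℂ) :
    (A ⊗ₖ B) * (M ⊗ₖ N).submatrix id (rebracket a b c) =
      ((A * M) ⊗ₖ (B * N)).submatrix id (rebracket a b c) := by
  rw [Matrix.mul_kronecker_mul]
  rfl

/-- Associativity of a Clebsch-Gordan datum with structure constants `c`: it expresses
`φ(φ(v ⊗ y) ⊗ w)` through the `φ(v ⊗ φ(w ⊗ y))`, where `y` is in the natural representation. -/
def AssocWith {n : ℕ} (c : Vertex n → Vertex n → Vertex n → Vertex n → Vertex n → ℂ)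
    (φ : CGDatum n) : Prop :=
  ∀ i i' j k : Vertex n,
    φ i' j k * ((φ i (O₁ n) i') ⊗ₖ (1 : Matrix (Fin (dim n j)) (Fin (dim n j)) ℂ)).submatrix id
      (rebracket _ _ _) =
    ∑ j', c i i' j k j' •
      (φ i j' k * ((1 : Matrix (Fin (dim n i)) (Fin (dim n i)) ℂ) ⊗ₖ φ j (O₁ n) j'))

/-- The left side of the associativity relation is an equivariant map `i ⊗ (j ⊗ O₁) → k`. Restricted
to the component `j'` of `j ⊗ O₁` it is an equivariant map `i ⊗ j' → k`, hence a multiple of `φ i j'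
k` by multiplicity one. -/
lemma IsRegular.exists_assocWith {n : ℕ} (hn : 4 ≤ n) {φ : CGDatum n} (h : IsRegular φ) :
    ∃ c, AssocWith c φ := by
  have key : ∀ i i' j k : Vertex n, ∃ c : Vertex n → ℂ,
      φ i' j k * ((φ i (O₁ n) i') ⊗ₖ (1 : Matrix (Fin (dim n j)) (Fin (dim n j)) ℂ)).submatrix id
        (rebracket _ _ _) =
      ∑ j', c j' •
        (φ i j' k * ((1 : Matrix (Fin (dim n i)) (Fin (dim n i)) ℂ) ⊗ₖ φ j (O₁ n) j')) := by
    intro i i' j k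
    obtain ⟨ι, h1, h2⟩ := h.exists_section j (O₁ n)
    set K := φ i' j k * ((φ i (O₁ n) i') ⊗ₖ
      (1 : Matrix (Fin (dim n j)) (Fin (dim n j)) ℂ)).submatrix id (rebracket _ _ _) with hK
    -- Stated for an arbitrary family `S` compatible with `φ`, so that it serves for both generators
    -- `a` and `x`.
    have hKA : ∀ (S : (v : Vertex n) → Matrix (Fin (dim n v)) (Fin (dim n v)) ℂ),
        (∀ i j k, φ i j k * (S i ⊗ₖ S j) = S k * φ i j k) →
        K * (S i ⊗ₖ (S j ⊗ₖ S (O₁ n))) = S k * K := by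
      intro S hS
      rw [hK, Matrix.mul_assoc, kronecker_rebracket_mul, hS, Matrix.one_mul]
      conv_lhs => rw [← Matrix.mul_one (S j)]
      rw [← mul_kronecker_rebracket, ← Matrix.mul_assoc, hS, Matrix.mul_assoc]
    clear_value K
    have hT : ∀ j', IsEquivariant n i j' k
        (K * ((1 : Matrix (Fin (dim n i)) (Fin (dim n i)) ℂ) ⊗ₖ ι j')) := by
      intro j'
      have hS : ∀ (S : (v : Vertex n) → Matrix (Fin (dim n v)) (Fin (dim n v)) ℂ),
          (∀ i j k, φ i j k * (S i ⊗ₖ S j) = S k * φ i j k) →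
          (∀ k, (S j ⊗ₖ S (O₁ n)) * ι k = ι k * S k) →
          (K * ((1 : Matrix (Fin (dim n i)) (Fin (dim n i)) ℂ) ⊗ₖ ι j')) * (S i ⊗ₖ S j') =
          S k * (K * ((1 : Matrix (Fin (dim n i)) (Fin (dim n i)) ℂ) ⊗ₖ ι j')) := by
        intro S hS hι
        rw [← Matrix.mul_assoc, ← hKA S hS, Matrix.mul_assoc, Matrix.mul_assoc,
          ← Matrix.mul_kronecker_mul, ← Matrix.mul_kronecker_mul, hι, Matrix.one_mul,
          Matrix.mul_one]
      exact ⟨hS _ (fun i j k => (h.equivariant i j k).1) (fun k => (h2 k).1),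
        hS _ (fun i j k => (h.equivariant i j k).2) (fun k => (h2 k).2)⟩
    choose c hc using fun j' => h.exists_eq_smul hn i j' k _ (hT j')
    refine ⟨c, ?_⟩
    calc K = K * ((1 : Matrix (Fin (dim n i)) (Fin (dim n i)) ℂ) ⊗ₖ
          ∑ j', ι j' * φ j (O₁ n) j') := by
          rw [h1, Matrix.one_kronecker_one, Matrix.mul_one]
      _ = ∑ j', K * ((1 : Matrix (Fin (dim n i)) (Fin (dim n i)) ℂ) ⊗ₖ (ι j' * φ j (O₁ n) j')) := by
          rw [← Matrix.mul_sum]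
          congr 1
          ext p q
          simp only [Matrix.kroneckerMap_apply, Matrix.sum_apply, Finset.mul_sum]
      _ = _ := by
          refine Finset.sum_congr rfl fun j' _ => ?_
          rw [← Matrix.smul_mul, ← hc, Matrix.mul_assoc, ← Matrix.mul_kronecker_mul, Matrix.one_mul]
  choose c hc using key
  exact ⟨c, hc⟩

/-- Both sides of the relation pick up the same outer factors, so one set of structure constants
works on the whole orbit. This uniformity is what makes limits accessible. -/
lemma AssocWith.gaugeCG {n : ℕ} {c} {φ : CGDatum n} (h : AssocWith c φ) (g : GLα n) :
    AssocWith c (gaugeCG g φ) := by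
  have hg : ∀ v, (g v)⁻¹.val * (g v).val = 1 := fun v => by simp
  intro i i' j k
  have e : ((g i')⁻¹.val ⊗ₖ (g j)⁻¹.val) * ((KleinianD.gaugeCG g φ i (O₁ n) i') ⊗ₖ
      (1 : Matrix (Fin (dim n j)) (Fin (dim n j)) ℂ)).submatrix id (rebracket _ _ _) =
      ((φ i (O₁ n) i') ⊗ₖ (1 : Matrix (Fin (dim n j)) (Fin (dim n j)) ℂ)).submatrix id
      (rebracket _ _ _) * ((g i)⁻¹.val ⊗ₖ ((g j)⁻¹.val ⊗ₖ (g (O₁ n))⁻¹.val)) := by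
    rw [mul_kronecker_rebracket, kronecker_rebracket_mul, KleinianD.gaugeCG, ← Matrix.mul_assoc,
      ← Matrix.mul_assoc, hg, Matrix.one_mul, Matrix.one_mul, Matrix.mul_one]
  have lhs : KleinianD.gaugeCG g φ i' j k * ((KleinianD.gaugeCG g φ i (O₁ n) i') ⊗ₖ
      (1 : Matrix (Fin (dim n j)) (Fin (dim n j)) ℂ)).submatrix id (rebracket _ _ _) =
      (g k).val * (φ i' j k * ((φ i (O₁ n) i') ⊗ₖ
      (1 : Matrix (Fin (dim n j)) (Fin (dim n j)) ℂ)).submatrix id (rebracket _ _ _)) *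
      ((g i)⁻¹.val ⊗ₖ ((g j)⁻¹.val ⊗ₖ (g (O₁ n))⁻¹.val)) := by
    rw [show KleinianD.gaugeCG g φ i' j k = (g k).val * φ i' j k *
      ((g i')⁻¹.val ⊗ₖ (g j)⁻¹.val) from rfl, Matrix.mul_assoc ((g k).val * _), e]
    simp only [Matrix.mul_assoc]
  rw [lhs, h, Matrix.mul_sum, Matrix.sum_mul]
  refine Finset.sum_congr rfl fun j' _ => ?_
  rw [Matrix.mul_smul, Matrix.smul_mul]
  congr 1
  simp only [KleinianD.gaugeCG]
  have e : ((g i)⁻¹.val ⊗ₖ (g j')⁻¹.val) * ((1 : Matrix (Fin (dim n i)) (Fin (dim n i)) ℂ) ⊗ₖ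
      ((g j').val * φ j (O₁ n) j' * ((g j)⁻¹.val ⊗ₖ (g (O₁ n))⁻¹.val))) =
      ((1 : Matrix (Fin (dim n i)) (Fin (dim n i)) ℂ) ⊗ₖ φ j (O₁ n) j') *
        ((g i)⁻¹.val ⊗ₖ ((g j)⁻¹.val ⊗ₖ (g (O₁ n))⁻¹.val)) := by
    rw [← Matrix.mul_kronecker_mul, ← Matrix.mul_kronecker_mul, Matrix.mul_one, Matrix.one_mul,
      ← Matrix.mul_assoc, ← Matrix.mul_assoc, hg, Matrix.one_mul]
  simp only [Matrix.mul_assoc] at e ⊢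
  rw [e]

/-! ### Limits of representations in the image of the comparison map -/

/-- The orbit of `φ` under base changes which are trivial at `E_1`. -/
def orbit {n : ℕ} (φ : CGDatum n) : Set (CGDatum n) :=
  {ψ | ∃ g : GLα n, g (E₁ n) = 1 ∧ ψ = gaugeCG g φ}

/-- Left multiplication by `v` in a Clebsch-Gordan datum: the map `φ_{i,j;k}(v ⊗ -)`. -/
def leftMul {n : ℕ} (φ : CGDatum n) (i j k : Vertex n) (v : Fin (dim n i) → ℂ) :
    Matrix (Fin (dim n k)) (Fin (dim n j)) ℂ :=
  Matrix.of fun c b => ∑ a, φ i j k c (a, b) * v a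

/-- Right multiplication by `y` in the natural representation: the map `φ_{i,O_1;j}(- ⊗ y)`. -/
def rightMul {n : ℕ} (φ : CGDatum n) (y : Fin (dim n (O₁ n)) → ℂ) (i j : Vertex n) :
    Matrix (Fin (dim n j)) (Fin (dim n i)) ℂ :=
  Matrix.of fun c a => ∑ b, φ i (O₁ n) j c (a, b) * y b

lemma R_apply {n : ℕ} (φ : CGDatum n) (y : Fin (dim n (O₁ n)) → ℂ) (e : DArrow n) :
    R φ y e = rightMul φ y e.1.1 e.1.2 := rfl

/-- Associativity contracted with `v` and `y`. Moving `v` along an arrow changes its multiplication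
operator only by composition with arrows of `R(φ, y)`, which is the inductive step for controlled
vectors. -/
lemma AssocWith.leftMul_mulVec {n : ℕ} {c} {φ : CGDatum n} (h : AssocWith c φ)
    (y : Fin (dim n (O₁ n)) → ℂ) (i i' j k : Vertex n) (v : Fin (dim n i) → ℂ) :
    leftMul φ i' j k ((rightMul φ y i i').mulVec v) =
      ∑ j', c i i' j k j' • (leftMul φ i j' k v * rightMul φ y j j') := by
  ext x b
  have key : ∀ a o, ∑ a', φ i' j k x (a', b) * φ i (O₁ n) i' a' (a, o) =
      ∑ j', c i i' j k j' * ∑ b', φ i j' k x (a, b') * φ j (O₁ n) j' b' (b, o) := by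
    intro a o
    have := congrFun (congrFun (h i i' j k) x) (a, (b, o))
    rw [Matrix.sum_apply] at this
    simpa only [Matrix.mul_apply, Matrix.smul_apply, Matrix.submatrix_apply,
      Matrix.kroneckerMap_apply, rebracket, Equiv.coe_fn_mk, id, Matrix.one_apply, mul_ite, ite_mul,
      mul_one, mul_zero, one_mul, zero_mul, Fintype.sum_prod_type, Finset.sum_ite_eq',
      Finset.sum_ite_eq, Finset.sum_ite_irrel, Finset.sum_const_zero, Finset.mem_univ, if_true,
      smul_eq_mul] using this
  have l1 : leftMul φ i' j k ((rightMul φ y i i').mulVec v) x b =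
      ∑ a, ∑ o, (∑ a', φ i' j k x (a', b) * φ i (O₁ n) i' a' (a, o)) * (v a * y o) := by
    simp only [leftMul, rightMul, Matrix.of_apply, Matrix.mulVec, dotProduct, Finset.mul_sum,
      Finset.sum_mul]
    rw [Finset.sum_comm]
    refine Finset.sum_congr rfl fun a _ => ?_
    rw [Finset.sum_comm]
    refine Finset.sum_congr rfl fun o _ => Finset.sum_congr rfl fun a' _ => ?_
    ring
  rw [l1, Matrix.sum_apply]
  simp only [key, leftMul, rightMul, Matrix.smul_apply, Matrix.mul_apply, Matrix.of_apply,
    Finset.mul_sum, Finset.sum_mul, smul_eq_mul]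
  rw [Finset.sum_congr rfl fun a _ => Finset.sum_comm, Finset.sum_comm]
  refine Finset.sum_congr rfl fun j' _ => ?_
  rw [Finset.sum_congr rfl fun a _ => Finset.sum_comm, Finset.sum_comm]
  refine Finset.sum_congr rfl fun b' _ => ?_
  rw [Finset.sum_comm]
  refine Finset.sum_congr rfl fun o _ => Finset.sum_congr rfl fun a _ => ?_
  ring

/-- If the components in `S` already determine a tensor, then the others vanish. -/
lemma IsRegular.eq_zero_of_injective {n : ℕ} {φ : CGDatum n} (h : IsRegular φ) (i j : Vertex n)
    (S : Set (Vertex n)) (hS : ∀ t, (∀ k ∈ S, (φ i j k).mulVec t = 0) → t = 0)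
    {k : Vertex n} (hk : k ∉ S) : φ i j k = 0 := by
  apply h.eq_zero_of_not_occurs
  intro hocc
  obtain ⟨t, -, ht⟩ := (h.bijective i j).surjOn
    (single_mem_of_occurs hocc 1)
  have h0 : t = 0 := hS t fun k' hk' => by
    have := congrFun ht k'
    have hne : k' ≠ k := by
      rintro rfl
      exact hk hk'
    simpa [hne] using this
  have := congrFun ht k
  simp only [h0, Matrix.mulVec_zero, Pi.single_eq_same] at this
  rcases k with k | k <;> simpa using congrFun this 0

/-- The components of `φ_{i,O_1}` are indexed by the neighbours of `i` in the McKay quiver. -/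
def SupportedOnArrows {n : ℕ} (φ : CGDatum n) : Prop :=
  ∀ i j, ¬ (IsArrow n i j ∨ IsArrow n j i) → φ i (O₁ n) j = 0

/-- `φ_{E_1,j}` is the identity. -/
structure IsUnital {n : ℕ} (φ : CGDatum n) : Prop where
  self : ∀ i, φ (E₁ n) i i = Matrix.of fun c p => if c = p.2 then 1 else 0
  ne : ∀ i j, i ≠ j → φ (E₁ n) i j = 0

lemma IsRegular.isUnital {n : ℕ} {φ : CGDatum n} (h : IsRegular φ) : IsUnital φ where
  self := h.left_unit
  ne i j hij := by
    refine h.eq_zero_of_injective (E₁ n) i {i} (fun t ht => ?_) (fun hj => hij hj.symm)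
    have := ht i rfl
    rw [h.left_unit] at this
    funext ⟨a, b⟩
    have ha : a = 0 := Subsingleton.elim _ _
    subst ha
    simpa [Matrix.mulVec, dotProduct, Fintype.sum_prod_type] using congrFun this b

lemma IsUnital.gaugeCG {n : ℕ} {φ : CGDatum n} (h : IsUnital φ) (g : GLα n) (hg : g (E₁ n) = 1) :
    IsUnital (gaugeCG g φ) where
  self i := by
    have e : (g i).val * (g i)⁻¹.val = 1 := by simp
    ext c ⟨a, b⟩
    have ha : a = 0 := Subsingleton.elim _ _
    subst ha
    have := congrFun (congrFun e c) b
    rw [KleinianD.gaugeCG, h.self, hg, Matrix.mul_assoc]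
    simpa [Matrix.mul_apply, Fintype.sum_prod_type, Matrix.one_apply] using this
  ne i j hij := by
    rw [KleinianD.gaugeCG, h.ne i j hij]
    simp

lemma SupportedOnArrows.gaugeCG {n : ℕ} {φ : CGDatum n} (h : SupportedOnArrows φ) (g : GLα n) :
    SupportedOnArrows (gaugeCG g φ) := fun i j hij => by
  rw [KleinianD.gaugeCG, h i j hij]
  simp

lemma IsUnital.leftMul_self {n : ℕ} {φ : CGDatum n} (h : IsUnital φ) (i : Vertex n) :
    leftMul φ (E₁ n) i i 1 = 1 := by
  ext c b
  rw [leftMul, h.self]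
  by_cases hcb : c = b <;> simp [hcb, Matrix.one_apply]

open Classical in
/-- The maps of a representation of the double quiver, extended by zero to all pairs of
vertices. -/
def extend {n : ℕ} (ρ : DoubleRep n) (i j : Vertex n) :
    Matrix (Fin (dim n j)) (Fin (dim n i)) ℂ :=
  if h : IsArrow n i j ∨ IsArrow n j i then ρ ⟨(i, j), h⟩ else 0

lemma continuous_extend {n : ℕ} (i j : Vertex n) :
    Continuous fun ρ : DoubleRep n => extend ρ i j := by
  unfold extend
  split_ifs with h
  · exact continuous_apply _
  · exact continuous_const

lemma SupportedOnArrows.extend_R {n : ℕ} {φ : CGDatum n} (h : SupportedOnArrows φ)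
    (y : Fin (dim n (O₁ n)) → ℂ) (i j : Vertex n) : extend (R φ y) i j = rightMul φ y i j := by
  unfold extend
  split_ifs with hij
  · rfl
  · ext c a
    simp [rightMul, h i j hij]

/-- `u` extends to a continuous family of vectors whose multiplication operators depend, on the
orbit of `φ`, continuously on the representation `R`. -/
def Controlled {n : ℕ} (φ : CGDatum n) (ρ : DoubleRep n) (i : Vertex n) (u : Fin (dim n i) → ℂ) :
    Prop :=
  ∃ (v : DoubleRep n → Fin (dim n i) → ℂ)
    (F : DoubleRep n → (j k : Vertex n) → Matrix (Fin (dim n k)) (Fin (dim n j)) ℂ),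
    Continuous v ∧ (∀ j k, Continuous fun σ => F σ j k) ∧ v ρ = u ∧
    ∀ ψ ∈ orbit φ, ∀ y j k, leftMul ψ i j k (v (R ψ y)) = F (R ψ y) j k

lemma leftMul_add {n : ℕ} (φ : CGDatum n) (i j k : Vertex n) (u v : Fin (dim n i) → ℂ) :
    leftMul φ i j k (u + v) = leftMul φ i j k u + leftMul φ i j k v := by
  ext c b
  simp [leftMul, mul_add, Finset.sum_add_distrib]

lemma leftMul_smul {n : ℕ} (φ : CGDatum n) (i j k : Vertex n) (t : ℂ) (v : Fin (dim n i) → ℂ) :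
    leftMul φ i j k (t • v) = t • leftMul φ i j k v := by
  ext c b
  simp only [leftMul, Matrix.of_apply, Pi.smul_apply, smul_eq_mul, Matrix.smul_apply,
    Finset.mul_sum]
  exact Finset.sum_congr rfl fun a _ => by ring

/-- The subspace of controlled vectors. -/
def controlledSubmodule {n : ℕ} (φ : CGDatum n) (ρ : DoubleRep n) (i : Vertex n) :
    Submodule ℂ (Fin (dim n i) → ℂ) where
  carrier := {u | Controlled φ ρ i u}
  add_mem' := by
    rintro u u' ⟨v, F, hv, hF, hu, h⟩ ⟨v', F', hv', hF', hu', h'⟩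
    refine ⟨fun σ => v σ + v' σ, fun σ j k => F σ j k + F' σ j k, hv.add hv',
      fun j k => (hF j k).add (hF' j k), by simp only [hu, hu'], fun ψ hψ y j k => ?_⟩
    rw [leftMul_add, h ψ hψ, h' ψ hψ]
  zero_mem' := ⟨fun _ => 0, fun _ _ _ => 0, continuous_const, fun _ _ => continuous_const, rfl,
    fun ψ _ y j k => by ext; simp [leftMul]⟩
  smul_mem' := by
    rintro t u ⟨v, F, hv, hF, hu, h⟩
    refine ⟨fun σ => t • v σ, fun σ j k => t • F σ j k, hv.const_smul t,
      fun j k => (hF j k).const_smul t, by simp only [hu], fun ψ hψ y j k => ?_⟩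
    rw [leftMul_smul, h ψ hψ]

/-- If multiplication by `v` is a continuous function of the representation, then so is
multiplication by its image under an arrow, by `AssocWith.leftMul_mulVec`; the constants `c` are the
same for every `ψ` in the orbit. -/
lemma isSubrep_controlled {n : ℕ} {c} {φ : CGDatum n} (hc : AssocWith c φ)
    (hs : SupportedOnArrows φ) (ρ : DoubleRep n) : IsSubrep ρ (controlledSubmodule φ ρ) := by
  rintro e u ⟨v, F, hv, hF, hu, h⟩
  refine ⟨fun σ => (σ e).mulVec (v σ), fun σ j k => ∑ j', c e.1.1 e.1.2 j k j' •
    (F σ j' k * extend σ j j'), (continuous_apply e).matrix_mulVec hv, fun j k => ?_,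
    by simp only [hu], ?_⟩
  · exact continuous_finsetSum _ fun j' _ =>
      ((hF j' k).matrix_mul (continuous_extend j j')).const_smul (c e.1.1 e.1.2 j k j')
  · rintro ψ hψ y j k
    obtain ⟨g, hg, rfl⟩ := id hψ
    beta_reduce
    rw [R_apply, (hc.gaugeCG g).leftMul_mulVec]
    refine Finset.sum_congr rfl fun j' _ => ?_
    rw [h _ hψ, (hs.gaugeCG g).extend_R]

open Classical in
lemma one_mem_controlled {n : ℕ} {φ : CGDatum n} (hu : IsUnital φ) (ρ : DoubleRep n) :
    Controlled φ ρ (E₁ n) 1 := by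
  refine ⟨fun _ => 1, fun _ j k => if h : j = k then h ▸ 1 else 0, continuous_const,
    fun _ _ => continuous_const, rfl, ?_⟩
  rintro _ ⟨g, hg, rfl⟩ y j k
  beta_reduce
  split_ifs with h
  · subst h
    exact (hu.gaugeCG g hg).leftMul_self j
  · ext a b
    simp [leftMul, (hu.gaugeCG g hg).ne j k h]

/-- A representation which is generated by its vector at `E_1` and is a limit of representations
`R(ψ, y)` with `ψ` in the orbit of `φ` is itself in the image of `R`. -/
theorem mem_imageR_of_mem_closure {n : ℕ} (hn : 4 ≤ n) {φ : CGDatum n} (hreg : IsRegular φ)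
    (hs : SupportedOnArrows φ) {ρ : DoubleRep n}
    (hgen : ∀ W, IsSubrep ρ W → W (E₁ n) = ⊤ → ∀ v, W v = ⊤)
    (hcl : ρ ∈ closure {σ | ∃ ψ ∈ orbit φ, ∃ y, R ψ y = σ}) : ρ ∈ imageR φ := by
  obtain ⟨c, hc⟩ := hreg.exists_assocWith hn
  have hE : controlledSubmodule φ ρ (E₁ n) = ⊤ := by
    rw [eq_top_iff]
    intro u _
    have : u = u 0 • (1 : Fin (dim n (E₁ n)) → ℂ) := by
      funext a
      have ha : a = 0 := Subsingleton.elim _ _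
      subst ha
      simp
    rw [this]
    exact Submodule.smul_mem _ _ (one_mem_controlled hreg.isUnital ρ)
  have htop := hgen _ (isSubrep_controlled hc hs ρ) hE
  have hctrl : ∀ (i : Vertex n) (a : Fin (dim n i)), Controlled φ ρ i (Pi.single a 1) :=
    fun i a => show Pi.single a 1 ∈ controlledSubmodule φ ρ i from htop i ▸ Submodule.mem_top
  choose v F hv hF hvρ h using hctrl
  set S : Set (DoubleRep n) := {σ | ∃ ψ ∈ orbit φ, ∃ y, R ψ y = σ} with hS
  have hSc : ∀ σ ∈ S, ∃ ψ, ψ ∈ orbit φ ∧ ∃ y, R ψ y = σ := fun σ hσ => hσ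
  choose! Ψ hΨ Y hY using hSc
  have : NeBot (𝓝[S] ρ) := mem_closure_iff_nhdsWithin_neBot.1 hcl
  have hmem : ∀ᶠ σ in 𝓝[S] ρ, σ ∈ S := self_mem_nhdsWithin
  -- The columns of `B i σ` are the controlled extensions of the standard basis vectors. The matrix
  -- is the identity at `ρ`, so it stays invertible nearby.
  let B : (i : Vertex n) → DoubleRep n → Matrix (Fin (dim n i)) (Fin (dim n i)) ℂ :=
    fun i σ => Matrix.of fun a a' => v i a' σ a
  have hB : ∀ i, Continuous (B i) := fun i => continuous_pi fun a => continuous_pi fun a' =>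
    (continuous_apply a).comp (hv i a')
  have hBρ : ∀ i, B i ρ = 1 := fun i => by
    ext a a'
    simp only [B, Matrix.of_apply, hvρ, Matrix.one_apply, Pi.single_apply]
  have hdet : ∀ i, (B i ρ).det = 1 := fun i => by rw [hBρ, Matrix.det_one]
  -- Solves for the datum from its products with the columns of `B i σ`. Cramer's rule, rather than
  -- an inverse matrix, makes continuity at `ρ` visible.
  let G : DoubleRep n → CGDatum n := fun σ i j k => Matrix.of fun x p =>
    ((B i σ).det)⁻¹ * (Matrix.vecMul (fun a => F i a σ j k x p.2) (B i σ).adjugate) p.1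
  have hG : ContinuousAt G ρ := by
    refine continuousAt_pi.2 fun i => continuousAt_pi.2 fun j => continuousAt_pi.2 fun k =>
      continuousAt_pi.2 fun x => continuousAt_pi.2 fun p => ?_
    refine ContinuousAt.mul ((hB i).matrix_det.continuousAt.inv₀ (by rw [hdet]; exact one_ne_zero))
      (Continuous.continuousAt ?_)
    have h1 : Continuous fun σ => Matrix.vecMul (fun a => F i a σ j k x p.2) (B i σ).adjugate := by
      refine Continuous.matrix_vecMul (continuous_pi fun a => ?_) (hB i).matrix_adjugate
      exact (hF i a j k).matrix_elem x p.2
    exact (continuous_apply p.1).comp h1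
  have hGΨ : ∀ᶠ σ in 𝓝[S] ρ, G σ = Ψ σ := by
    have hne : ∀ᶠ σ in 𝓝[S] ρ, ∀ i, (B i σ).det ≠ 0 := by
      refine eventually_all.2 fun i => nhdsWithin_le_nhds ?_
      exact (hB i).matrix_det.continuousAt.eventually_ne (by rw [hdet]; exact one_ne_zero)
    filter_upwards [hmem, hne] with σ hσ hd
    funext i j k
    ext x ⟨a, b⟩
    have e1 : (fun a => F i a σ j k x b) = Matrix.vecMul (fun a => Ψ σ i j k x (a, b)) (B i σ) := by
      funext a'
      have := congrFun (congrFun (h i a' (Ψ σ) (hΨ σ hσ) (Y σ) j k) x) b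
      rw [hY σ hσ] at this
      rw [← this]
      rfl
    simp only [G, Matrix.of_apply, e1, Matrix.vecMul_vecMul, Matrix.mul_adjugate,
      Matrix.vecMul_smul, Matrix.vecMul_one, Pi.smul_apply, smul_eq_mul]
    rw [inv_mul_cancel_left₀ (hd i)]
  have hΨlim : Tendsto Ψ (𝓝[S] ρ) (𝓝 (G ρ)) :=
    (hG.tendsto.mono_left nhdsWithin_le_nhds).congr' hGΨ
  have harr : IsArrow n (E₁ n) (O₁ n) := ⟨Or.inl rfl, rfl⟩
  -- As `φ_{E_1,O_1}` is the identity throughout the orbit, `y` is read off from the arrow `E_1 →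
  -- O_1`.
  let y₀ : DoubleRep n → Fin (dim n (O₁ n)) → ℂ := fun σ c => σ ⟨(E₁ n, O₁ n), Or.inl harr⟩ c 0
  have hy₀ : Continuous y₀ := continuous_pi fun c =>
    (continuous_apply (⟨(E₁ n, O₁ n), Or.inl harr⟩ : DArrow n)).matrix_elem c 0
  have hYy : ∀ᶠ σ in 𝓝[S] ρ, y₀ σ = Y σ := by
    filter_upwards [hmem] with σ hσ
    obtain ⟨g, hg, hg'⟩ := hΨ σ hσ
    have hu := (hreg.isUnital.gaugeCG g hg).self (O₁ n)
    rw [← hg'] at hu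
    funext c
    simp only [y₀]
    rw [← hY σ hσ, R_apply]
    simp [rightMul, hu, hY σ hσ]
  have hYlim : Tendsto Y (𝓝[S] ρ) (𝓝 (y₀ ρ)) :=
    ((hy₀.tendsto ρ).mono_left nhdsWithin_le_nhds).congr' hYy
  refine ⟨G ρ, mem_closure_of_tendsto hΨlim (hmem.mono hΨ), y₀ ρ, ?_⟩
  have hR : Tendsto (fun σ => R (Ψ σ) (Y σ)) (𝓝[S] ρ) (𝓝 (R (G ρ) (y₀ ρ))) := by
    refine tendsto_pi_nhds.2 fun e => tendsto_pi_nhds.2 fun c => tendsto_pi_nhds.2 fun a => ?_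
    simp only [R, Matrix.of_apply]
    refine tendsto_finsetSum _ fun b _ => Tendsto.mul ?_ ((tendsto_pi_nhds.1 hYlim) b)
    exact tendsto_pi_nhds.1 (tendsto_pi_nhds.1 (tendsto_pi_nhds.1 (tendsto_pi_nhds.1
      (tendsto_pi_nhds.1 hΨlim e.1.1) (O₁ n)) e.1.2) c) (a, b)
  have hid : Tendsto (fun σ => R (Ψ σ) (Y σ)) (𝓝[S] ρ) (𝓝 ρ) :=
    (tendsto_id.mono_left nhdsWithin_le_nhds).congr'
      (hmem.mono fun σ hσ => (hY σ hσ).symm)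
  exact tendsto_nhds_unique hR hid

/-! ### Representations in coordinates -/

lemma tensorMat_apply_one {p : ℕ} (A : Matrix (Fin p) (Fin (1 * 2)) ℂ) (c : Fin p) (a : Fin 1)
    (b : Fin 2) : tensorMat (q := 1) (r := 2) A c (a, b) = A c b := by
  fin_cases a; fin_cases b <;> rfl

lemma tensorMat_apply_two {p : ℕ} (A : Matrix (Fin p) (Fin (2 * 2)) ℂ) (c : Fin p) :
    tensorMat (q := 2) (r := 2) A c (0, 0) = A c 0 ∧ tensorMat (q := 2) (r := 2) A c (0, 1) = A c 1 ∧
    tensorMat (q := 2) (r := 2) A c (1, 0) = A c 2 ∧ tensorMat (q := 2) (r := 2) A c (1, 1) = A c 3 :=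
  ⟨rfl, rfl, rfl, rfl⟩

lemma tensorMat_mulVec_one {p : ℕ} (A : Matrix (Fin p) (Fin (1 * 2)) ℂ) (t : Fin 1 × Fin 2 → ℂ)
    (c : Fin p) : (tensorMat (q := 1) (r := 2) A).mulVec t c = A c 0 * t (0, 0) + A c 1 * t (0, 1) := by
  simp [Matrix.mulVec, dotProduct, Fintype.sum_prod_type, tensorMat_apply_one]

lemma tensorMat_mulVec_two {p : ℕ} (A : Matrix (Fin p) (Fin (2 * 2)) ℂ) (t : Fin 2 × Fin 2 → ℂ)
    (c : Fin p) : (tensorMat (q := 2) (r := 2) A).mulVec t c =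
      A c 0 * t (0, 0) + A c 1 * t (0, 1) + (A c 2 * t (1, 0) + A c 3 * t (1, 1)) := by
  simp only [Matrix.mulVec, dotProduct, Fintype.sum_prod_type, Fin.sum_univ_two]
  rw [(tensorMat_apply_two A c).1, (tensorMat_apply_two A c).2.1, (tensorMat_apply_two A c).2.2.1,
    (tensorMat_apply_two A c).2.2.2]

lemma funext_one_two {t : Fin 1 × Fin 2 → ℂ} (h0 : t (0, 0) = 0) (h1 : t (0, 1) = 0) : t = 0 := by
  funext ⟨a, b⟩
  fin_cases a; fin_cases b <;> assumption

lemma funext_two_two {t : Fin 2 × Fin 2 → ℂ} (h0 : t (0, 0) = 0) (h1 : t (0, 1) = 0)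
    (h2 : t (1, 0) = 0) (h3 : t (1, 1) = 0) : t = 0 := by
  funext ⟨a, b⟩
  fin_cases a <;> fin_cases b <;> assumption

/-- The prescribed components along arrows, with the unit at `E_1`, already determine each tensor;
regularity then leaves no room for other components. -/
lemma HasStandardEntries.supportedOnArrows {n : ℕ} {φ : CGDatum n} (h : HasStandardEntries φ)
    (hreg : IsRegular φ) : SupportedOnArrows φ := by
  intro i j hij
  refine hreg.eq_zero_of_injective i (O₁ n) {j | IsArrow n i j ∨ IsArrow n j i} (fun t ht => ?_) hij
  rcases i with i | k
  · have hfirst : i = 0 ∨ i = 1 → (φ (Sum.inl i) (O₁ n) (O₁ n)).mulVec t = 0 :=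
      fun hi => ht (O₁ n) (Or.inl ⟨hi, rfl⟩)
    have hlast : i = 2 ∨ i = 3 → (φ (Sum.inl i) (O₁ n) (lastV n)).mulVec t = 0 :=
      fun hi => ht (lastV n) (Or.inr ⟨rfl, hi⟩)
    fin_cases i
    · have h1 := hfirst (Or.inl rfl)
      have hu : φ (Sum.inl 0) (O₁ n) (O₁ n) = _ := hreg.left_unit (O₁ n)
      simp only [Fin.zero_eta] at h1
      rw [hu] at h1
      have h0 := congrFun h1 0
      have h1 := congrFun h1 1
      simp [Matrix.mulVec, dotProduct, Fintype.sum_prod_type] at h0 h1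
      exact funext_one_two h0 h1
    · have h1 := hfirst (Or.inr rfl)
      simp only [Fin.mk_one] at h1
      rw [h.E₂_O₁] at h1
      have h0 := congrFun h1 0
      have h1 := congrFun h1 1
      rw [tensorMat_mulVec_one] at h0 h1
      simp at h0 h1
      exact funext_one_two h0 h1
    · have h1 := hlast (Or.inl rfl)
      simp only [Fin.reduceFinMk] at h1
      rw [h.E₃_O₁] at h1
      have h0 := congrFun h1 0
      have h1 := congrFun h1 1
      rw [tensorMat_mulVec_one] at h0 h1
      simp at h0 h1
      exact funext_one_two h1 h0
    · have h1 := hlast (Or.inr rfl)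
      simp only [Fin.reduceFinMk] at h1
      rw [h.E₄_O₁] at h1
      have h0 := congrFun h1 0
      have h1 := congrFun h1 1
      rw [tensorMat_mulVec_one] at h0 h1
      simp at h0 h1
      exact funext_one_two h1 h0
  · have hoff : t (0, 1) = 0 ∧ t (1, 0) = 0 := by
      rcases Fin.eq_zero_or_eq_succ k with rfl | ⟨k, rfl⟩
      · have h0 := congrFun (ht (E₁ n) (Or.inr ⟨Or.inl rfl, rfl⟩)) 0
        have h1 := congrFun (ht (Sum.inl 1) (Or.inr ⟨Or.inr rfl, rfl⟩)) 0
        rw [h.O₁_O₁_E₁, tensorMat_mulVec_two] at h0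
        rw [h.O₁_O₁_E₂, tensorMat_mulVec_two] at h1
        simp at h0 h1
        constructor
        · linear_combination (h0 + h1) / 2
        · linear_combination (h1 - h0) / 2
      · have h1 := ht (Sum.inr k.castSucc) (Or.inr (by simp [IsArrow]))
        rw [h.V_O₁_down] at h1
        have h0 := congrFun h1 0
        have h1 := congrFun h1 1
        rw [tensorMat_mulVec_two] at h0 h1
        simp at h0 h1
        exact ⟨h0, h1⟩
    have hdiag : t (0, 0) = 0 ∧ t (1, 1) = 0 := by
      rcases Fin.eq_castSucc_or_eq_last k with ⟨k, rfl⟩ | rfl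
      · have h1 := ht (Sum.inr k.succ) (Or.inl (by simp [IsArrow]))
        rw [h.V_O₁_up] at h1
        have h0 := congrFun h1 0
        have h1 := congrFun h1 1
        rw [tensorMat_mulVec_two] at h0 h1
        simp at h0 h1
        exact ⟨h0, h1⟩
      · have h0 := congrFun (ht (Sum.inl 2) (Or.inl ⟨rfl, Or.inl rfl⟩)) 0
        have h1 := congrFun (ht (Sum.inl 3) (Or.inl ⟨rfl, Or.inr rfl⟩)) 0
        rw [h.last_O₁_E₃, tensorMat_mulVec_two] at h0
        rw [h.last_O₁_E₄, tensorMat_mulVec_two] at h1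
        simp at h0 h1
        constructor
        · linear_combination (h0 + h1) / 2
        · linear_combination (h0 - h1) / 2
    exact funext_two_two hdiag.1 hoff.1 hoff.2 hdiag.2

/-- Coordinates of an `α`-dimensional representation of the double quiver: `P i` and `Q i` are the
maps from and to the `i`-th one-dimensional vertex, `a k` and `b k` the maps
`U_{k+1} → U_{k+2}` and `U_{k+2} → U_{k+1}`. -/
structure QuiverData where
  P : Fin 4 → Fin 2 → ℂ
  Q : Fin 4 → Fin 2 → ℂ
  a : ℕ → Matrix (Fin 2) (Fin 2) ℂ
  b : ℕ → Matrix (Fin 2) (Fin 2) ℂ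

/-- The representation with given coordinates. -/
def QuiverData.toRep (n : ℕ) (D : QuiverData) : DoubleRep n
  | ⟨(Sum.inl i, Sum.inr _), _⟩ => Matrix.of fun c _ => D.P i c
  | ⟨(Sum.inr _, Sum.inl i), _⟩ => Matrix.of fun _ c => D.Q i c
  | ⟨(Sum.inr k, Sum.inr l), _⟩ => if k.val < l.val then D.a k.val else D.b l.val
  | ⟨(Sum.inl _, Sum.inl _), _⟩ => 0

/-- The position in the chain `0, …, l` of two-dimensional vertices to which the `i`-th
one-dimensional vertex is attached. -/
def attach (l : ℕ) (i : Fin 4) : ℕ := if i = 0 ∨ i = 1 then 0 else l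

/-- The `k`-th two-dimensional vertex. -/
def chainV (n k : ℕ) : Fin (n - 4 + 1) := Fin.ofNat (n - 4 + 1) k

lemma chainV_val {n k : ℕ} (h : k ≤ n - 4) : (chainV n k).val = k := by
  simp [chainV, Nat.mod_eq_of_lt (show k < n - 4 + 1 by omega)]

lemma chainV_fin {n : ℕ} (k : Fin (n - 4 + 1)) : chainV n k.val = k :=
  Fin.ext (chainV_val (by omega))

lemma isArrow_inl_inr_iff {n : ℕ} {i : Fin 4} {k : Fin (n - 4 + 1)} :
    (IsArrow n (Sum.inl i) (Sum.inr k) ∨ IsArrow n (Sum.inr k) (Sum.inl i)) ↔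
      k = chainV n (attach (n - 4) i) := by
  have h0 : chainV n 0 = 0 := Fin.ext (chainV_val (by omega))
  have hl : chainV n (n - 4) = Fin.last _ := Fin.ext (chainV_val le_rfl)
  fin_cases i <;> simp [IsArrow, attach, h0, hl]

/-- The coordinates of a representation. -/
def ofRep {n : ℕ} (ρ : DoubleRep n) : QuiverData where
  P i c := extend ρ (Sum.inl i) (Sum.inr (chainV n (attach (n - 4) i))) c 0
  Q i c := extend ρ (Sum.inr (chainV n (attach (n - 4) i))) (Sum.inl i) 0 c
  a k := extend ρ (Sum.inr (chainV n k)) (Sum.inr (chainV n (k + 1)))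
  b k := extend ρ (Sum.inr (chainV n (k + 1))) (Sum.inr (chainV n k))

lemma extend_apply {n : ℕ} (ρ : DoubleRep n) (e : DArrow n) : extend ρ e.1.1 e.1.2 = ρ e := by
  rw [extend, dif_pos e.2]

lemma toRep_ofRep {n : ℕ} (ρ : DoubleRep n) : (ofRep ρ).toRep n = ρ := by
  funext ⟨⟨i, j⟩, h⟩
  rw [← extend_apply ρ ⟨⟨i, j⟩, h⟩]
  rcases i with i | k <;> rcases j with j | l
  · simp [IsArrow] at h
  · obtain rfl := isArrow_inl_inr_iff.1 h
    ext c d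
    have hd : d = 0 := Subsingleton.elim _ _
    subst hd
    rfl
  · obtain rfl := isArrow_inl_inr_iff.1 h.symm
    ext c d
    have hd : c = 0 := Subsingleton.elim _ _
    subst hd
    rfl
  · simp only [QuiverData.toRep, ofRep]
    rcases h with h | h
    · have h' : l.val = k.val + 1 := h
      rw [if_pos (by omega), ← h', chainV_fin, chainV_fin]
    · have h' : k.val = l.val + 1 := h
      rw [if_neg (by omega), ← h', chainV_fin, chainV_fin]

/-- The endomorphism of the `k`-th two-dimensional space given by the preprojective relations. -/
def QuiverData.X (D : QuiverData) : ℕ → Matrix (Fin 2) (Fin 2) ℂ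
  | 0 => Matrix.vecMulVec (D.P 0) (D.Q 0) + Matrix.vecMulVec (D.P 1) (D.Q 1)
  | k + 1 => D.a k * D.b k

/-- The preprojective relations in coordinates. -/
structure QuiverData.IsPreproj (l : ℕ) (D : QuiverData) : Prop where
  dot : ∀ i, D.Q i ⬝ᵥ D.P i = 0
  step : ∀ k < l, D.b k * D.a k = D.X k
  last : Matrix.vecMulVec (D.P 2) (D.Q 2) + Matrix.vecMulVec (D.P 3) (D.Q 3) = D.X l

open Classical in
lemma preproj_extend {n : ℕ} {ρ : DoubleRep n} (h : ρ ∈ RepPreproj n) (v : Vertex n) :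
    (∑ w : Vertex n, if IsArrow n w v then extend ρ w v * extend ρ v w else 0) -
    (∑ w : Vertex n, if IsArrow n v w then extend ρ w v * extend ρ v w else 0) = 0 := by
  refine Eq.trans ?_ (h v)
  congr 1
  · refine Finset.sum_congr rfl fun w _ => ?_
    by_cases hw : IsArrow n w v
    · rw [if_pos hw, dif_pos hw, extend, extend, dif_pos (Or.inl hw), dif_pos (Or.inr hw)]
      rfl
    · rw [if_neg hw, dif_neg hw]
  · refine Finset.sum_congr rfl fun w _ => ?_
    by_cases hw : IsArrow n v w
    · rw [if_pos hw, dif_pos hw, extend, extend, dif_pos (Or.inl hw), dif_pos (Or.inr hw)]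
      rfl
    · rw [if_neg hw, dif_neg hw]

open Classical in
lemma sum_in_eq_X {n : ℕ} (ρ : DoubleRep n) {k : ℕ} (hk : k ≤ n - 4) :
    (∑ w : Vertex n, if IsArrow n w (Sum.inr (chainV n k)) then
      extend ρ w (Sum.inr (chainV n k)) * extend ρ (Sum.inr (chainV n k)) w else 0) =
      (ofRep ρ).X k := by
  rw [Fintype.sum_sum_type]
  rcases k with _ | k
  · have h0 : chainV n 0 = 0 := Fin.ext (chainV_val (by omega))
    rw [Finset.sum_eq_zero (s := (Finset.univ : Finset (Fin (n - 4 + 1)))), add_zero,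
      Fin.sum_univ_four]
    · simp only [IsArrow, h0]
      simp only [QuiverData.X, ofRep, attach]
      ext c d
      simp [Matrix.mul_apply, Matrix.vecMulVec_apply]
    · intro w _
      rw [if_neg]
      simp [IsArrow, h0]
  · have hv := chainV_val hk
    have hv' := chainV_val (show k ≤ n - 4 by omega)
    rw [Finset.sum_eq_zero (s := (Finset.univ : Finset (Fin 4))), zero_add,
      Finset.sum_eq_single_of_mem (chainV n k) (Finset.mem_univ _), if_pos]
    · rfl
    · simp only [IsArrow]
      omega
    · intro w _ hw
      rw [if_neg]
      intro h
      apply hw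
      ext
      simp only [IsArrow] at h
      omega
    · intro i _
      rw [if_neg]
      rintro ⟨-, h⟩
      have := congrArg Fin.val h
      rw [hv] at this
      simp at this

open Classical in
lemma sum_out_eq {n : ℕ} (ρ : DoubleRep n) {k : ℕ} (hk : k ≤ n - 4) :
    (∑ w : Vertex n, if IsArrow n (Sum.inr (chainV n k)) w then
      extend ρ w (Sum.inr (chainV n k)) * extend ρ (Sum.inr (chainV n k)) w else 0) =
      if k < n - 4 then (ofRep ρ).b k * (ofRep ρ).a k else
        Matrix.vecMulVec ((ofRep ρ).P 2) ((ofRep ρ).Q 2) +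
        Matrix.vecMulVec ((ofRep ρ).P 3) ((ofRep ρ).Q 3) := by
  rw [Fintype.sum_sum_type]
  have hv := chainV_val hk
  split_ifs with hlt
  · have hv' := chainV_val (show k + 1 ≤ n - 4 by omega)
    rw [Finset.sum_eq_zero (s := (Finset.univ : Finset (Fin 4))), zero_add,
      Finset.sum_eq_single_of_mem (chainV n (k + 1)) (Finset.mem_univ _), if_pos]
    · rfl
    · simp only [IsArrow]
      omega
    · intro w _ hw
      rw [if_neg]
      intro h
      apply hw
      ext
      simp only [IsArrow] at h
      omega
    · intro i _
      rw [if_neg]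
      rintro ⟨h, -⟩
      have := congrArg Fin.val h
      rw [hv] at this
      simp at this
      omega
  · obtain rfl : k = n - 4 := by omega
    have h0 : chainV n (n - 4) = Fin.last _ := Fin.ext hv
    rw [Finset.sum_eq_zero (s := (Finset.univ : Finset (Fin (n - 4 + 1)))), add_zero,
      Fin.sum_univ_four]
    · simp only [IsArrow, h0]
      simp only [ofRep, attach]
      ext c d
      simp [Matrix.mul_apply, Matrix.vecMulVec_apply]
    · intro w _
      rw [if_neg]
      simp only [IsArrow, h0, Fin.val_last]
      omega

lemma isPreproj_ofRep {n : ℕ} {ρ : DoubleRep n} (h : ρ ∈ RepPreproj n) :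
    (ofRep ρ).IsPreproj (n - 4) where
  dot i := by
    have h1 := preproj_extend h (Sum.inl i)
    have h0 : chainV n 0 = 0 := Fin.ext (chainV_val (by omega))
    have hl : chainV n (n - 4) = Fin.last _ := Fin.ext (chainV_val le_rfl)
    rw [Fintype.sum_sum_type, Fintype.sum_sum_type] at h1
    simp only [dotProduct, ofRep, attach]
    fin_cases i
    all_goals
      simp only [IsArrow, ← h0, ← hl] at h1
      simp at h1
      have h2 := congrFun (congrFun h1 0) 0
      simpa [Matrix.mul_apply] using h2
  step k hk := by
    have h1 := preproj_extend h (Sum.inr (chainV n k))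
    rw [sum_in_eq_X ρ hk.le, sum_out_eq ρ hk.le, if_pos hk] at h1
    exact (sub_eq_zero.1 h1).symm
  last := by
    have h1 := preproj_extend h (Sum.inr (chainV n (n - 4)))
    rw [sum_in_eq_X ρ le_rfl, sum_out_eq ρ le_rfl, if_neg (lt_irrefl _)] at h1
    exact (sub_eq_zero.1 h1).symm

/-! ### Base change and limits in coordinates -/

/-- Base change matrices `G k`, `γ i` carrying the coordinates `D'` to the coordinates `D`. -/
structure QuiverData.IsBaseChange (l : ℕ) (D D' : QuiverData) (G : ℕ → Matrix (Fin 2) (Fin 2) ℂ)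
    (γ : Fin 4 → ℂ) : Prop where
  γ_ne : ∀ i, γ i ≠ 0
  γ_zero : γ 0 = 1
  det_ne : ∀ k ≤ l, (G k).det ≠ 0
  P : ∀ i, γ i • D.P i = (G (attach l i)).mulVec (D'.P i)
  Q : ∀ i, Matrix.vecMul (D.Q i) (G (attach l i)) = γ i • D'.Q i
  a : ∀ k < l, D.a k * G k = G (k + 1) * D'.a k
  b : ∀ k < l, D.b k * G (k + 1) = G k * D'.b k

/-- The representations `R(ψ, y)` for `ψ` in the orbit of `φ`. -/
def genericReps {n : ℕ} (φ : CGDatum n) : Set (DoubleRep n) :=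
  {σ | ∃ ψ ∈ orbit φ, ∃ y, R ψ y = σ}

/-- The map `u ↦ u ⊗ y`. -/
def tensorRight {p q : Type} [DecidableEq p] (y : q → ℂ) : Matrix (p × q) p ℂ :=
  Matrix.of fun x a => if x.1 = a then y x.2 else 0

lemma rightMul_eq {n : ℕ} (φ : CGDatum n) (y : Fin (dim n (O₁ n)) → ℂ) (i j : Vertex n) :
    rightMul φ y i j = φ i (O₁ n) j *
      (tensorRight y : Matrix (Fin (dim n i) × Fin (dim n (O₁ n))) (Fin (dim n i)) ℂ) := by
  ext c a
  simp only [rightMul, tensorRight, Matrix.mul_apply, Matrix.of_apply, Fintype.sum_prod_type,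
    mul_ite, mul_zero]
  rw [Finset.sum_comm]
  simp

lemma kronecker_mul_tensorRight {p q : Type} [DecidableEq p] [Fintype p] [Fintype q]
    (A : Matrix p p ℂ) (B : Matrix q q ℂ) (y : q → ℂ) :
    (A ⊗ₖ B) * (tensorRight y : Matrix (p × q) p ℂ) =
      (tensorRight (B.mulVec y) : Matrix (p × q) p ℂ) * A := by
  ext ⟨a, o⟩ a'
  simp only [tensorRight, Matrix.mul_apply, Matrix.of_apply, Matrix.kroneckerMap_apply,
    Fintype.sum_prod_type, mul_ite, mul_zero, ite_mul, zero_mul, Finset.sum_ite_eq,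
    Finset.mem_univ, if_true]
  rw [Finset.sum_comm]
  simp only [Finset.sum_ite_eq', Finset.mem_univ, if_true, Matrix.mulVec, dotProduct,
    Finset.sum_mul]
  exact Finset.sum_congr rfl fun b _ => by ring

/-- Equivariance of `R`: a base change of the representation moves the datum and the vector `y`
together, so `genericReps` is stable under base changes trivial at `E_1`. -/
lemma gaugeRep_R {n : ℕ} (g : GLα n) (φ : CGDatum n) (y : Fin (dim n (O₁ n)) → ℂ) :
    gaugeRep g (R φ y) = R (gaugeCG g φ) ((g (O₁ n)).val.mulVec y) := by
  funext e
  have hy : (g (O₁ n))⁻¹.val.mulVec ((g (O₁ n)).val.mulVec y) = y := by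
    rw [Matrix.mulVec_mulVec]
    simp
  rw [R_apply, gaugeRep, R_apply, rightMul_eq, rightMul_eq, gaugeCG, Matrix.mul_assoc _ (_ ⊗ₖ _),
    kronecker_mul_tensorRight, hy]
  simp only [Matrix.mul_assoc]

lemma gaugeCG_gaugeCG {n : ℕ} (g g' : GLα n) (φ : CGDatum n) :
    gaugeCG g (gaugeCG g' φ) = gaugeCG (g * g') φ := by
  funext i j k
  have e : ∀ v, (g * g') v = g v * g' v := fun v => rfl
  simp only [gaugeCG, e, mul_inv_rev, Units.val_mul, Matrix.mul_kronecker_mul, Matrix.mul_assoc]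

lemma gaugeRep_mem_genericReps {n : ℕ} {φ : CGDatum n} {σ : DoubleRep n} (h : σ ∈ genericReps φ)
    {g : GLα n} (hg : g (E₁ n) = 1) : gaugeRep g σ ∈ genericReps φ := by
  obtain ⟨_, ⟨g', hg', rfl⟩, y, rfl⟩ := h
  rw [gaugeRep_R, gaugeCG_gaugeCG]
  exact ⟨_, ⟨g * g', by rw [Pi.mul_apply, hg, hg', one_mul], rfl⟩, _, rfl⟩

lemma continuous_gaugeRep {n : ℕ} (g : GLα n) : Continuous (gaugeRep g) :=
  continuous_pi fun e => (continuous_const.matrix_mul (continuous_apply e)).matrix_mul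
    continuous_const

lemma gaugeRep_mem_closure {n : ℕ} {φ : CGDatum n} {σ : DoubleRep n}
    (h : σ ∈ closure (genericReps φ)) {g : GLα n} (hg : g (E₁ n) = 1) :
    gaugeRep g σ ∈ closure (genericReps φ) :=
  map_mem_closure (continuous_gaugeRep g) h fun _ hσ => gaugeRep_mem_genericReps hσ hg

lemma gaugeRep_apply_eq {n : ℕ} {g : GLα n} {σ : DoubleRep n} {e : DArrow n}
    {M : Matrix (Fin (dim n e.1.2)) (Fin (dim n e.1.1)) ℂ}
    (h : M * (g e.1.1).val = (g e.1.2).val * σ e) : M = gaugeRep g σ e := by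
  rw [gaugeRep, ← h, Matrix.mul_assoc]
  simp

lemma attach_le (l : ℕ) (i : Fin 4) : attach l i ≤ l := by
  unfold attach
  split_ifs <;> omega

/-- The element of the gauge group with given matrices. -/
def QuiverData.IsBaseChange.gauge {n : ℕ} {D D' : QuiverData} {G : ℕ → Matrix (Fin 2) (Fin 2) ℂ}
    {γ : Fin 4 → ℂ} (h : D.IsBaseChange (n - 4) D' G γ) : GLα n
  | Sum.inl i => Matrix.GeneralLinearGroup.mkOfDetNeZero (Matrix.of fun _ _ : Fin 1 => γ i)
      (by simpa using h.γ_ne i)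
  | Sum.inr k => Matrix.GeneralLinearGroup.mkOfDetNeZero (G k.val) (h.det_ne _ (by omega))

lemma QuiverData.IsBaseChange.toRep_eq {n : ℕ} {D D' : QuiverData}
    {G : ℕ → Matrix (Fin 2) (Fin 2) ℂ} {γ : Fin 4 → ℂ} (h : D.IsBaseChange (n - 4) D' G γ) :
    D.toRep n = gaugeRep h.gauge (D'.toRep n) := by
  funext ⟨⟨i, j⟩, hij⟩
  apply gaugeRep_apply_eq
  rcases i with i | k <;> rcases j with j | m
  · simp [IsArrow] at hij
  · obtain rfl := isArrow_inl_inr_iff.1 hij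
    have hP := h.P i
    rw [← chainV_val (attach_le (n - 4) i)] at hP
    ext c d
    have hd : d = 0 := Subsingleton.elim _ _
    subst hd
    have := congrFun hP c
    simpa [QuiverData.toRep, gauge, Matrix.mul_apply, Matrix.mulVec, dotProduct, mul_comm (γ i)]
      using this
  · obtain rfl := isArrow_inl_inr_iff.1 hij.symm
    have hQ := h.Q j
    rw [← chainV_val (attach_le (n - 4) j)] at hQ
    ext c d
    have hc : c = 0 := Subsingleton.elim _ _
    subst hc
    have := congrFun hQ d
    simpa [QuiverData.toRep, gauge, Matrix.mul_apply, Matrix.vecMul, dotProduct] using this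
  · simp only [QuiverData.toRep]
    rcases hij with hij | hij
    · have h' : m.val = k.val + 1 := hij
      rw [if_pos (by omega), if_pos (by omega)]
      have := h.a k.val (by omega)
      rw [← h'] at this
      exact this
    · have h' : k.val = m.val + 1 := hij
      rw [if_neg (by omega), if_neg (by omega)]
      have := h.b m.val (by omega)
      rw [← h'] at this
      exact this

lemma QuiverData.IsBaseChange.mem_closure {n : ℕ} {φ : CGDatum n} {D D' : QuiverData}
    {G : ℕ → Matrix (Fin 2) (Fin 2) ℂ} {γ : Fin 4 → ℂ} (h : D.IsBaseChange (n - 4) D' G γ)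
    (hD' : D'.toRep n ∈ closure (genericReps φ)) : D.toRep n ∈ closure (genericReps φ) := by
  rw [h.toRep_eq]
  refine gaugeRep_mem_closure hD' ?_
  ext p q
  have hp : p = 0 := Subsingleton.elim _ _
  have hq : q = 0 := Subsingleton.elim _ _
  subst hp hq
  exact h.γ_zero

/-- A family of coordinates which is continuous at `0`. -/
structure QuiverData.IsContinuousAt (F : ℂ → QuiverData) : Prop where
  P : ContinuousAt (fun t => (F t).P) 0
  Q : ContinuousAt (fun t => (F t).Q) 0
  a : ∀ k, ContinuousAt (fun t => (F t).a k) 0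
  b : ∀ k, ContinuousAt (fun t => (F t).b k) 0

lemma QuiverData.IsContinuousAt.toRep {F : ℂ → QuiverData} (h : IsContinuousAt F) (n : ℕ) :
    ContinuousAt (fun t => (F t).toRep n) 0 := by
  refine continuousAt_pi.2 ?_
  rintro ⟨⟨i | k, j | m⟩, hij⟩
  · exact continuousAt_const
  · exact continuousAt_pi.2 fun c => continuousAt_pi.2 fun _ =>
      continuousAt_pi.1 (continuousAt_pi.1 h.P i) c
  · exact continuousAt_pi.2 fun _ => continuousAt_pi.2 fun c =>
      continuousAt_pi.1 (continuousAt_pi.1 h.Q j) c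
  · simp only [QuiverData.toRep]
    split_ifs
    · exact h.a k.val
    · exact h.b m.val

lemma QuiverData.IsContinuousAt.mem_closure {n : ℕ} {φ : CGDatum n} {F : ℂ → QuiverData}
    (h : IsContinuousAt F) (hF : ∀ᶠ t in 𝓝[≠] 0, (F t).toRep n ∈ closure (genericReps φ)) :
    (F 0).toRep n ∈ closure (genericReps φ) :=
  isClosed_closure.mem_of_tendsto ((h.toRep n).tendsto.mono_left nhdsWithin_le_nhds) hF

/-! ### The representations of the normalised datum -/

/-- The coordinates of `R(φ⁽⁰⁾, y)`. -/
def standardData (y : Fin 2 → ℂ) : QuiverData where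
  P := ![y, ![y 0, -y 1], ![y 1, -y 0], ![y 1, y 0]]
  Q := ![![y 1, -y 0], ![y 1, y 0], y, ![y 0, -y 1]]
  a _ := !![2 * y 0, 0; 0, 2 * y 1]
  b _ := !![y 1, 0; 0, -y 0]

lemma rightMul_one_apply {n : ℕ} {φ : CGDatum n} (y : Fin 2 → ℂ) {i : Fin 4} {j : Vertex n}
    {A : Matrix (Fin (dim n j)) (Fin (1 * 2)) ℂ}
    (hA : φ (Sum.inl i) (O₁ n) j = tensorMat (q := 1) (r := 2) A) (c : Fin (dim n j)) :
    rightMul φ y (Sum.inl i) j c 0 = A c 0 * y 0 + A c 1 * y 1 := by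
  have e : rightMul φ y (Sum.inl i) j c 0 =
      ∑ b : Fin 2, tensorMat (q := 1) (r := 2) A c (0, b) * y b := by
    rw [← hA]
    rfl
  rw [e, Fin.sum_univ_two]
  rfl

lemma rightMul_two_apply {n : ℕ} {φ : CGDatum n} (y : Fin 2 → ℂ) {k : Fin (n - 4 + 1)}
    {j : Vertex n} {A : Matrix (Fin (dim n j)) (Fin (2 * 2)) ℂ}
    (hA : φ (Sum.inr k) (O₁ n) j = tensorMat (q := 2) (r := 2) A) (c : Fin (dim n j)) :
    rightMul φ y (Sum.inr k) j c = ![A c 0 * y 0 + A c 1 * y 1, A c 2 * y 0 + A c 3 * y 1] := by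
  have e : ∀ a : Fin 2, rightMul φ y (Sum.inr k) j c a =
      ∑ b : Fin 2, tensorMat (q := 2) (r := 2) A c (a, b) * y b := by
    rw [← hA]
    exact fun a => rfl
  funext a
  rw [e, Fin.sum_univ_two]
  fin_cases a <;> rfl

lemma HasStandardEntries.toRep_standardData {n : ℕ} {φ : CGDatum n} (h : HasStandardEntries φ)
    (hreg : IsRegular φ) (y : Fin 2 → ℂ) : (standardData y).toRep n = R φ y := by
  funext ⟨⟨i, j⟩, hij⟩
  have h0 : chainV n 0 = 0 := Fin.ext (chainV_val (by omega))
  have hl : chainV n (n - 4) = Fin.last _ := Fin.ext (chainV_val le_rfl)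
  rw [R_apply]
  rcases i with i | k <;> rcases j with j | m
  · simp [IsArrow] at hij
  · have hm := isArrow_inl_inr_iff.1 hij
    ext c d
    have hd : d = 0 := Subsingleton.elim _ _
    subst hd
    change (standardData y).P i c = rightMul φ y (Sum.inl i) (Sum.inr m) c 0
    fin_cases i
    · obtain rfl : m = 0 := by simpa [attach, h0] using hm
      have e : rightMul φ y (Sum.inl 0) (Sum.inr 0) c 0 =
        ∑ b : Fin 2, φ (E₁ n) (O₁ n) (O₁ n) c (0, b) * y b := rfl
      have hu := hreg.left_unit (O₁ n)
      refine Eq.trans ?_ e.symm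
      rw [hu]
      fin_cases c <;> simp [standardData]
    · obtain rfl : m = 0 := by simpa [attach, h0] using hm
      refine Eq.trans ?_ (rightMul_one_apply y h.E₂_O₁ c).symm
      fin_cases c <;> simp [standardData]
    · obtain rfl : m = Fin.last _ := by simpa [attach, hl] using hm
      refine Eq.trans ?_ (rightMul_one_apply y h.E₃_O₁ c).symm
      fin_cases c <;> simp [standardData]
    · obtain rfl : m = Fin.last _ := by simpa [attach, hl] using hm
      refine Eq.trans ?_ (rightMul_one_apply y h.E₄_O₁ c).symm
      fin_cases c <;> simp [standardData]
  · have hm := isArrow_inl_inr_iff.1 hij.symm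
    ext d c
    have hd : d = 0 := Subsingleton.elim _ _
    subst hd
    change (standardData y).Q j c = rightMul φ y (Sum.inr k) (Sum.inl j) 0 c
    fin_cases j
    · obtain rfl : k = 0 := by simpa [attach, h0] using hm
      refine Eq.trans ?_ (congrFun (rightMul_two_apply y h.O₁_O₁_E₁ 0) c).symm
      fin_cases c <;> simp [standardData]
    · obtain rfl : k = 0 := by simpa [attach, h0] using hm
      refine Eq.trans ?_ (congrFun (rightMul_two_apply y h.O₁_O₁_E₂ 0) c).symm
      fin_cases c <;> simp [standardData]
    · obtain rfl : k = Fin.last _ := by simpa [attach, hl] using hm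
      refine Eq.trans ?_ (congrFun (rightMul_two_apply y h.last_O₁_E₃ 0) c).symm
      fin_cases c <;> simp [standardData]
    · obtain rfl : k = Fin.last _ := by simpa [attach, hl] using hm
      refine Eq.trans ?_ (congrFun (rightMul_two_apply y h.last_O₁_E₄ 0) c).symm
      fin_cases c <;> simp [standardData]
  · rcases hij with hij | hij
    · have h' : m.val = k.val + 1 := hij
      obtain ⟨k, rfl⟩ : ∃ k' : Fin (n - 4), k = k'.castSucc := ⟨⟨k.val, by omega⟩, rfl⟩
      obtain rfl : m = k.succ := Fin.ext h'
      ext c a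
      refine Eq.trans ?_ (congrFun (rightMul_two_apply y (h.V_O₁_up k) c) a).symm
      fin_cases c <;> fin_cases a <;> simp [standardData, QuiverData.toRep]
    · have h' : k.val = m.val + 1 := hij
      obtain ⟨m, rfl⟩ : ∃ k' : Fin (n - 4), m = k'.castSucc := ⟨⟨m.val, by omega⟩, rfl⟩
      obtain rfl : k = m.succ := Fin.ext h'
      ext c a
      refine Eq.trans ?_ (congrFun (rightMul_two_apply y (h.V_O₁_down m) c) a).symm
      have hlt : ¬ (m.val + 1 < m.val) := by omega
      fin_cases c <;> fin_cases a <;> simp [standardData, QuiverData.toRep, hlt]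

lemma HasStandardEntries.standardData_mem {n : ℕ} {φ : CGDatum n} (h : HasStandardEntries φ)
    (hreg : IsRegular φ) (y : Fin 2 → ℂ) :
    (standardData y).toRep n ∈ closure (genericReps φ) := by
  refine subset_closure ⟨φ, ⟨1, rfl, ?_⟩, y, (h.toRep_standardData hreg y).symm⟩
  funext i j k
  simp [gaugeCG]

/-! ### Representations with nonvanishing discriminant -/

/-- The matrix with columns `u` and `v`. -/
def cols (u v : Fin 2 → ℂ) : Matrix (Fin 2) (Fin 2) ℂ := !![u 0, v 0; u 1, v 1]

lemma mul_cols (M : Matrix (Fin 2) (Fin 2) ℂ) (u v : Fin 2 → ℂ) :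
    M * cols u v = cols (M.mulVec u) (M.mulVec v) := by
  ext i j
  fin_cases i <;> fin_cases j <;> simp [cols, Matrix.mul_apply, Matrix.mulVec, dotProduct]

lemma cols_mul (u v : Fin 2 → ℂ) (a b c d : ℂ) :
    cols u v * !![a, b; c, d] = cols (a • u + c • v) (b • u + d • v) := by
  ext i j
  fin_cases i <;> fin_cases j <;> simp [cols, Matrix.mul_apply, mul_comm]

lemma vecMul_cols (q u v : Fin 2 → ℂ) : Matrix.vecMul q (cols u v) = ![q ⬝ᵥ u, q ⬝ᵥ v] := by
  ext i
  fin_cases i <;> simp [cols, Matrix.vecMul, dotProduct]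

lemma cols_mulVec (u v : Fin 2 → ℂ) (a b : ℂ) : (cols u v).mulVec ![a, b] = a • u + b • v := by
  ext i
  fin_cases i <;> simp [cols, Matrix.mulVec, dotProduct, mul_comm]

lemma det_cols (u v : Fin 2 → ℂ) : (cols u v).det = u 0 * v 1 - v 0 * u 1 := by
  simp [cols, Matrix.det_fin_two]

/-- The vector `u` of the first two-dimensional space transported along the chain. -/
def QuiverData.trans (D : QuiverData) (u : Fin 2 → ℂ) : ℕ → Fin 2 → ℂ
  | 0 => u
  | k + 1 => (D.a k).mulVec (D.trans u k)

/-- At the start of the chain `Q_0·P_0 = Q_1·P_1 = 0`, so `X` sends each of `P_0`, `P_1` to a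
multiple of the other. The relations give `X_{k+1} a_k = a_k X_k`, which carries this along the
chain. -/
lemma QuiverData.IsPreproj.X_trans {l : ℕ} {D : QuiverData} (h : D.IsPreproj l) {k : ℕ}
    (hk : k ≤ l) :
    (D.X k).mulVec (D.trans (D.P 0) k) = (D.Q 1 ⬝ᵥ D.P 0) • D.trans (D.P 1) k ∧
    (D.X k).mulVec (D.trans (D.P 1) k) = (D.Q 0 ⬝ᵥ D.P 1) • D.trans (D.P 0) k := by
  induction k with
  | zero =>
    simp only [X, trans, Matrix.add_mulVec, Matrix.vecMulVec_mulVec, h.dot, MulOpposite.op_zero,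
      zero_smul, zero_add, add_zero, op_smul_eq_smul]
    exact ⟨trivial, trivial⟩
  | succ k ih =>
    have e : ∀ u, (D.X (k + 1)).mulVec (D.trans u (k + 1)) =
        (D.a k).mulVec ((D.X k).mulVec (D.trans u k)) := by
      intro u
      rw [X, trans, Matrix.mulVec_mulVec, Matrix.mulVec_mulVec, Matrix.mul_assoc,
        h.step k (by omega)]
    rw [e, e, (ih (by omega)).1, (ih (by omega)).2, Matrix.mulVec_smul, Matrix.mulVec_smul]
    exact ⟨rfl, rfl⟩

lemma QuiverData.IsPreproj.b_trans {l : ℕ} {D : QuiverData} (h : D.IsPreproj l) {k : ℕ}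
    (hk : k < l) (u : Fin 2 → ℂ) :
    (D.b k).mulVec (D.trans u (k + 1)) = (D.X k).mulVec (D.trans u k) := by
  rw [trans, Matrix.mulVec_mulVec, h.step k hk]

/-- The normal form of representations for which the vectors `y_k` transported from `E_1` and
their images `X y_k` form bases. -/
def chainData (d : ℂ) (p q p' q' : Fin 2 → ℂ) : QuiverData where
  P := ![![1, 0], ![0, 1], p, p']
  Q := ![![0, d], ![1, 0], q, q']
  a _ := 1
  b _ := !![0, d; 1, 0]

/-- The preprojective relations at the end of the chain for `chainData`. -/
structure IsChainEnd (d : ℂ) (p q p' q' : Fin 2 → ℂ) : Prop where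
  dot : q ⬝ᵥ p = 0
  dot' : q' ⬝ᵥ p' = 0
  sum : Matrix.vecMulVec p q + Matrix.vecMulVec p' q' = !![0, d; 1, 0]

lemma exists_mulVec_eq {G : Matrix (Fin 2) (Fin 2) ℂ} (hG : G.det ≠ 0) (u : Fin 2 → ℂ) :
    ∃ p, G.mulVec p = u :=
  ⟨G⁻¹.mulVec u, by rw [Matrix.mulVec_mulVec, Matrix.mul_nonsing_inv _ (Ne.isUnit hG),
    Matrix.one_mulVec]⟩

lemma mul_left_cancel_of_det {G M N : Matrix (Fin 2) (Fin 2) ℂ} (hG : G.det ≠ 0)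
    (h : G * M = G * N) : M = N := by
  have := congrArg (G⁻¹ * ·) h
  simpa [← Matrix.mul_assoc, Matrix.nonsing_inv_mul _ (Ne.isUnit hG)] using this

/-- In the bases `y_k`, `X y_k` transport becomes the identity and every `b k` becomes the companion
matrix of `X`; all remaining freedom sits in the maps at `E_3` and `E_4`. -/
lemma QuiverData.IsPreproj.exists_chainData {l : ℕ} {D : QuiverData} (h : D.IsPreproj l)
    (h1 : D.Q 1 ⬝ᵥ D.P 0 ≠ 0)
    (hdet : ∀ k ≤ l, (cols (D.trans (D.P 0) k) (D.trans (D.P 1) k)).det ≠ 0) :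
    ∃ p q p' q' G γ, IsChainEnd ((D.Q 0 ⬝ᵥ D.P 1) * (D.Q 1 ⬝ᵥ D.P 0)) p q p' q' ∧
      D.IsBaseChange l (chainData ((D.Q 0 ⬝ᵥ D.P 1) * (D.Q 1 ⬝ᵥ D.P 0)) p q p' q') G γ ∧
      γ 2 = 1 ∧ γ 3 = 1 := by
  set t := D.Q 1 ⬝ᵥ D.P 0 with ht
  set s := D.Q 0 ⬝ᵥ D.P 1 with hs
  let G : ℕ → Matrix (Fin 2) (Fin 2) ℂ := fun k =>
    cols (D.trans (D.P 0) k) (t • D.trans (D.P 1) k)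
  have hG : ∀ k ≤ l, (G k).det ≠ 0 := fun k hk => by
    have := mul_ne_zero h1 (hdet k hk)
    rw [det_cols] at this
    simp only [G, det_cols, Pi.smul_apply, smul_eq_mul]
    intro h0
    apply this
    linear_combination h0
  have hX : ∀ k ≤ l, D.X k * G k = G k * !![0, s * t; 1, 0] := fun k hk => by
    simp only [G]
    rw [mul_cols, cols_mul, Matrix.mulVec_smul, (h.X_trans hk).1, (h.X_trans hk).2, smul_smul]
    simp [mul_comm, ht, hs]
  obtain ⟨p, hp⟩ := exists_mulVec_eq (hG l le_rfl) (D.P 2)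
  obtain ⟨p', hp'⟩ := exists_mulVec_eq (hG l le_rfl) (D.P 3)
  have hend : IsChainEnd (s * t) p (Matrix.vecMul (D.Q 2) (G l)) p'
      (Matrix.vecMul (D.Q 3) (G l)) := by
    refine ⟨?_, ?_, ?_⟩
    · rw [← Matrix.dotProduct_mulVec, hp, h.dot]
    · rw [← Matrix.dotProduct_mulVec, hp', h.dot]
    · apply mul_left_cancel_of_det (hG l le_rfl)
      rw [← hX l le_rfl, ← h.last, Matrix.mul_add, Matrix.add_mul, Matrix.mul_vecMulVec,
        Matrix.mul_vecMulVec, hp, hp', Matrix.vecMulVec_mul, Matrix.vecMulVec_mul]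
  refine ⟨p, _, p', _, G, ![1, t, 1, 1], hend, ⟨?_, rfl, hG, ?_, ?_, ?_, ?_⟩, rfl, rfl⟩
  · intro i
    fin_cases i <;> simp [h1]
  · intro i
    fin_cases i
    · ext j
      fin_cases j <;> simp [attach, chainData, G, cols, trans]
    · ext j
      fin_cases j <;> simp [attach, chainData, G, cols, trans]
    · simp [attach, chainData, hp]
    · simp [attach, chainData, hp']
  · intro i
    fin_cases i
    · simp [attach, chainData, G, vecMul_cols, trans, h.dot, ← hs, mul_comm]
    · simp [attach, chainData, G, vecMul_cols, trans, h.dot, ← ht]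
    · simp [attach, chainData]
    · simp [attach, chainData]
  · intro k hk
    simp [G, chainData, mul_cols, trans, Matrix.mulVec_smul]
  · intro k hk
    simp only [chainData]
    rw [← hX k hk.le]
    simp only [G]
    rw [mul_cols, mul_cols, Matrix.mulVec_smul, Matrix.mulVec_smul, h.b_trans hk, h.b_trans hk]

/-- The eigenvalue pairings of the linear form `q` with the eigenvectors `(c, ±1)` do not vanish. -/
lemma IsChainEnd.pairing_ne_zero {c : ℂ} (hc : c ≠ 0) {p q p' q' : Fin 2 → ℂ}
    (h : IsChainEnd (c ^ 2) p q p' q') : q 0 * c + q 1 ≠ 0 := by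
  have h00 := congrFun (congrFun h.sum 0) 0
  have h01 := congrFun (congrFun h.sum 0) 1
  have h10 := congrFun (congrFun h.sum 1) 0
  have h11 := congrFun (congrFun h.sum 1) 1
  have hd := h.dot'
  simp [Matrix.vecMulVec_apply, dotProduct] at h00 h01 h10 h11 hd
  -- If `q` killed the eigenvector `(c, 1)`, then `p' q'` alone would act on it as `X`. So `p'`
  -- would be proportional to it unless `q'` kills it too, and `q'·p' = 0` forces the latter; then
  -- `X (c, 1) = 0`, against `c ≠ 0`.
  intro h0
  have e0 : p' 0 * (q' 0 * c + q' 1) = c * c := by linear_combination c * h00 + h01 - p 0 * h0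
  have e1 : p' 1 * (q' 0 * c + q' 1) = c := by linear_combination c * h10 + h11 - p 1 * h0
  have e2 : q' 0 * c + q' 1 = 0 := by
    have : c * (q' 0 * c + q' 1) = 0 := by
      linear_combination (q' 0 * c + q' 1) * hd - q' 0 * e0 - q' 1 * e1
    simpa [hc] using this
  rw [e2] at e1
  exact hc (by linear_combination -e1)

lemma IsChainEnd.neg_root {c : ℂ} {p q p' q' : Fin 2 → ℂ} (h : IsChainEnd (c ^ 2) p q p' q') :
    IsChainEnd ((-c) ^ 2) p q p' q' := by rwa [neg_sq]

/-- Used to find `y = (u, v)`: the product is fixed by the eigenvalue `c` of `X`, and the ratio of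
powers by matching the two eigenlines at the far end of the chain. -/
lemma exists_mul_eq_pow_eq {c r : ℂ} (hc : c ≠ 0) (hr : r ≠ 0) {m : ℕ} (hm : m ≠ 0) :
    ∃ u v : ℂ, u ≠ 0 ∧ v ≠ 0 ∧ 2 * u * v = c ∧ v ^ m = r * u ^ m := by
  obtain ⟨v, hv⟩ := IsAlgClosed.exists_pow_nat_eq (r * (c / 2) ^ m) (show 0 < 2 * m by omega)
  have hv0 : v ≠ 0 := by
    rintro rfl
    rw [zero_pow (by omega)] at hv
    exact mul_ne_zero hr (pow_ne_zero _ (div_ne_zero hc two_ne_zero)) hv.symm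
  refine ⟨c / 2 / v, v, div_ne_zero (div_ne_zero hc two_ne_zero) hv0, hv0, by field_simp, ?_⟩
  rw [div_pow (c / 2), ← mul_div_assoc, ← hv, eq_div_iff (pow_ne_zero _ hv0)]
  ring

/-- A chain with nonzero discriminant is one of the representations `R(φ⁽⁰⁾, y)` up to base
change. -/
lemma IsChainEnd.exists_isBaseChange {c : ℂ} (hc : c ≠ 0) {p q p' q' : Fin 2 → ℂ}
    (h : IsChainEnd (c ^ 2) p q p' q') (l : ℕ) :
    ∃ y G γ, (chainData (c ^ 2) p q p' q').IsBaseChange l (standardData y) G γ := by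
  have hA := h.pairing_ne_zero hc
  have hB := h.neg_root.pairing_ne_zero (neg_ne_zero.2 hc)
  have h' : IsChainEnd (c ^ 2) p' q' p q := ⟨h.dot', h.dot, by rw [add_comm, h.sum]⟩
  have hA' := h'.pairing_ne_zero hc
  have h00 := congrFun (congrFun h.sum 0) 0
  have h01 := congrFun (congrFun h.sum 0) 1
  have h10 := congrFun (congrFun h.sum 1) 0
  have h11 := congrFun (congrFun h.sum 1) 1
  have hd := h.dot
  have hd' := h.dot'
  simp [Matrix.vecMulVec_apply, dotProduct] at h00 h01 h10 h11 hd hd'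
  set A := q 0 * c + q 1 with hAdef
  set B := q 0 * -c + q 1 with hBdef
  set A' := q' 0 * c + q' 1 with hAdef'
  set B' := q' 0 * -c + q' 1 with hBdef'
  have eA0 : p 0 * A + p' 0 * A' = c * c := by linear_combination c * h00 + h01
  have eA1 : p 1 * A + p' 1 * A' = c := by linear_combination c * h10 + h11
  have eB0 : p 0 * B + p' 0 * B' = c * c := by linear_combination -c * h00 + h01
  have eB1 : p 1 * B + p' 1 * B' = -c := by linear_combination -c * h10 + h11
  -- Applying `q` to the eigenvector equations for `(c, 1)` and `(-c, 1)`, with `q·p = 0`, gives two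
  -- equations in `q·p'`; eliminating it gives the relation.
  have hAB : A * B' + A' * B = 0 := by
    have m1 : (q 0 * p' 0 + q 1 * p' 1) * A' = c * A := by
      linear_combination q 0 * eA0 + q 1 * eA1 - A * hd
    have m2 : (q 0 * p' 0 + q 1 * p' 1) * B' = -(c * B) := by
      linear_combination q 0 * eB0 + q 1 * eB1 - B * hd
    have : c * (A * B' + A' * B) = 0 := by linear_combination A' * m2 - B' * m1
    simpa [hc] using this
  -- For the standard data `X_0 = diag(2uv, -2uv)`, hence `2uv = c`. The exponent `l + 2` collects
  -- `l + 1` factors from the scalings `s l`, `t l` below and one from the end map `y`.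
  obtain ⟨u, v, hu, hv, huv, hpow⟩ := exists_mul_eq_pow_eq (m := l + 2) hc
    (neg_ne_zero.2 (div_ne_zero hB hA)) (by omega)
  -- Scalings of the eigenvectors `(c, 1)` and `(c, -1)`. They are fixed at `k = 0` by `P_0`, and
  -- then by the recursion coming from `a = diag(2u, 2v)`.
  let s : ℕ → ℂ := fun k => (2 * c * 2 ^ k * u ^ (k + 1))⁻¹
  let t : ℕ → ℂ := fun k => (2 * c * 2 ^ k * v ^ (k + 1))⁻¹
  have hs0 : ∀ k, s k ≠ 0 := fun k => by simp [s, hc, hu]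
  have ht0 : ∀ k, t k ≠ 0 := fun k => by simp [t, hc, hv]
  have hs : ∀ k, s k = 2 * u * s (k + 1) := fun k => by
    simp only [s]; field_simp; ring
  have ht : ∀ k, t k = 2 * v * t (k + 1) := fun k => by
    simp only [t]; field_simp; ring
  have hs00 : 2 * c * u * s 0 = 1 := by simp only [s]; field_simp; ring
  have ht00 : 2 * c * v * t 0 = 1 := by simp only [t]; field_simp; ring
  have hst : s l * A * v = -(t l * B * u) := by
    rw [neg_mul, div_mul_eq_mul_div, eq_neg_iff_add_eq_zero, add_div' _ _ _ hA,
      div_eq_zero_iff, or_iff_left hA] at hpow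
    simp only [s, t]
    field_simp
    linear_combination hpow
  have hst' : s l * A' * v = t l * B' * u := by
    apply mul_left_cancel₀ hA
    linear_combination A' * hst - t l * u * hAB
  have hB' : B' ≠ 0 := h'.neg_root.pairing_ne_zero (neg_ne_zero.2 hc)
  have ep0 : 2 * p 0 * A * B = c ^ 2 * (A + B) := by
    linear_combination B * eA0 + A * eB0 - p' 0 * hAB
  have ep1 : 2 * p 1 * A * B = c * (B - A) := by
    linear_combination B * eA1 + A * eB1 - p' 1 * hAB
  have ep0' : 2 * p' 0 * A' * B' = c ^ 2 * (A' + B') := by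
    linear_combination B' * eA0 + A' * eB0 - p 0 * hAB
  have ep1' : 2 * p' 1 * A' * B' = c * (B' - A') := by
    linear_combination B' * eA1 + A' * eB1 - p 1 * hAB
  clear_value s t A B A' B'
  refine ⟨![u, v], fun k => cols (s k • ![c, 1]) (t k • ![c, -1]),
    ![1, c⁻¹, s l * A / u, s l * A' / u], ⟨?_, rfl, ?_, ?_, ?_, ?_, ?_⟩⟩
  · intro i
    fin_cases i <;> simp [hc, hs0, hA, hA', hu]
  · intro k _
    rw [det_cols]
    have := mul_ne_zero (mul_ne_zero (hs0 k) (ht0 k)) (mul_ne_zero two_ne_zero hc)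
    intro h0
    apply this
    simp at h0
    linear_combination -h0
  · intro i
    fin_cases i
    · ext j
      fin_cases j
      · simp [attach, chainData, standardData, cols]
        linear_combination -hs00 / 2 - ht00 / 2
      · simp [attach, chainData, standardData, cols]
        apply mul_left_cancel₀ hc
        linear_combination -hs00 / 2 + ht00 / 2
    · ext j
      fin_cases j
      · simp [attach, chainData, standardData, cols]
        linear_combination -hs00 / 2 + ht00 / 2
      · simp [attach, chainData, standardData, cols]
        field_simp
        linear_combination -hs00 / 2 - ht00 / 2
    · ext j
      fin_cases j
      · simp [attach, chainData, standardData, cols]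
        field_simp
        apply mul_left_cancel₀ (mul_ne_zero two_ne_zero hB)
        linear_combination s l * ep0 + 2 * u * c * hst - s l * c * (A + B) * huv
      · simp [attach, chainData, standardData, cols]
        field_simp
        apply mul_left_cancel₀ (mul_ne_zero two_ne_zero hB)
        linear_combination s l * ep1 - 2 * u * hst + s l * (A - B) * huv
    · ext j
      fin_cases j
      · simp [attach, chainData, standardData, cols]
        field_simp
        apply mul_left_cancel₀ (mul_ne_zero two_ne_zero hB')
        linear_combination s l * ep0' + 2 * u * c * hst' - s l * c * (A' + B') * huv
      · simp [attach, chainData, standardData, cols]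
        field_simp
        apply mul_left_cancel₀ (mul_ne_zero two_ne_zero hB')
        linear_combination s l * ep1' - 2 * u * hst' + s l * (A' - B') * huv
  · intro i
    fin_cases i
    · ext j
      fin_cases j
      · simp [attach, chainData, standardData, cols, Matrix.vecMul, dotProduct]
        linear_combination v * hs00 - c * s 0 * huv
      · simp [attach, chainData, standardData, cols, Matrix.vecMul, dotProduct]
        linear_combination u * ht00 - c * t 0 * huv
    · ext j
      fin_cases j
      · simp [attach, chainData, standardData, cols, Matrix.vecMul, dotProduct]
        field_simp
        linear_combination v * hs00 - c * s 0 * huv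
      · simp [attach, chainData, standardData, cols, Matrix.vecMul, dotProduct]
        field_simp
        linear_combination u * ht00 - c * t 0 * huv
    · ext j
      fin_cases j
      · simp [attach, chainData, standardData, cols, Matrix.vecMul, dotProduct]
        field_simp
        linear_combination -s l * hAdef
      · simp [attach, chainData, standardData, cols, Matrix.vecMul, dotProduct]
        field_simp
        linear_combination -hst + u * t l * hBdef
    · ext j
      fin_cases j
      · simp [attach, chainData, standardData, cols, Matrix.vecMul, dotProduct]
        field_simp
        linear_combination -s l * hAdef'
      · simp [attach, chainData, standardData, cols, Matrix.vecMul, dotProduct]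
        field_simp
        linear_combination hst' + u * t l * hBdef'
  · intro k _
    ext i j
    fin_cases i <;> fin_cases j <;> simp [chainData, standardData, cols, Matrix.mul_apply]
    · rw [hs]; ring
    · rw [ht]; ring
    · rw [hs]; ring
    · rw [ht]; ring
  · intro k _
    ext i j
    fin_cases i <;> fin_cases j <;> simp [chainData, standardData, cols, Matrix.mul_apply]
    · rw [hs k]; linear_combination -c * s (k + 1) * huv
    · rw [ht k]; linear_combination -c * t (k + 1) * huv
    · rw [hs k]; linear_combination -s (k + 1) * huv
    · rw [ht k]; linear_combination -t (k + 1) * huv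

lemma IsChainEnd.mem_closure {n : ℕ} {φ : CGDatum n} (hstd : HasStandardEntries φ)
    (hreg : IsRegular φ) {d : ℂ} (hd : d ≠ 0) {p q p' q' : Fin 2 → ℂ}
    (h : IsChainEnd d p q p' q') :
    (chainData d p q p' q').toRep n ∈ closure (genericReps φ) := by
  obtain ⟨c, rfl⟩ : ∃ c, c ^ 2 = d := IsAlgClosed.exists_pow_nat_eq d two_pos
  obtain ⟨y, G, γ, hG⟩ := h.exists_isBaseChange (fun h0 => hd (by rw [h0]; ring)) (n - 4)
  exact hG.mem_closure (hstd.standardData_mem hreg y)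

/-- Nonzero `d` makes `P_0` and `P_1` independent, because `Q_0` kills `P_0` but not `P_1`, and `P_0
≠ 0`. Independence passes to position `k + 1`, since `b k` maps the transported pair there to an
invertible combination of the pair at `k`. -/
lemma QuiverData.IsPreproj.mem_closure_of_ne_zero {n : ℕ} {φ : CGDatum n}
    (hstd : HasStandardEntries φ) (hreg : IsRegular φ) {D : QuiverData} (h : D.IsPreproj (n - 4))
    (h0 : D.Q 0 ⬝ᵥ D.P 1 ≠ 0) (h1 : D.Q 1 ⬝ᵥ D.P 0 ≠ 0) :
    D.toRep n ∈ closure (genericReps φ) := by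
  have hdet : ∀ k ≤ n - 4, (cols (D.trans (D.P 0) k) (D.trans (D.P 1) k)).det ≠ 0 := by
    intro k hk
    induction k with
    | zero =>
      intro hz
      rw [det_cols] at hz
      have d0 := h.dot 0
      have d1 := h.dot 1
      simp only [dotProduct, Fin.sum_univ_two, trans] at *
      apply mul_ne_zero h0 h1
      linear_combination (D.Q 0 0 * D.Q 1 1 - D.Q 0 1 * D.Q 1 0) * (-hz) +
        (D.Q 1 0 * D.P 1 0 + D.Q 1 1 * D.P 1 1) * d0
    | succ k ih =>
      have e : D.b k * cols (D.trans (D.P 0) (k + 1)) (D.trans (D.P 1) (k + 1)) =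
          cols (D.trans (D.P 0) k) (D.trans (D.P 1) k) *
            !![0, D.Q 0 ⬝ᵥ D.P 1; D.Q 1 ⬝ᵥ D.P 0, 0] := by
        rw [mul_cols, h.b_trans (by omega), h.b_trans (by omega), (h.X_trans (by omega)).1,
          (h.X_trans (by omega)).2, cols_mul]
        simp
      intro hz
      have := congrArg Matrix.det e
      rw [Matrix.det_mul, Matrix.det_mul, hz, mul_zero, Matrix.det_fin_two_of] at this
      apply mul_ne_zero (ih (by omega)) (mul_ne_zero h0 h1)
      linear_combination this
  obtain ⟨p, q, p', q', G, γ, hend, hG, -⟩ := h.exists_chainData h1 hdet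
  exact hG.mem_closure (hend.mem_closure hstd hreg (mul_ne_zero h0 h1))

/-! ### Deforming representations with vanishing discriminant -/

lemma continuousAt_vec {f g : ℂ → ℂ} (hf : ContinuousAt f 0) (hg : ContinuousAt g 0) :
    ContinuousAt (fun t => ![f t, g t]) 0 := by
  refine continuousAt_pi.2 fun i => ?_
  fin_cases i
  · exact hf
  · exact hg

lemma continuousAt_mat {f g h k : ℂ → ℂ} (hf : ContinuousAt f 0) (hg : ContinuousAt g 0)
    (hh : ContinuousAt h 0) (hk : ContinuousAt k 0) :
    ContinuousAt (fun t => !![f t, g t; h t, k t]) 0 := by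
  refine continuousAt_pi.2 fun i => continuousAt_pi.2 fun j => ?_
  fin_cases i <;> fin_cases j
  · exact hf
  · exact hg
  · exact hh
  · exact hk

lemma continuousAt_vec_four {f g h k : ℂ → Fin 2 → ℂ} (hf : ContinuousAt f 0)
    (hg : ContinuousAt g 0) (hh : ContinuousAt h 0) (hk : ContinuousAt k 0) :
    ContinuousAt (fun t => ![f t, g t, h t, k t]) 0 := by
  refine continuousAt_pi.2 fun i => ?_
  fin_cases i
  · exact hf
  · exact hg
  · exact hh
  · exact hk

lemma eventually_ne_of_continuousAt {f : ℂ → ℂ} (hf : ContinuousAt f 0) (h0 : f 0 ≠ 0) :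
    ∀ᶠ t in 𝓝[≠] 0, f t ≠ 0 :=
  nhdsWithin_le_nhds (hf.eventually_ne h0)

/-- Adding `t` makes a parameter nonzero near `0`, whether or not it was zero to begin with. -/
lemma eventually_add_ne (c : ℂ) : ∀ᶠ t in 𝓝[≠] (0 : ℂ), c + t ≠ 0 := by
  by_cases hc : c = 0
  · subst hc
    simpa using eventually_mem_nhdsWithin (a := (0 : ℂ)) (s := {0}ᶜ)
  · exact eventually_ne_of_continuousAt (f := fun t => c + t) (by fun_prop) (by simpa)

/-- A deformation of the end of a chain to nonzero discriminant. -/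
structure IsChainEndDeformation (d : ℂ → ℂ) (p q p' q' : ℂ → Fin 2 → ℂ) : Prop where
  cont_d : ContinuousAt d 0
  cont_p : ContinuousAt p 0
  cont_q : ContinuousAt q 0
  cont_p' : ContinuousAt p' 0
  cont_q' : ContinuousAt q' 0
  isChainEnd : ∀ᶠ t in 𝓝[≠] 0, IsChainEnd (d t) (p t) (q t) (p' t) (q' t)
  ne : ∀ᶠ t in 𝓝[≠] 0, d t ≠ 0

lemma IsChainEnd.swap {d : ℂ} {p q p' q' : Fin 2 → ℂ} (h : IsChainEnd d p q p' q') :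
    IsChainEnd d p' q' p q := ⟨h.dot', h.dot, by rw [add_comm, h.sum]⟩

lemma IsChainEndDeformation.swap {d : ℂ → ℂ} {p q p' q' : ℂ → Fin 2 → ℂ}
    (h : IsChainEndDeformation d p q p' q') : IsChainEndDeformation d p' q' p q :=
  ⟨h.cont_d, h.cont_p', h.cont_q', h.cont_p, h.cont_q, h.isChainEnd.mono fun _ h => h.swap, h.ne⟩

/-- With `J = !![0, 1; -1, 0]` and `p = c J q`, one has `p qᵀ = J (c q qᵀ)`. The end relation thus
says that the symmetric form `c q qᵀ + c' q' q'ᵀ` is `diag(-1, d)`; the hypotheses are its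
off-diagonal and first entries, and the last entry defines `d`. -/
lemma isChainEnd_smul {c α β c' α' β' : ℂ} (h1 : c * α * β + c' * α' * β' = 0)
    (h2 : c * α ^ 2 + c' * α' ^ 2 = -1) :
    IsChainEnd (c * β ^ 2 + c' * β' ^ 2) ![c * β, -(c * α)] ![α, β] ![c' * β', -(c' * α')]
      ![α', β'] := by
  refine ⟨?_, ?_, ?_⟩
  · simp [dotProduct]; ring
  · simp [dotProduct]; ring
  · ext i j
    fin_cases i <;> fin_cases j <;> simp
    · linear_combination h1
    · ring
    · linear_combination -h2
    · linear_combination -h1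

lemma IsChainEnd.exists_smul {d : ℂ} {p q p' q' : Fin 2 → ℂ} (h : IsChainEnd d p q p' q')
    (hq : q ≠ 0) : ∃ c, p = ![c * q 1, -(c * q 0)] := by
  have hd := h.dot
  simp only [dotProduct, Fin.sum_univ_two] at hd
  by_cases h0 : q 0 = 0
  · have h1 : q 1 ≠ 0 := fun h1 => hq (by ext i; fin_cases i <;> assumption)
    refine ⟨p 0 / q 1, ?_⟩
    have hp : p 1 = 0 := by simpa [h0, h1] using hd
    ext i
    fin_cases i <;> simp [h0, h1, hp]
  · refine ⟨-p 1 / q 0, ?_⟩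
    ext i
    fin_cases i
    · simp
      field_simp
      linear_combination hd
    · simp [h0]

/-- The absent second form is switched on with coefficient `t`. The coefficient `C` restores the
entry `-1`, `B` restores the vanishing off-diagonal entry, and `β'` is moved to `β' + t` because `C
α² d = -t (β' + t)²` has to be nonzero. -/
lemma exists_deformation_of_zero {c α α' β' : ℂ} (hc : c * α ^ 2 = -1) :
    ∃ d p q p' q', IsChainEndDeformation d p q p' q' ∧ d 0 = 0 ∧ p 0 = ![0, -(c * α)] ∧
      q 0 = ![α, 0] ∧ p' 0 = 0 ∧ q' 0 = ![α', β'] := by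
  have hα : α ≠ 0 := by
    rintro rfl
    simp at hc
  have hc0 : c ≠ 0 := by
    rintro rfl
    simp at hc
  let C : ℂ → ℂ := fun t => c * (1 + t * α' ^ 2)
  let B : ℂ → ℂ := fun t => -(t * α' * (β' + t)) / (C t * α)
  have hC0 : C 0 = c := by simp [C]
  have hB0 : B 0 = 0 := by simp [B]
  have hC : ContinuousAt C 0 := by fun_prop
  have hB : ContinuousAt B 0 := by
    refine ContinuousAt.div (by fun_prop) (hC.mul continuousAt_const) ?_
    simp [hC0, hc0, hα]
  have hCne := eventually_ne_of_continuousAt hC (by rwa [hC0])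
  refine ⟨fun t => C t * B t ^ 2 + t * (β' + t) ^ 2, fun t => ![C t * B t, -(C t * α)],
    fun t => ![α, B t], fun t => ![t * (β' + t), -(t * α')], fun t => ![α', β' + t],
    ⟨by fun_prop, continuousAt_vec (by fun_prop) (by fun_prop),
      continuousAt_vec (by fun_prop) (by fun_prop), continuousAt_vec (by fun_prop) (by fun_prop),
      continuousAt_vec (by fun_prop) (by fun_prop), ?_, ?_⟩, ?_, ?_, ?_, ?_, ?_⟩
  · filter_upwards [hCne] with t ht
    apply isChainEnd_smul
    · simp only [B]
      field_simp
      ring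
    · simp only [C]
      linear_combination (1 + t * α' ^ 2) * hc
  · filter_upwards [hCne, eventually_add_ne β', eventually_mem_nhdsWithin] with t ht hβ ht0
    have e : C t * α ^ 2 = -(1 + t * α' ^ 2) := by
      simp only [C]
      linear_combination (1 + t * α' ^ 2) * hc
    have e2 : C t * α ^ 2 * (C t * B t ^ 2 + t * (β' + t) ^ 2) = -(t * (β' + t) ^ 2) := by
      have : C t * α * B t = -(t * α' * (β' + t)) := by
        simp only [B]
        field_simp
      linear_combination (C t * α * B t - (t * α' * (β' + t))) * this +
        t * (β' + t) ^ 2 * e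
    intro h0
    rw [h0, mul_zero] at e2
    have := mul_ne_zero (show t ≠ 0 from ht0) (pow_ne_zero 2 hβ)
    exact this (by linear_combination e2)
  · simp [hB0]
  · simp [hB0, hC0]
  · simp [hB0]
  · ext i
    fin_cases i <;> simp
  · simp

/-- Nonzero `q`, `q'` allow `p` and `p'` to be written through forms with coefficients `c`, `c'`,
and the determinant identity reads `c c' (q_0 q'_1 - q_1 q'_0)² = -d = 0`. If one coefficient
vanishes, it is switched on by `exists_deformation_of_zero`. If neither does, `q` and `q'` lie on
the first axis and are turned apart. -/
lemma IsChainEnd.exists_deformation {p q p' q' : Fin 2 → ℂ} (h : IsChainEnd 0 p q p' q')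
    (hq : q ≠ 0) (hq' : q' ≠ 0) :
    ∃ d p₁ q₁ p₁' q₁', IsChainEndDeformation d p₁ q₁ p₁' q₁' ∧ d 0 = 0 ∧ p₁ 0 = p ∧ q₁ 0 = q ∧
      p₁' 0 = p' ∧ q₁' 0 = q' := by
  obtain ⟨c, hp⟩ := h.exists_smul hq
  obtain ⟨c', hp'⟩ := h.swap.exists_smul hq'
  have h00 := congrFun (congrFun h.sum 0) 0
  have h01 := congrFun (congrFun h.sum 0) 1
  have h10 := congrFun (congrFun h.sum 1) 0
  have hp0 : p 0 = c * q 1 := by rw [hp]; rfl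
  have hp1 : p 1 = -(c * q 0) := by rw [hp]; rfl
  have hp0' : p' 0 = c' * q' 1 := by rw [hp']; rfl
  have hp1' : p' 1 = -(c' * q' 0) := by rw [hp']; rfl
  simp [Matrix.vecMulVec_apply] at h00 h01 h10
  rw [hp0, hp0'] at h00 h01
  rw [hp1, hp1'] at h10
  clear hp0 hp1 hp0' hp1'
  have hqv : ![q 0, q 1] = q := by ext i; fin_cases i <;> rfl
  have hqv' : ![q' 0, q' 1] = q' := by ext i; fin_cases i <;> rfl
  by_cases hc : c = 0
  · subst hc
    have h1 : c' * q' 0 ^ 2 = -1 := by linear_combination -h10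
    have hc' : c' ≠ 0 := by
      rintro rfl
      simp at h1
    have hq1 : q' 1 = 0 := by
      have : c' * q' 1 ^ 2 = 0 := by linear_combination h01
      simpa [hc'] using this
    obtain ⟨d, p₁, q₁, p₁', q₁', hdef, hd0, h1, h2, h3, h4⟩ :=
      exists_deformation_of_zero (α' := q 0) (β' := q 1) h1
    refine ⟨d, p₁', q₁', p₁, q₁, hdef.swap, hd0, ?_, ?_, ?_, ?_⟩
    · rw [h3, hp]
      ext i
      fin_cases i <;> simp
    · rw [h4, hqv]
    · rw [h1, hp', hq1, mul_zero]
    · rw [h2, ← hqv', hq1]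
      rfl
  by_cases hc' : c' = 0
  · subst hc'
    have h1 : c * q 0 ^ 2 = -1 := by linear_combination -h10
    have hq1 : q 1 = 0 := by
      have : c * q 1 ^ 2 = 0 := by linear_combination h01
      simpa [hc] using this
    obtain ⟨d, p₁, q₁, p₁', q₁', hdef, hd0, h1, h2, h3, h4⟩ :=
      exists_deformation_of_zero (α' := q' 0) (β' := q' 1) h1
    refine ⟨d, p₁, q₁, p₁', q₁', hdef, hd0, ?_, ?_, ?_, ?_⟩
    · rw [h1, hp, hq1, mul_zero]
    · rw [h2, ← hqv, hq1]
      rfl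
    · rw [h3, hp']
      ext i
      fin_cases i <;> simp
    · rw [h4, hqv']
  have hD : q 1 * q' 0 - q' 1 * q 0 = 0 := by
    have : c * c' * (q 1 * q' 0 - q' 1 * q 0) ^ 2 = 0 := by
      linear_combination (c * q 0 ^ 2 + c' * q' 0 ^ 2) * h01 -
        (c * q 1 * q 0 + c' * q' 1 * q' 0) * h00
    simpa [hc, hc'] using this
  have hq1 : q 1 = 0 := by
    linear_combination -(q 1) * h10 - q 0 * h00 - c' * q' 0 * hD
  have hq1' : q' 1 = 0 := by
    linear_combination -(q' 1) * h10 - q' 0 * h00 + c * q 0 * hD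
  have h2 : c * q 0 ^ 2 + c' * q' 0 ^ 2 = -1 := by linear_combination -h10
  -- The second coordinates `-t c' q'_0` and `t c q_0` are chosen to keep the off-diagonal entry
  -- zero; then `d = -t² c c'`.
  refine ⟨fun t => c * (-(t * (c' * q' 0))) ^ 2 + c' * (t * (c * q 0)) ^ 2,
    fun t => ![c * (-(t * (c' * q' 0))), -(c * q 0)],
    fun t => ![q 0, -(t * (c' * q' 0))], fun t => ![c' * (t * (c * q 0)), -(c' * q' 0)],
    fun t => ![q' 0, t * (c * q 0)],
    ⟨by fun_prop, continuousAt_vec (by fun_prop) (by fun_prop),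
      continuousAt_vec (by fun_prop) (by fun_prop), continuousAt_vec (by fun_prop) (by fun_prop),
      continuousAt_vec (by fun_prop) (by fun_prop), ?_, ?_⟩, ?_, ?_, ?_, ?_, ?_⟩
  · exact Eventually.of_forall fun t => isChainEnd_smul (by ring) h2
  · filter_upwards [eventually_mem_nhdsWithin] with t ht
    have := mul_ne_zero (pow_ne_zero 2 (show t ≠ 0 from ht)) (mul_ne_zero hc hc')
    intro h0
    apply this
    linear_combination -h0 + t ^ 2 * c * c' * h2
  · simp
  · simp [hp, hq1]
  · ext i
    fin_cases i <;> simp [hq1]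
  · simp [hp', hq1']
  · ext i
    fin_cases i <;> simp [hq1']

lemma IsChainEnd.mem_closure_of_zero {n : ℕ} {φ : CGDatum n} (hstd : HasStandardEntries φ)
    (hreg : IsRegular φ) {p q p' q' : Fin 2 → ℂ} (h : IsChainEnd 0 p q p' q') (hq : q ≠ 0)
    (hq' : q' ≠ 0) : (chainData 0 p q p' q').toRep n ∈ closure (genericReps φ) := by
  obtain ⟨d, p₁, q₁, p₁', q₁', hdef, hd0, h1, h2, h3, h4⟩ := h.exists_deformation hq hq'
  have hF : QuiverData.IsContinuousAt
      (fun t => chainData (d t) (p₁ t) (q₁ t) (p₁' t) (q₁' t)) := by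
    refine ⟨continuousAt_vec_four continuousAt_const continuousAt_const hdef.cont_p hdef.cont_p',
      continuousAt_vec_four (continuousAt_vec continuousAt_const hdef.cont_d) continuousAt_const
        hdef.cont_q hdef.cont_q', fun k => continuousAt_const, fun k => continuousAt_mat continuousAt_const
        hdef.cont_d continuousAt_const continuousAt_const⟩
  have := hF.mem_closure (n := n) (φ := φ) (by
    filter_upwards [hdef.isChainEnd, hdef.ne] with t ht hd
    exact ht.mem_closure hstd hreg hd)
  simpa [hd0, h1, h2, h3, h4] using this

/-- Coordinates of a representation whose end is adapted to `X = !![v, 0; u, -v]`. -/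
def tailData (P₁ Q₀ Q₁ : Fin 2 → ℂ) (a b : ℕ → Matrix (Fin 2) (Fin 2) ℂ) (v u : ℂ) :
    QuiverData where
  P := ![![1, 0], P₁,
    ![(1 + u / 4) ^ 2 * (v / (2 * (1 + u / 4))), (1 + u / 4) ^ 2],
    ![(1 - u / 4) ^ 2 * (v / (2 * (1 - u / 4))), -(1 - u / 4) ^ 2]]
  Q := ![Q₀, Q₁, ![1, -(v / (2 * (1 + u / 4)))], ![1, v / (2 * (1 - u / 4))]]
  a := a
  b := b

/-- The coefficients at `E_3` and `E_4` work because `(1 + u/4)² - (1 - u/4)² = u`, `(1 + u/4) + (1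
- u/4) = 2`, and the two upper right entries cancel. This reduces the relation at the end to knowing
`X l`. -/
lemma tailData_isPreproj {P₁ Q₀ Q₁ : Fin 2 → ℂ} {a b : ℕ → Matrix (Fin 2) (Fin 2) ℂ} {v u : ℂ}
    (hu : 1 + u / 4 ≠ 0) (hu' : 1 - u / 4 ≠ 0) {l : ℕ} (h0 : Q₀ 0 = 0) (h1 : Q₁ ⬝ᵥ P₁ = 0)
    (X : ℕ → Matrix (Fin 2) (Fin 2) ℂ)
    (hX : ∀ k, (tailData P₁ Q₀ Q₁ a b v u).X k = X k)
    (hstep : ∀ k < l, b k * a k = X k) (hlast : X l = !![v, 0; u, -v]) :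
    (tailData P₁ Q₀ Q₁ a b v u).IsPreproj l where
  dot i := by
    fin_cases i
    · simpa [tailData, dotProduct] using h0
    · exact h1
    · simp [tailData, dotProduct]
      ring
    · simp [tailData, dotProduct]
      ring
  step k hk := by
    rw [hX]
    exact hstep k hk
  last := by
    rw [hX, hlast]
    have h4 : 4 + u ≠ 0 := fun h => hu (by linear_combination h / 4)
    have h4' : 4 - u ≠ 0 := fun h => hu' (by linear_combination h / 4)
    ext i j
    fin_cases i <;> fin_cases j <;> simp [tailData] <;> field_simp <;> ring

lemma tailData_isContinuousAt {P₁ Q₀ Q₁ : ℂ → Fin 2 → ℂ} {a b : ℂ → ℕ → Matrix (Fin 2) (Fin 2) ℂ}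
    {v u : ℂ → ℂ} (hP : ContinuousAt P₁ 0) (hQ : ContinuousAt Q₀ 0) (hQ' : ContinuousAt Q₁ 0)
    (ha : ∀ k, ContinuousAt (fun t => a t k) 0) (hb : ∀ k, ContinuousAt (fun t => b t k) 0)
    (hv : ContinuousAt v 0) (hu : ContinuousAt u 0) (hu0 : u 0 = 0) :
    QuiverData.IsContinuousAt (fun t => tailData (P₁ t) (Q₀ t) (Q₁ t) (a t) (b t) (v t) (u t)) := by
  have h1 : ContinuousAt (fun t => v t / (2 * (1 + u t / 4))) 0 :=
    hv.div (by fun_prop) (by simp [hu0])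
  have h2 : ContinuousAt (fun t => v t / (2 * (1 - u t / 4))) 0 :=
    hv.div (by fun_prop) (by simp [hu0])
  exact ⟨continuousAt_vec_four continuousAt_const hP (continuousAt_vec (by fun_prop) (by fun_prop))
    (continuousAt_vec (by fun_prop) (by fun_prop)), continuousAt_vec_four hQ hQ'
    (continuousAt_vec (by fun_prop) (by fun_prop)) (continuousAt_vec (by fun_prop) (by fun_prop)),
    ha, hb⟩

lemma eventually_tail_ne {u : ℂ → ℂ} (hu : ContinuousAt u 0) (hu0 : u 0 = 0) :
    ∀ᶠ t in 𝓝[≠] 0, 1 + u t / 4 ≠ 0 ∧ 1 - u t / 4 ≠ 0 :=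
  (eventually_ne_of_continuousAt (f := fun t => 1 + u t / 4) (by fun_prop) (by simp [hu0])).and
    (eventually_ne_of_continuousAt (f := fun t => 1 - u t / 4) (by fun_prop) (by simp [hu0]))

/-- Deformations of the representations in which `X` vanishes on all two-dimensional spaces. -/
def flatData (l : ℕ) (p m w : ℂ) : QuiverData :=
  tailData ![p * w, -(p * m)] ![0, -(p * w ^ 2)] ![m, w]
    (fun _ => !![1, 0; 0, -(p * m * w)])
    (fun k => !![p * m * w, 0; -(p * m ^ 2) * (-(p * m * w)) ^ k, 1])
    (p * m * w) (-(p * m ^ 2) * (-(p * m * w)) ^ l)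

lemma flatData_isPreproj {l : ℕ} {p m w : ℂ}
    (hu : 1 + -(p * m ^ 2) * (-(p * m * w)) ^ l / 4 ≠ 0)
    (hu' : 1 - -(p * m ^ 2) * (-(p * m * w)) ^ l / 4 ≠ 0) :
    (flatData l p m w).IsPreproj l := by
  refine tailData_isPreproj hu hu' rfl (by simp [dotProduct]; ring)
    -- Each step along the chain preserves the diagonal of `X` and multiplies its lower left entry
    -- by `-pmw`.
    (fun k => !![p * m * w, 0; -(p * m ^ 2) * (-(p * m * w)) ^ k, -(p * m * w)]) ?_ ?_ rfl
  · rintro (_ | k)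
    · ext i j
      fin_cases i <;> fin_cases j <;>
        simp [QuiverData.X, tailData] <;> ring
    · ext i j
      fin_cases i <;> fin_cases j <;> simp [QuiverData.X, tailData, Matrix.mul_apply]
      ring
  · intro k _
    ext i j
    fin_cases i <;> fin_cases j <;> simp [Matrix.mul_apply]

/-- All three parameters are shifted by `t`, since `Q_0·P_1 = p² m w²` and `Q_1·P_0 = m` must both
become nonzero. The condition `p * m = 0` ensures that the limit has `u = v = 0`. -/
lemma flatData_mem_closure {n : ℕ} {φ : CGDatum n} (hstd : HasStandardEntries φ)
    (hreg : IsRegular φ) {p m w : ℂ} (h : p * m = 0) :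
    (flatData (n - 4) p m w).toRep n ∈ closure (genericReps φ) := by
  have hu : ContinuousAt (fun t : ℂ => -((p + t) * (m + t) ^ 2) *
      (-((p + t) * (m + t) * (w + t))) ^ (n - 4)) 0 := by fun_prop
  have hu0 : (fun t : ℂ => -((p + t) * (m + t) ^ 2) *
      (-((p + t) * (m + t) * (w + t))) ^ (n - 4)) 0 = 0 := by
    simp only [add_zero, sq, ← mul_assoc, h]
    simp
  have hF : QuiverData.IsContinuousAt (fun t => flatData (n - 4) (p + t) (m + t) (w + t)) := by
    refine tailData_isContinuousAt (continuousAt_vec (by fun_prop) (by fun_prop))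
      (continuousAt_vec (by fun_prop) (by fun_prop)) (continuousAt_vec (by fun_prop) (by fun_prop))
      (fun k => continuousAt_mat (by fun_prop) (by fun_prop) (by fun_prop) (by fun_prop))
      (fun k => continuousAt_mat (by fun_prop) (by fun_prop) (by fun_prop) (by fun_prop))
      (by fun_prop) hu hu0
  have := hF.mem_closure (n := n) (φ := φ) (by
    filter_upwards [eventually_tail_ne hu hu0, eventually_add_ne p, eventually_add_ne m,
      eventually_add_ne w] with t ht hp hm hw
    refine (flatData_isPreproj ht.1 ht.2).mem_closure_of_ne_zero hstd hreg ?_ ?_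
    · simp [flatData, tailData, hp, hm, hw]
    · simp [flatData, tailData, hm])
  simpa using this

/-- Deformations of the representations in which `X` vanishes precisely from the `j`-th
two-dimensional space on. -/
def bentData (l j : ℕ) (w t : ℂ) : QuiverData :=
  tailData ![0, 1] ![0, (w * t) ^ 2] ![1, 0]
    (fun k => if k + 1 < j then 1 else if k + 1 = j then !![1, w * t; 0, -t] else
      !![1, 0; 0, -(w * t)])
    (fun k => if k + 1 < j then !![0, (w * t) ^ 2; 1, 0] else if k + 1 = j then
      !![0, -(w * (w * t)); 1, w] else !![w * t, 0; -t * (-(w * t)) ^ (k - j), 1])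
    (w * t) (-t * (-(w * t)) ^ (l - j))

lemma bentData_isPreproj {l j : ℕ} (hj0 : 0 < j) (hj : j ≤ l) {w t : ℂ}
    (hu : 1 + -t * (-(w * t)) ^ (l - j) / 4 ≠ 0) (hu' : 1 - -t * (-(w * t)) ^ (l - j) / 4 ≠ 0) :
    (bentData l j w t).IsPreproj l := by
  refine tailData_isPreproj hu hu' rfl (by simp [dotProduct])
    (fun k => if k < j then !![0, (w * t) ^ 2; 1, 0] else
      !![w * t, 0; -t * (-(w * t)) ^ (k - j), -(w * t)]) ?_ ?_ (by rw [if_neg (by omega)])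
  · rintro (_ | k)
    · rw [if_pos hj0]
      ext i j
      fin_cases i <;> fin_cases j <;> simp [QuiverData.X, tailData]
    · simp only [QuiverData.X, tailData]
      rcases lt_trichotomy (k + 1) j with hk | hk | hk
      · rw [if_pos hk, if_pos hk, if_pos hk, Matrix.one_mul]
      · subst hk
        simp only [lt_irrefl, if_false, if_true, Nat.sub_self, pow_zero]
        ext i j
        fin_cases i <;> fin_cases j <;> simp [Matrix.mul_apply] <;> ring
      · rw [if_neg (by omega), if_neg (by omega), if_neg (by omega), if_neg (by omega),
          if_neg (by omega), show k + 1 - j = (k - j) + 1 by omega]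
        ext i j
        fin_cases i <;> fin_cases j <;> simp [Matrix.mul_apply]
        ring
  · intro k _
    rcases lt_trichotomy (k + 1) j with hk | hk | hk
    · rw [if_pos hk, if_pos hk, if_pos (by omega), Matrix.mul_one]
    · subst hk
      simp only [lt_irrefl, if_false, if_true, Nat.lt_succ_self]
      ext i j
      fin_cases i <;> fin_cases j <;> simp [Matrix.mul_apply] 
      ring
    · rw [if_neg (by omega), if_neg (by omega), if_neg (by omega), if_neg (by omega),
        if_neg (by omega)]
      ext i j
      fin_cases i <;> fin_cases j <;> simp [Matrix.mul_apply]

/-- The family has `d = (w t)²`; since `w` may be zero, it is shifted along with `t`. -/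
lemma bentData_mem_closure {n : ℕ} {φ : CGDatum n} (hstd : HasStandardEntries φ)
    (hreg : IsRegular φ) {j : ℕ} (hj0 : 0 < j) (hj : j ≤ n - 4) (w : ℂ) :
    (bentData (n - 4) j w 0).toRep n ∈ closure (genericReps φ) := by
  have hu : ContinuousAt (fun t : ℂ => -t * (-((w + t) * t)) ^ (n - 4 - j)) 0 := by fun_prop
  have hu0 : (fun t : ℂ => -t * (-((w + t) * t)) ^ (n - 4 - j)) 0 = 0 := by simp
  have hF : QuiverData.IsContinuousAt (fun t => bentData (n - 4) j (w + t) t) := by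
    refine tailData_isContinuousAt continuousAt_const
      (continuousAt_vec (by fun_prop) (by fun_prop)) continuousAt_const
      (fun k => ?_) (fun k => ?_) (by fun_prop) hu hu0
    · split_ifs
      · exact continuousAt_const
      · exact continuousAt_mat (by fun_prop) (by fun_prop) (by fun_prop) (by fun_prop)
      · exact continuousAt_mat (by fun_prop) (by fun_prop) (by fun_prop) (by fun_prop)
    · split_ifs
      · exact continuousAt_mat (by fun_prop) (by fun_prop) (by fun_prop) (by fun_prop)
      · exact continuousAt_mat (by fun_prop) (by fun_prop) (by fun_prop) (by fun_prop)
      · exact continuousAt_mat (by fun_prop) (by fun_prop) (by fun_prop) (by fun_prop)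
  have := hF.mem_closure (n := n) (φ := φ) (by
    filter_upwards [eventually_tail_ne hu hu0, eventually_add_ne w, eventually_mem_nhdsWithin]
      with t ht hw ht0
    have ht0' : t ≠ 0 := ht0
    refine (bentData_isPreproj hj0 hj ht.1 ht.2).mem_closure_of_ne_zero hstd hreg ?_ ?_
    · simp [bentData, tailData, hw, ht0']
    · simp [bentData, tailData])
  simpa using this

/-! ### Representations generated at the trivial vertex -/

/-- The representation is generated by its vector at `E_1`. -/
def QuiverData.IsGenerated (l : ℕ) (D : QuiverData) : Prop :=
  ∀ (W : ℕ → Submodule ℂ (Fin 2 → ℂ)) (e : Fin 4 → Prop), e 0 →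
    (∀ i, e i → D.P i ∈ W (attach l i)) → (∀ i, ∀ u ∈ W (attach l i), D.Q i ⬝ᵥ u ≠ 0 → e i) →
    (∀ k < l, ∀ u ∈ W k, (D.a k).mulVec u ∈ W (k + 1)) →
    (∀ k < l, ∀ u ∈ W (k + 1), (D.b k).mulVec u ∈ W k) → (∀ i, e i) ∧ ∀ k ≤ l, W k = ⊤

/-- If `Q_i = 0`, omitting the vertex `E_{i+1}` and keeping everything else leaves a stable family
that contains `E_1`. -/
lemma QuiverData.IsGenerated.Q_ne_zero {l : ℕ} {D : QuiverData} (h : D.IsGenerated l) {i : Fin 4}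
    (hi : i ≠ 0) : D.Q i ≠ 0 := by
  intro h0
  refine (h (fun _ => ⊤) (fun j => j ≠ i) hi.symm (fun _ _ => Submodule.mem_top) ?_
    (fun _ _ _ _ => Submodule.mem_top) (fun _ _ _ _ => Submodule.mem_top)).1 i rfl
  rintro j u - hu rfl
  exact hu (by rw [h0, zero_dotProduct])

lemma mulVec_mem_span_triple {M : Matrix (Fin 2) (Fin 2) ℂ} {u v w : Fin 2 → ℂ}
    {S : Submodule ℂ (Fin 2 → ℂ)} (hu : M.mulVec u ∈ S) (hv : M.mulVec v ∈ S)
    (hw : M.mulVec w ∈ S) {s : Fin 2 → ℂ} (hs : s ∈ Submodule.span ℂ {u, v, w}) :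
    M.mulVec s ∈ S := by
  obtain ⟨a, b, c, rfl⟩ := Submodule.mem_span_triple.1 hs
  rw [Matrix.mulVec_add, Matrix.mulVec_add, Matrix.mulVec_smul, Matrix.mulVec_smul,
    Matrix.mulVec_smul]
  exact S.add_mem (S.add_mem (S.smul_mem _ hu) (S.smul_mem _ hv)) (S.smul_mem _ hw)

lemma dotProduct_eq_zero_of_mem_span_triple {q u v w : Fin 2 → ℂ} (hu : q ⬝ᵥ u = 0)
    (hv : q ⬝ᵥ v = 0) (hw : q ⬝ᵥ w = 0) {s : Fin 2 → ℂ} (hs : s ∈ Submodule.span ℂ {u, v, w}) :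
    q ⬝ᵥ s = 0 := by
  obtain ⟨a, b, c, rfl⟩ := Submodule.mem_span_triple.1 hs
  simp only [dotProduct_add, dotProduct_smul, hu, hv, hw, smul_zero, add_zero]

lemma det_cols_ne_zero_of_span {u v : Fin 2 → ℂ} (h : Submodule.span ℂ {u, v, 0} = ⊤) :
    (cols u v).det ≠ 0 := by
  have h0 : (![1, 0] : Fin 2 → ℂ) ∈ Submodule.span ℂ {u, v, 0} := h ▸ Submodule.mem_top
  have h1 : (![0, 1] : Fin 2 → ℂ) ∈ Submodule.span ℂ {u, v, 0} := h ▸ Submodule.mem_top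
  obtain ⟨a, b, _, h0⟩ := Submodule.mem_span_triple.1 h0
  obtain ⟨c, d, _, h1⟩ := Submodule.mem_span_triple.1 h1
  have e : cols u v * !![a, c; b, d] = 1 := by
    rw [cols_mul]
    simp only [smul_zero, add_zero] at h0 h1
    rw [h0, h1]
    ext i j
    fin_cases i <;> fin_cases j <;> rfl
  intro hz
  have := congrArg Matrix.det e
  rw [Matrix.det_mul, hz, zero_mul, Matrix.det_one] at this
  exact zero_ne_one this

lemma exists_eq_smul_add_smul {u v : Fin 2 → ℂ} (h : (cols u v).det ≠ 0) (w : Fin 2 → ℂ) :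
    ∃ a b : ℂ, w = a • u + b • v := by
  obtain ⟨p, hp⟩ := exists_mulVec_eq h w
  refine ⟨p 0, p 1, ?_⟩
  rw [← cols_mulVec, ← hp]
  congr 1
  ext i
  fin_cases i <;> rfl

lemma det_cols_ne_zero_of_nilpotent {M : Matrix (Fin 2) (Fin 2) ℂ} {u v : Fin 2 → ℂ}
    (h1 : M.mulVec u = v) (h2 : M.mulVec v = 0) (hv : v ≠ 0) : (cols u v).det ≠ 0 := by
  intro h0
  obtain ⟨p, hp0, hp⟩ := Matrix.exists_mulVec_eq_zero_iff.2 h0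
  have hpe : p = ![p 0, p 1] := by ext i; fin_cases i <;> rfl
  rw [hpe, cols_mulVec] at hp
  have e := congrArg M.mulVec hp
  rw [Matrix.mulVec_add, Matrix.mulVec_smul, Matrix.mulVec_smul, h1, h2, smul_zero, add_zero,
    Matrix.mulVec_zero, smul_eq_zero, or_iff_left hv] at e
  rw [e, zero_smul, zero_add, smul_eq_zero, or_iff_left hv] at hp
  exact hp0 (by rw [hpe, e, hp]; ext i; fin_cases i <;> rfl)

/-- The image of `y_k` under `X`. -/
def QuiverData.xvec (D : QuiverData) (k : ℕ) : Fin 2 → ℂ :=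
  (D.Q 1 ⬝ᵥ D.P 0) • D.trans (D.P 1) k

/-! ### Generation with vanishing discriminant: the vector coming back from `E_3` and `E_4`. -/

section Degenerate

variable {l : ℕ} {D : QuiverData}

lemma QuiverData.a_xvec (k : ℕ) : (D.a k).mulVec (D.xvec k) = D.xvec (k + 1) := by
  rw [xvec, xvec, Matrix.mulVec_smul]
  rfl

lemma QuiverData.IsPreproj.X_y (h : D.IsPreproj l) {k : ℕ} (hk : k ≤ l) :
    (D.X k).mulVec (D.trans (D.P 0) k) = D.xvec k := (h.X_trans hk).1

lemma QuiverData.IsPreproj.X_xvec (h : D.IsPreproj l)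
    (hd : (D.Q 0 ⬝ᵥ D.P 1) * (D.Q 1 ⬝ᵥ D.P 0) = 0) {k : ℕ} (hk : k ≤ l) :
    (D.X k).mulVec (D.xvec k) = 0 := by
  rw [xvec, Matrix.mulVec_smul, (h.X_trans hk).2, smul_smul, mul_comm, hd, zero_smul]

lemma QuiverData.IsPreproj.b_y (h : D.IsPreproj l) {k : ℕ} (hk : k < l) :
    (D.b k).mulVec (D.trans (D.P 0) (k + 1)) = D.xvec k := by
  rw [h.b_trans hk, h.X_y hk.le]

lemma QuiverData.IsPreproj.b_xvec (h : D.IsPreproj l)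
    (hd : (D.Q 0 ⬝ᵥ D.P 1) * (D.Q 1 ⬝ᵥ D.P 0) = 0) {k : ℕ} (hk : k < l) :
    (D.b k).mulVec (D.xvec (k + 1)) = 0 := by
  rw [← a_xvec, Matrix.mulVec_mulVec, h.step k hk, h.X_xvec hd hk.le]

/-- The subspaces spanned by `y_k`, `X y_k` and `w_k` exhaust a generated representation as soon
as they are stable. -/
lemma QuiverData.IsGenerated.span_eq_top (hgen : D.IsGenerated l) (h : D.IsPreproj l)
    (hd : (D.Q 0 ⬝ᵥ D.P 1) * (D.Q 1 ⬝ᵥ D.P 0) = 0) (w : ℕ → Fin 2 → ℂ)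
    (hb : ∀ k < l, (D.b k).mulVec (w (k + 1)) = w k) (ha : ∀ k < l, (D.a k).mulVec (w k) = 0)
    (h1 : D.Q 1 ⬝ᵥ w 0 ≠ 0 → D.P 1 ∈ Submodule.span ℂ {D.trans (D.P 0) 0, D.xvec 0, w 0})
    (h23 : ∀ i, i = 2 ∨ i = 3 →
      (D.Q i ⬝ᵥ D.trans (D.P 0) l ≠ 0 ∨ D.Q i ⬝ᵥ D.xvec l ≠ 0 ∨ D.Q i ⬝ᵥ w l ≠ 0) →
      D.P i ∈ Submodule.span ℂ {D.trans (D.P 0) l, D.xvec l, w l}) :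
    (D.Q 1 ⬝ᵥ D.P 0 ≠ 0 ∨ D.Q 1 ⬝ᵥ w 0 ≠ 0) ∧
      ∀ k ≤ l, Submodule.span ℂ {D.trans (D.P 0) k, D.xvec k, w k} = ⊤ := by
  set W : ℕ → Submodule ℂ (Fin 2 → ℂ) :=
    fun k => Submodule.span ℂ {D.trans (D.P 0) k, D.xvec k, w k} with hW
  have my : ∀ k, D.trans (D.P 0) k ∈ W k := fun k => Submodule.subset_span (by simp)
  have mx : ∀ k, D.xvec k ∈ W k := fun k => Submodule.subset_span (by simp)
  have mw : ∀ k, w k ∈ W k := fun k => Submodule.subset_span (by simp)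
  -- A one-dimensional vertex is included exactly when some spanning vector reaches it. For `E_2`
  -- the vector `X y_0` is omitted: it is a multiple of `P_1`, which `Q_1` kills.
  have key := hgen W ![True, D.Q 1 ⬝ᵥ D.P 0 ≠ 0 ∨ D.Q 1 ⬝ᵥ w 0 ≠ 0,
    D.Q 2 ⬝ᵥ D.trans (D.P 0) l ≠ 0 ∨ D.Q 2 ⬝ᵥ D.xvec l ≠ 0 ∨ D.Q 2 ⬝ᵥ w l ≠ 0,
    D.Q 3 ⬝ᵥ D.trans (D.P 0) l ≠ 0 ∨ D.Q 3 ⬝ᵥ D.xvec l ≠ 0 ∨ D.Q 3 ⬝ᵥ w l ≠ 0] trivial ?_ ?_ ?_ ?_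
  · exact ⟨key.1 1, key.2⟩
  · intro i hi
    fin_cases i
    · exact my 0
    · rcases hi with hi | hi
      · have := (W 0).smul_mem (D.Q 1 ⬝ᵥ D.P 0)⁻¹ (mx 0)
        rwa [xvec, smul_smul, inv_mul_cancel₀ hi, one_smul] at this
      · exact h1 hi
    · exact h23 2 (Or.inl rfl) hi
    · exact h23 3 (Or.inr rfl) hi
  · intro i u hu hq
    by_contra hc
    fin_cases i
    · exact hc trivial
    · simp only [Fin.mk_one, Matrix.cons_val_one, Matrix.cons_val_zero, not_or, not_not] at hc
      refine hq (dotProduct_eq_zero_of_mem_span_triple hc.1 ?_ hc.2 hu)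
      have hx : D.Q 1 ⬝ᵥ D.xvec 0 = 0 := by
        rw [xvec, dotProduct_smul]
        simp only [trans, h.dot 1, smul_zero]
      exact hx
    · have hc' : ¬ (D.Q 2 ⬝ᵥ D.trans (D.P 0) l ≠ 0 ∨ D.Q 2 ⬝ᵥ D.xvec l ≠ 0 ∨ D.Q 2 ⬝ᵥ w l ≠ 0) := hc
      simp only [not_or, not_not] at hc'
      exact hq (dotProduct_eq_zero_of_mem_span_triple hc'.1 hc'.2.1 hc'.2.2 hu)
    · have hc' : ¬ (D.Q 3 ⬝ᵥ D.trans (D.P 0) l ≠ 0 ∨ D.Q 3 ⬝ᵥ D.xvec l ≠ 0 ∨ D.Q 3 ⬝ᵥ w l ≠ 0) := hc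
      simp only [not_or, not_not] at hc'
      exact hq (dotProduct_eq_zero_of_mem_span_triple hc'.1 hc'.2.1 hc'.2.2 hu)
  · intro k hk u hu
    refine mulVec_mem_span_triple (my (k + 1)) ?_ ?_ hu
    · rw [a_xvec]
      exact mx _
    · rw [ha k hk]
      exact Submodule.zero_mem _
  · intro k hk u hu
    refine mulVec_mem_span_triple ?_ ?_ ?_ hu
    · rw [h.b_y hk]
      exact mx _
    · rw [h.b_xvec hd hk]
      exact Submodule.zero_mem _
    · rw [hb k hk]
      exact mw _

/-- If the `y_k` and `X y_k` do not span, then `E_3` and `E_4` both provide new vectors. -/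
lemma QuiverData.IsGenerated.end_of_degenerate (hgen : D.IsGenerated l) (h : D.IsPreproj l)
    (hd : (D.Q 0 ⬝ᵥ D.P 1) * (D.Q 1 ⬝ᵥ D.P 0) = 0)
    (hB : ¬ (D.Q 1 ⬝ᵥ D.P 0 ≠ 0 ∧ ∀ k ≤ l, (cols (D.trans (D.P 0) k) (D.xvec k)).det ≠ 0)) :
    D.xvec l = 0 ∧ D.Q 2 ⬝ᵥ D.trans (D.P 0) l ≠ 0 ∧ D.Q 3 ⬝ᵥ D.trans (D.P 0) l ≠ 0 ∧
      (D.Q 2 ⬝ᵥ D.trans (D.P 0) l) • D.P 2 + (D.Q 3 ⬝ᵥ D.trans (D.P 0) l) • D.P 3 = 0 := by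
  have hX : ∀ u, (D.X l).mulVec u = (D.Q 2 ⬝ᵥ u) • D.P 2 + (D.Q 3 ⬝ᵥ u) • D.P 3 := by
    intro u
    rw [← h.last, Matrix.add_mulVec, Matrix.vecMulVec_mulVec, Matrix.vecMulVec_mulVec,
      op_smul_eq_smul, op_smul_eq_smul]
  obtain ⟨i, hi, hne, hP⟩ : ∃ i, (i = 2 ∨ i = 3) ∧
      (D.Q i ⬝ᵥ D.trans (D.P 0) l ≠ 0 ∨ D.Q i ⬝ᵥ D.xvec l ≠ 0) ∧
      D.P i ∉ Submodule.span ℂ {D.trans (D.P 0) l, D.xvec l, 0} := by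
    -- With `w = 0` the spans of `y_k` and `X y_k` would be stable, so they would exhaust the
    -- representation, against `hB`.
    by_contra! hcon
    have key := hgen.span_eq_top h hd (fun _ => 0) (fun _ _ => Matrix.mulVec_zero _)
      (fun _ _ => Matrix.mulVec_zero _) (fun h0 => absurd (dotProduct_zero _) h0)
      (fun i hi hne => hcon i hi (by simpa using hne))
    refine hB ⟨?_, fun k hk => det_cols_ne_zero_of_span (key.2 k hk)⟩
    simpa using key.1
  have hx : D.xvec l = 0 := by
    -- If `X y_l ≠ 0`, then `X² y_l = 0` makes `y_l`, `X y_l` a basis, leaving no room for a new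
    -- vector `P_i`.
    by_contra hx
    have hdet := det_cols_ne_zero_of_nilpotent (h.X_y le_rfl) (h.X_xvec hd le_rfl) hx
    obtain ⟨a, b, hab⟩ := exists_eq_smul_add_smul hdet (D.P i)
    exact hP (Submodule.mem_span_triple.2 ⟨a, b, 0, by rw [hab]; simp⟩)
  have hP0 : D.P i ≠ 0 := fun h0 => hP (by rw [h0]; exact Submodule.zero_mem _)
  have hrel := hX (D.trans (D.P 0) l)
  rw [h.X_y le_rfl, hx] at hrel
  have hne' : D.Q i ⬝ᵥ D.trans (D.P 0) l ≠ 0 := by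
    rcases hne with hne | hne
    · exact hne
    · rw [hx, dotProduct_zero] at hne
      exact absurd rfl hne
  rcases hi with rfl | rfl
  · refine ⟨hx, hne', fun h3 => ?_, hrel.symm⟩
    rw [h3, zero_smul, add_zero, eq_comm, smul_eq_zero] at hrel
    exact hrel.elim hne' hP0
  · refine ⟨hx, fun h3 => ?_, hne', hrel.symm⟩
    rw [h3, zero_smul, zero_add, eq_comm, smul_eq_zero] at hrel
    exact hrel.elim hne' hP0

lemma exists_backward_sequence (b : ℕ → Matrix (Fin 2) (Fin 2) ℂ) (l : ℕ) (u : Fin 2 → ℂ) :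
    ∃ w : ℕ → Fin 2 → ℂ, w l = u ∧ ∀ k < l, (b k).mulVec (w (k + 1)) = w k := by
  induction l generalizing u with
  | zero => exact ⟨fun _ => u, rfl, fun k hk => absurd hk (by omega)⟩
  | succ l ih =>
    obtain ⟨w, hw, hw'⟩ := ih ((b l).mulVec u)
    refine ⟨fun k => if k ≤ l then w k else u, by simp, fun k hk => ?_⟩
    beta_reduce
    by_cases hkl : k < l
    · rw [if_pos (by omega), if_pos (by omega), hw' k hkl]
    · obtain rfl : k = l := by omega
      rw [if_neg (by omega), if_pos le_rfl, hw]

/-- The vectors `w_k` which come back along the chain from `E_3`. -/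
structure QuiverData.IsReturn (l : ℕ) (D : QuiverData) (w : ℕ → Fin 2 → ℂ) : Prop where
  b : ∀ k < l, (D.b k).mulVec (w (k + 1)) = w k
  a : ∀ k < l, (D.a k).mulVec (w k) = 0
  X_zero : (D.X 0).mulVec (w 0) = 0
  P_two : (D.Q 2 ⬝ᵥ D.trans (D.P 0) l) • D.P 2 = w l
  P_three : (D.Q 3 ⬝ᵥ D.trans (D.P 0) l) • D.P 3 = -w l
  Q_two : D.Q 2 ⬝ᵥ w l = 0
  Q_three : D.Q 3 ⬝ᵥ w l = 0
  ne_two : D.Q 2 ⬝ᵥ D.trans (D.P 0) l ≠ 0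
  ne_three : D.Q 3 ⬝ᵥ D.trans (D.P 0) l ≠ 0
  xvec : D.xvec l = 0
  ne_zero : D.Q 1 ⬝ᵥ D.P 0 ≠ 0 ∨ D.Q 1 ⬝ᵥ w 0 ≠ 0
  span : ∀ k ≤ l, Submodule.span ℂ {D.trans (D.P 0) k, D.xvec k, w k} = ⊤

/-- The relation `X y_l = 0` makes the contributions of `E_3` and `E_4` opposite; `w_l` is the
former, and it is pulled back along the maps `b`. Both end forms kill it, so `X w_l = 0`; this
propagates backwards and gives `a_k w_k = 0`. The spans of `y_k`, `X y_k`, `w_k` are then stable,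
hence everything. -/
lemma QuiverData.IsGenerated.exists_isReturn (hgen : D.IsGenerated l) (h : D.IsPreproj l)
    (hd : (D.Q 0 ⬝ᵥ D.P 1) * (D.Q 1 ⬝ᵥ D.P 0) = 0)
    (hB : ¬ (D.Q 1 ⬝ᵥ D.P 0 ≠ 0 ∧ ∀ k ≤ l, (cols (D.trans (D.P 0) k) (D.xvec k)).det ≠ 0)) :
    ∃ w, D.IsReturn l w := by
  obtain ⟨hx, h2, h3, hrel⟩ := hgen.end_of_degenerate h hd hB
  obtain ⟨w, hwl, hwb⟩ := exists_backward_sequence D.b l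
    ((D.Q 2 ⬝ᵥ D.trans (D.P 0) l) • D.P 2)
  have hw3 : (D.Q 3 ⬝ᵥ D.trans (D.P 0) l) • D.P 3 = -w l := by
    rw [hwl, eq_neg_iff_add_eq_zero, add_comm, hrel]
  have hq2 : D.Q 2 ⬝ᵥ w l = 0 := by rw [hwl, dotProduct_smul, h.dot, smul_zero]
  have hq3 : D.Q 3 ⬝ᵥ w l = 0 := by
    rw [← neg_eq_zero, ← dotProduct_neg, ← hw3, dotProduct_smul, h.dot, smul_zero]
  have hXl : (D.X l).mulVec (w l) = 0 := by
    rw [← h.last, Matrix.add_mulVec, Matrix.vecMulVec_mulVec, Matrix.vecMulVec_mulVec,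
      op_smul_eq_smul, op_smul_eq_smul, hq2, hq3, zero_smul, zero_smul, add_zero]
  -- Downward induction along the chain, from `X_k b_k = b_k X_{k+1}`.
  have hXw : ∀ m ≤ l, (D.X (l - m)).mulVec (w (l - m)) = 0 := by
    intro m hm
    induction m with
    | zero => exact hXl
    | succ m ih =>
      have hk : l - (m + 1) < l := by omega
      have e : l - m = l - (m + 1) + 1 := by omega
      have ih := ih (by omega)
      rw [e, X] at ih
      rw [← h.step _ hk, ← hwb _ hk, Matrix.mulVec_mulVec, Matrix.mul_assoc,
        ← Matrix.mulVec_mulVec, ih, Matrix.mulVec_zero]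
  have hXw' : ∀ k ≤ l, (D.X k).mulVec (w k) = 0 := fun k hk => by
    have := hXw (l - k) (by omega)
    rwa [show l - (l - k) = k by omega] at this
  have ha : ∀ k < l, (D.a k).mulVec (w k) = 0 := fun k hk => by
    rw [← hwb k hk, Matrix.mulVec_mulVec]
    exact hXw' (k + 1) hk
  have hX0 := hXw' 0 (Nat.zero_le _)
  have mw : w l ∈ Submodule.span ℂ {D.trans (D.P 0) l, D.xvec l, w l} :=
    Submodule.subset_span (by simp)
  have key := hgen.span_eq_top h hd w hwb ha (fun h1 => ?_) (fun i hi _ => ?_)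
  · exact ⟨w, hwb, ha, hX0, hwl.symm, hw3, hq2, hq3, h2, h3, hx, key.1, key.2⟩
  · rw [X, Matrix.add_mulVec, Matrix.vecMulVec_mulVec, Matrix.vecMulVec_mulVec,
      op_smul_eq_smul, op_smul_eq_smul] at hX0
    refine Submodule.mem_span_triple.2 ⟨-((D.Q 1 ⬝ᵥ w 0)⁻¹ * (D.Q 0 ⬝ᵥ w 0)), 0, 0, ?_⟩
    have e := congrArg (fun v => (D.Q 1 ⬝ᵥ w 0)⁻¹ • v) hX0
    simp only [smul_add, smul_smul, smul_zero, inv_mul_cancel₀ h1, one_smul] at e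
    rw [zero_smul, zero_smul, add_zero, add_zero, neg_smul]
    exact neg_eq_of_add_eq_zero_right e
  · rcases hi with rfl | rfl
    · have := Submodule.smul_mem _ (D.Q 2 ⬝ᵥ D.trans (D.P 0) l)⁻¹ mw
      rwa [hwl, smul_smul, inv_mul_cancel₀ h2, one_smul, ← hwl] at this
    · have := Submodule.smul_mem _ (-(D.Q 3 ⬝ᵥ D.trans (D.P 0) l)⁻¹) mw
      rwa [← neg_neg (w l), ← hw3, neg_smul, smul_neg, smul_smul, inv_mul_cancel₀ h3, one_smul,
        neg_neg, hw3, neg_neg] at this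

end Degenerate

/-! ### Normal forms of degenerate representations with a returning vector. -/

section Return

variable {l : ℕ} {D : QuiverData} {w : ℕ → Fin 2 → ℂ}

/-- The second basis vector `z k` has to agree with `w k` only at the end of the chain; earlier it
may be replaced by `X y_k`, as the bent case requires. -/
lemma QuiverData.IsReturn.isBaseChange (hw : D.IsReturn l w) (h : D.IsPreproj l)
    {P₁ Q₀ Q₁ : Fin 2 → ℂ} {a b : ℕ → Matrix (Fin 2) (Fin 2) ℂ} {v u c : ℂ} {z : ℕ → Fin 2 → ℂ}
    (hv : v = 0) (hu : u = 0) (hc : c ≠ 0) (hz : z l = w l)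
    (hdet : ∀ k ≤ l, (cols (D.trans (D.P 0) k) (z k)).det ≠ 0)
    (hP : c • D.P 1 = P₁ 0 • D.P 0 + P₁ 1 • z 0)
    (hQ₀ : ![0, D.Q 0 ⬝ᵥ z 0] = Q₀)
    (hQ₁ : ![D.Q 1 ⬝ᵥ D.P 0, D.Q 1 ⬝ᵥ z 0] = c • Q₁)
    (ha : ∀ k < l, cols (D.trans (D.P 0) (k + 1)) ((D.a k).mulVec (z k)) =
      cols (D.trans (D.P 0) (k + 1)) (z (k + 1)) * a k)
    (hb : ∀ k < l, cols (D.xvec k) ((D.b k).mulVec (z (k + 1))) =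
      cols (D.trans (D.P 0) k) (z k) * b k) :
    D.IsBaseChange l (tailData P₁ Q₀ Q₁ a b v u) (fun k => cols (D.trans (D.P 0) k) (z k))
      ![1, c, D.Q 2 ⬝ᵥ D.trans (D.P 0) l, D.Q 3 ⬝ᵥ D.trans (D.P 0) l] := by
  subst hv hu
  refine ⟨fun i => ?_, rfl, hdet, fun i => ?_, fun i => ?_, fun k hk => ?_, fun k hk => ?_⟩
  · fin_cases i
    · exact one_ne_zero
    · exact hc
    · exact hw.ne_two
    · exact hw.ne_three
  · fin_cases i
    · change (1 : ℂ) • D.P 0 = (cols (D.P 0) (z 0)).mulVec ![1, 0]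
      rw [cols_mulVec, one_smul, zero_smul, add_zero]
    · have e : P₁ = ![P₁ 0, P₁ 1] := by ext i; fin_cases i <;> rfl
      change c • D.P 1 = (cols (D.P 0) (z 0)).mulVec P₁
      rw [e, cols_mulVec, hP]
    · change _ • D.P 2 = (cols (D.trans (D.P 0) l) (z l)).mulVec _
      erw [hz, hw.P_two, cols_mulVec]
      simp
    · change _ • D.P 3 = (cols (D.trans (D.P 0) l) (z l)).mulVec _
      erw [hz, hw.P_three, cols_mulVec]
      simp
  · fin_cases i
    · change Matrix.vecMul (D.Q 0) (cols (D.P 0) (z 0)) = (1 : ℂ) • Q₀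
      rw [vecMul_cols, h.dot, hQ₀, one_smul]
    · change Matrix.vecMul (D.Q 1) (cols (D.P 0) (z 0)) = c • Q₁
      rw [vecMul_cols, hQ₁]
    · change Matrix.vecMul (D.Q 2) (cols (D.trans (D.P 0) l) (z l)) = _
      rw [vecMul_cols, hz, hw.Q_two]
      simp [tailData]
    · change Matrix.vecMul (D.Q 3) (cols (D.trans (D.P 0) l) (z l)) = _
      rw [vecMul_cols, hz, hw.Q_three]
      simp [tailData]
  · rw [mul_cols]
    exact ha k hk
  · rw [mul_cols, h.b_y hk]
    exact hb k hk

lemma QuiverData.IsReturn.det_ne_zero (hw : D.IsReturn l w) {k : ℕ} (hk : k ≤ l)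
    (hx : D.xvec k = 0) : (cols (D.trans (D.P 0) k) (w k)).det ≠ 0 := by
  have := hw.span k hk
  rw [hx, Set.pair_comm] at this
  exact det_cols_ne_zero_of_span this

lemma QuiverData.xvec_eq_zero_of_le {j k : ℕ} (hjk : j ≤ k) (hj : D.xvec j = 0) :
    D.xvec k = 0 := by
  induction k, hjk using Nat.le_induction with
  | base => exact hj
  | succ k _ ih => rw [← a_xvec, ih, Matrix.mulVec_zero]

lemma QuiverData.IsReturn.mem_closure_flat {n : ℕ} {φ : CGDatum n} (hstd : HasStandardEntries φ)
    (hreg : IsRegular φ) (hw : D.IsReturn (n - 4) w) (h : D.IsPreproj (n - 4))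
    (hx : D.xvec 0 = 0) : D.toRep n ∈ closure (genericReps φ) := by
  have hx' : ∀ k, D.xvec k = 0 := fun k => xvec_eq_zero_of_le k.zero_le hx
  have hX := hw.X_zero
  rw [X, Matrix.add_mulVec, Matrix.vecMulVec_mulVec, Matrix.vecMulVec_mulVec, op_smul_eq_smul,
    op_smul_eq_smul] at hX
  -- From `X_0 y_0 = 0` either `Q_1·P_0 = 0` or `P_1 = 0`. In the first case `X_0 w_0 = 0` makes
  -- `P_1` a multiple of `P_0` and determines `p`; in the second `p = 0`.
  obtain ⟨p, hpm, hP, hQ⟩ : ∃ p, p * (D.Q 1 ⬝ᵥ D.P 0) = 0 ∧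
      D.P 1 = (p * (D.Q 1 ⬝ᵥ w 0)) • D.P 0 ∧ D.Q 0 ⬝ᵥ w 0 = -(p * (D.Q 1 ⬝ᵥ w 0) ^ 2) := by
    by_cases hm : D.Q 1 ⬝ᵥ D.P 0 = 0
    · have hw0 := hw.ne_zero.resolve_left (not_not.2 hm)
      refine ⟨-(D.Q 0 ⬝ᵥ w 0) / (D.Q 1 ⬝ᵥ w 0) ^ 2, by rw [hm, mul_zero], ?_, by field_simp⟩
      have e := congrArg (fun v => (D.Q 1 ⬝ᵥ w 0)⁻¹ • v) (eq_neg_of_add_eq_zero_right hX)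
      simp only [smul_smul, inv_mul_cancel₀ hw0, one_smul] at e
      rw [e, ← neg_smul, smul_smul]
      congr 1
      field_simp
    · have hP1 : D.P 1 = 0 := (smul_eq_zero.1 hx).resolve_left hm
      have hP0 : D.P 0 ≠ 0 := fun h0 => hm (by rw [h0, dotProduct_zero])
      rw [hP1, smul_zero, add_zero, smul_eq_zero, or_iff_left hP0] at hX
      exact ⟨0, zero_mul _, by rw [hP1, zero_mul, zero_smul], by rw [hX, zero_mul, neg_zero]⟩
  refine (hw.isBaseChange h (z := w) (c := 1) ?_ ?_ one_ne_zero rfl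
    (fun k hk => hw.det_ne_zero hk (hx' k)) ?_ ?_ ?_ (fun k hk => ?_) (fun k hk => ?_)).mem_closure
    (flatData_mem_closure hstd hreg hpm (w := D.Q 1 ⬝ᵥ w 0))
  · rw [hpm, zero_mul]
  · rw [sq, ← mul_assoc, hpm, zero_mul, neg_zero, zero_mul]
  · change (1 : ℂ) • D.P 1 =
      (p * (D.Q 1 ⬝ᵥ w 0)) • D.P 0 + (-(p * (D.Q 1 ⬝ᵥ D.P 0))) • w 0
    rw [hpm, neg_zero, zero_smul, add_zero, one_smul, hP]
  · rw [hQ]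
  · rw [one_smul]
  · rw [hw.a k hk, cols_mul, hpm]
    simp
  · rw [hw.b k hk, hx', cols_mul, hpm, sq, ← mul_assoc, hpm]
    simp

lemma QuiverData.IsReturn.mem_closure_bent {n : ℕ} {φ : CGDatum n} (hstd : HasStandardEntries φ)
    (hreg : IsRegular φ) (hw : D.IsReturn (n - 4) w) (h : D.IsPreproj (n - 4))
    (hd : (D.Q 0 ⬝ᵥ D.P 1) * (D.Q 1 ⬝ᵥ D.P 0) = 0) {j : ℕ} (hj : j + 1 ≤ n - 4)
    (hx : D.xvec (j + 1) = 0) (hx' : ∀ k ≤ j, D.xvec k ≠ 0) :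
    D.toRep n ∈ closure (genericReps φ) := by
  have hx1 : ∀ k, j + 1 ≤ k → D.xvec k = 0 := fun k hk => xvec_eq_zero_of_le hk hx
  have hh : D.Q 1 ⬝ᵥ D.P 0 ≠ 0 := fun h0 => hx' 0 j.zero_le (by
    change (D.Q 1 ⬝ᵥ D.P 0) • D.P 1 = 0
    rw [h0, zero_smul])
  have hQ0 : D.Q 0 ⬝ᵥ D.P 1 = 0 := (mul_eq_zero.1 hd).resolve_right hh
  have hdet : ∀ k ≤ j, (cols (D.trans (D.P 0) k) (D.xvec k)).det ≠ 0 := fun k hk =>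
    det_cols_ne_zero_of_nilpotent (h.X_y (by omega)) (h.X_xvec hd (by omega)) (hx' k hk)
  -- At the last position with `X y_j ≠ 0`, the map `a j` kills both `w_j` and `X y_j` but not
  -- `y_j`, so `w_j` has no `y_j` component. The coefficient `ν` is the parameter of the bent
  -- family.
  obtain ⟨ν, hν⟩ : ∃ ν : ℂ, w j = ν • D.xvec j := by
    obtain ⟨a, ν, e⟩ := exists_eq_smul_add_smul (hdet j le_rfl) (w j)
    have e' := hw.a j (by omega)
    rw [e, Matrix.mulVec_add, Matrix.mulVec_smul, Matrix.mulVec_smul, a_xvec, hx, smul_zero,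
      add_zero, smul_eq_zero] at e'
    have hy : (D.a j).mulVec (D.trans (D.P 0) j) ≠ 0 := fun h0 => by
      have := hw.det_ne_zero hj hx
      rw [trans, h0, det_cols] at this
      simp at this
    refine ⟨ν, ?_⟩
    rw [e, e'.resolve_right hy, zero_smul, zero_add]
  -- The basis uses `X y_k` as long as it is nonzero and `w_k` afterwards. The change happens at `j
  -- + 1`, which is the index passed to `bentData`.
  refine (hw.isBaseChange h (z := fun k => if k < j + 1 then D.xvec k else w k)
    (c := D.Q 1 ⬝ᵥ D.P 0) (mul_zero _) ?_ hh (if_neg (by omega)) (fun k hk => ?_) ?_ ?_ ?_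
    (fun k hk => ?_) (fun k hk => ?_)).mem_closure
    (bentData_mem_closure hstd hreg j.succ_pos hj ν)
  · rw [neg_zero, zero_mul]
  · split_ifs with hkj
    · exact hdet k (by omega)
    · exact hw.det_ne_zero hk (hx1 k (by omega))
  · change (D.Q 1 ⬝ᵥ D.P 0) • D.P 1 =
      (0 : ℂ) • D.P 0 + (1 : ℂ) • (if 0 < j + 1 then D.xvec 0 else w 0)
    rw [if_pos j.succ_pos, zero_smul, zero_add, one_smul]
    rfl
  · rw [if_pos j.succ_pos, show D.xvec 0 = (D.Q 1 ⬝ᵥ D.P 0) • D.P 1 from rfl, dotProduct_smul,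
      hQ0]
    simp
  · rw [if_pos j.succ_pos, show D.xvec 0 = (D.Q 1 ⬝ᵥ D.P 0) • D.P 1 from rfl, dotProduct_smul,
      h.dot]
    simp
  · rcases lt_trichotomy k j with hkj | rfl | hkj
    · rw [if_pos (by omega), if_pos (by omega), if_pos (by omega), a_xvec, Matrix.mul_one]
    · rw [if_pos (by omega), if_neg (by omega), a_xvec, hx, if_neg (by omega), if_pos rfl, cols_mul]
      simp
    · simp [hw.a k hk, cols_mul, show ¬ k < j + 1 by omega, show ¬ k < j by omega,
        show k ≠ j by omega]
  · rcases lt_trichotomy k j with hkj | rfl | hkj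
    · simp [hkj, Nat.lt_succ_of_lt hkj, h.b_xvec hd hk, cols_mul]
    · simp [hw.b k hk, cols_mul, hν]
    · simp [hw.b k hk, cols_mul, show ¬ k < j + 1 by omega, show ¬ k < j by omega,
        show k ≠ j by omega, hx1 k hkj]

end Return

/-- The only obstruction to deforming a degenerate chain end is a zero form `q` or `q'`, and
generation excludes it. When the chain vectors fail to be bases, the first zero of `X y_k` separates
the flat from the bent case. -/
lemma QuiverData.IsGenerated.mem_closure {n : ℕ} {φ : CGDatum n} (hstd : HasStandardEntries φ)
    (hreg : IsRegular φ) {D : QuiverData} (hgen : D.IsGenerated (n - 4))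
    (h : D.IsPreproj (n - 4)) : D.toRep n ∈ closure (genericReps φ) := by
  by_cases hd : (D.Q 0 ⬝ᵥ D.P 1) * (D.Q 1 ⬝ᵥ D.P 0) = 0
  swap
  · exact h.mem_closure_of_ne_zero hstd hreg (left_ne_zero_of_mul hd) (right_ne_zero_of_mul hd)
  by_cases hB : D.Q 1 ⬝ᵥ D.P 0 ≠ 0 ∧
      ∀ k ≤ n - 4, (cols (D.trans (D.P 0) k) (D.xvec k)).det ≠ 0
  · obtain ⟨p, q, p', q', G, γ, hend, hG, h2, h3⟩ := h.exists_chainData hB.1 (fun k hk => by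
      have := hB.2 k hk
      rw [det_cols] at this ⊢
      intro h0
      apply this
      simp only [xvec, Pi.smul_apply, smul_eq_mul]
      linear_combination (D.Q 1 ⬝ᵥ D.P 0) * h0)
    have hq : ∀ i : Fin 4, i ≠ 0 → γ i = 1 →
        (chainData ((D.Q 0 ⬝ᵥ D.P 1) * (D.Q 1 ⬝ᵥ D.P 0)) p q p' q').Q i ≠ 0 := by
      intro i hi hγ h0
      have e := hG.Q i
      rw [h0, smul_zero] at e
      have ha : attach (n - 4) i ≤ n - 4 := by
        rw [attach]
        split_ifs <;> omega
      exact hgen.Q_ne_zero hi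
        (Matrix.eq_zero_of_vecMul_eq_zero (hG.det_ne _ ha) e)
    have hq2 : q ≠ 0 := hq 2 (by decide) h2
    have hq3 : q' ≠ 0 := hq 3 (by decide) h3
    rw [hd] at hend hG
    exact hG.mem_closure (hend.mem_closure_of_zero hstd hreg hq2 hq3)
  · obtain ⟨w, hw⟩ := hgen.exists_isReturn h hd hB
    classical
    have hex : ∃ k, D.xvec k = 0 := ⟨_, hw.xvec⟩
    have hle : Nat.find hex ≤ n - 4 := Nat.find_min' hex hw.xvec
    have hspec := Nat.find_spec hex
    rcases hj : Nat.find hex with _ | j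
    · exact hw.mem_closure_flat hstd hreg h (hj ▸ hspec)
    · exact hw.mem_closure_bent hstd hreg h hd (hj ▸ hle) (hj ▸ hspec)
        fun k hk => Nat.find_min hex (by omega)

/-! ### Semistability -/

/-- A subrepresentation with full space at `E_1` can lose dimension only where `θ₂` is `+1`, so a
proper one would have negative weight. -/
lemma IsSemistable.eq_top {n : ℕ} {ρ : DoubleRep n} (h : IsSemistable (θ₂ n) ρ)
    {W : (v : Vertex n) → Submodule ℂ (Fin (dim n v) → ℂ)} (hW : IsSubrep ρ W)
    (h0 : W (E₁ n) = ⊤) : W = ⊤ := by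
  by_contra hne
  have hbot : W ≠ ⊥ := fun hb => by
    rw [hb] at h0
    exact bot_ne_top h0
  have hle : ∀ v, Module.finrank ℂ (W v) ≤ dim n v := fun v => by
    simpa using (W v).finrank_le
  obtain ⟨v, hv⟩ : ∃ v, W v ≠ ⊤ := by
    by_contra! hall
    exact hne (funext hall)
  have hlt : Module.finrank ℂ (W v) < dim n v := by
    simpa using Submodule.finrank_lt hv
  have hvE : v ≠ E₁ n := by
    rintro rfl
    exact hv h0
  have : ∑ v, θ₂ n v * (Module.finrank ℂ (W v) : ℤ) < ∑ v, θ₂ n v * (dim n v : ℤ) := by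
    refine Finset.sum_lt_sum (fun u _ => ?_) ⟨v, Finset.mem_univ v, ?_⟩
    · by_cases hu : u = E₁ n
      · subst hu
        rw [h0, finrank_top, Module.finrank_fin_fun]
      · rw [θ₂, if_neg hu, one_mul, one_mul]
        exact_mod_cast hle u
    · rw [θ₂, if_neg hvE, one_mul, one_mul]
      exact_mod_cast hlt
  rw [h.1] at this
  exact absurd (h.2 W hW hbot hne) (not_le.2 this)

open Classical in
lemma isGenerated_ofRep {n : ℕ} {ρ : DoubleRep n}
    (h : ∀ W, IsSubrep ρ W → W (E₁ n) = ⊤ → W = ⊤) : (ofRep ρ).IsGenerated (n - 4) := by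
  intro W e he hP hQ ha hb
  -- The predicate `e` becomes a choice between the full and the zero subspace at each
  -- one-dimensional vertex.
  let S : (v : Vertex n) → Submodule ℂ (Fin (dim n v) → ℂ)
    | Sum.inl i => if e i then ⊤ else ⊥
    | Sum.inr k => W k.val
  have hatt : ∀ i, attach (n - 4) i ≤ n - 4 := fun i => by
    rw [attach]
    split_ifs <;> omega
  have hS : IsSubrep ρ S := by
    rw [← toRep_ofRep ρ]
    rintro ⟨⟨i | k, j | m⟩, hij⟩ u hu
    · simp [IsArrow] at hij
    · obtain rfl := isArrow_inl_inr_iff.1 hij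
      change u ∈ (if e i then ⊤ else ⊥ : Submodule ℂ (Fin 1 → ℂ)) at hu
      change Matrix.mulVec (Matrix.of fun c (_ : Fin 1) => (ofRep ρ).P i c) u ∈
        W (chainV n (attach (n - 4) i)).val
      rw [chainV_val (hatt i)]
      have eu : Matrix.mulVec (Matrix.of fun c (_ : Fin 1) => (ofRep ρ).P i c) u =
          u 0 • (ofRep ρ).P i := by
        ext c
        simp [Matrix.mulVec, dotProduct]
        exact mul_comm _ _
      rw [eu]
      split_ifs at hu with hi
      · exact Submodule.smul_mem _ _ (hP i hi)
      · rw [Submodule.mem_bot] at hu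
        rw [hu, Pi.zero_apply, zero_smul]
        exact Submodule.zero_mem _
    · obtain rfl := isArrow_inl_inr_iff.1 hij.symm
      change u ∈ W (chainV n (attach (n - 4) j)).val at hu
      change Matrix.mulVec (Matrix.of fun (_ : Fin 1) c => (ofRep ρ).Q j c) u ∈
        (if e j then ⊤ else ⊥ : Submodule ℂ (Fin 1 → ℂ))
      rw [chainV_val (hatt j)] at hu
      split_ifs with hj
      · exact Submodule.mem_top
      · rw [Submodule.mem_bot]
        funext _
        by_contra h0
        exact hj (hQ j u hu h0)
    · change u ∈ W k.val at hu
      change Matrix.mulVec (if k.val < m.val then (ofRep ρ).a k.val else (ofRep ρ).b m.val) u ∈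
        W m.val
      rcases hij with hij | hij
      · have h' : m.val = k.val + 1 := hij
        rw [if_pos (by omega), h']
        exact ha k.val (by omega) u hu
      · have h' : k.val = m.val + 1 := hij
        rw [if_neg (by omega)]
        exact hb m.val (by omega) u (h' ▸ hu)
  have htop := h S hS (if_pos he)
  refine ⟨fun i => ?_, fun k hk => ?_⟩
  · by_contra hi
    have := congrFun htop (Sum.inl i)
    change (if e i then ⊤ else ⊥ : Submodule ℂ (Fin 1 → ℂ)) = ⊤ at this
    rw [if_neg hi] at this
    exact bot_ne_top this
  · have := congrFun htop (Sum.inr (chainV n k))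
    change W (chainV n k).val = ⊤ at this
    rwa [chainV_val hk] at this

/-- Semistable representations of the preprojective algebra lie in the image of the comparison map,
whether or not they belong to the nullcone. -/
lemma mem_imageR_of_isSemistable {n : ℕ} (hn : 4 ≤ n) {φ : CGDatum n} (hreg : IsRegular φ)
    (hstd : HasStandardEntries φ) {ρ : DoubleRep n} (hρ : ρ ∈ RepPreproj n)
    (hss : IsSemistable (θ₂ n) ρ) : ρ ∈ imageR φ := by
  have hgen : ∀ W, IsSubrep ρ W → W (E₁ n) = ⊤ → W = ⊤ := fun W hW h0 => hss.eq_top hW h0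
  have := (isGenerated_ofRep hgen).mem_closure hstd hreg (isPreproj_ofRep hρ)
  rw [toRep_ofRep] at this
  exact mem_imageR_of_mem_closure hn hreg (hstd.supportedOnArrows hreg)
    (fun W hW h0 v => by rw [hgen W hW h0]; rfl) this

end KleinianD

end

theorem mainTheorem11 (n : ℕ) (hn : 4 ≤ n) (φ₀ : KleinianD.CGDatum n)
    (hreg : KleinianD.IsRegular φ₀) (hstd : KleinianD.HasStandardEntries φ₀)
    (ρ : KleinianD.DoubleRep n) (hρ : ρ ∈ KleinianD.RepPreproj n)
    (hss : KleinianD.IsSemistable (KleinianD.θ₂ n) ρ) (hnull : ρ ∈ KleinianD.nullcone n) :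
    ρ ∈ KleinianD.imageR φ₀ :=
  KleinianD.mem_imageR_of_isSemistable hn hreg hstd hρ hss
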